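/- **Conventions.** Let $K$ be a finite simplicial complex with $n$ vertices, and let $X=(x_{i,v})$ be a real $n\times n$ matrix, with rows indexed by $[n]=\{1,\dots,n\}$ and columns by the vertices of $K$, that is *generic*: its entries are algebraically independent over $\mathbb{Q}$. Let $\bigwedge\mathbb{R}^n$ be the exterior algebra on the basis $(e_v)_{v}$ indexed by the vertices, $\bigwedge K=\bigwedge\mathbb{R}^n/(e_\sigma : \sigma\notin K)$ with quotient map $q$, $f_i=\sum_v x_{i,v}e_v$, and $f_\sigma=f_{i_1}\wedge\cdots\wedge f_{i_k}$ for $\sigma=\{i_1<\dots<i_k\}\subseteq[n]$. The (lexicographic) exterior shifting of $K$ is $$\Delta(K)=\{\sigma\subseteq[n] : q(f_\sigma)\notin\operatorname{span}_{\mathbb{R}}\{q(f_\tau) : |\tau|=|\sigma|,\ \tau<_{\mathrm{lex}}\sigma\}\}.$$ For a set $S$ of finite subsets of $\mathbb{N}$, let $\mathrm{Tail}_{\mathrm{lex}}(S,\sigma)=\{\delta\in S : |\delta|=|\sigma|,\ \delta\ge_{\mathrm{lex}}\sigma\}$. A *triangulated surface* is a triangulation of a compact connected surface without boundary, i.e.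 a finite connected simplicial complex in which the link of every vertex is a cycle. An edge $uv$ of a triangulated surface $K$ is *contractible* if $K$ is not the boundary of a tetrahedron and there is no vertex $w$ such that $uv,uw,vw\in K$ but $uvw\notin K$. Contracting $uv$ means identifying $u$ and $v$ and removing duplicate faces. **Proposition.** Let $K$ be a triangulated surface, and let $D\subseteq K$ be a pure $2$-dimensional subcomplex whose realization $|D|$ is homeomorphic to a closed disk and whose boundary $\partial D$ (the edges lying in exactly one triangle of $D$) is a triangle. Let $uv$ be an edge internal to $D$, i.e. an edge of $D$ with at least one endpoint not on $\partial D$, let $uv$ be contractible in $K$, and let $K'$ be obtained from $K$ by contracting $uv$. Then $$\mathrm{Tail}_{\mathrm{lex}}\bigl(\Delta(K),\{1,4,5\}\bigr)=\mathrm{Tail}_{\mathrm{lex}}\bigl(\Delta(K'),\{1,4,5\}\bigr),$$ for every choice of the generic matrices with which $\Delta(K)$ and $\Delta(K')$ are computed. -/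

import Mathlib

noncomputable section

namespace ExtShift

/-! ### Simplicial complexes -/

section Complexes

variable {V : Type*}

/-- The set of vertices of a simplicial complex on (some of) the elements of `V`. -/
def vertexSet (K : PreAbstractSimplicialComplex V) : Set V := {v | ({v} : Finset V) ∈ K}

/-- The `1`-skeleton of `K`, as a graph on the vertices of `K`. -/
def skeletonGraph [DecidableEq V] (K : PreAbstractSimplicialComplex V) :
    SimpleGraph (vertexSet K) where
  Adj x y := x ≠ y ∧ ({x.1, y.1} : Finset V) ∈ K
  symm.symm x y h := ⟨h.1.symm, by rw [Finset.pair_comm]; exact h.2⟩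
  loopless.irrefl x h := h.1 rfl

/-- The link of a vertex. -/
def link [DecidableEq V] (K : PreAbstractSimplicialComplex V) (v : V) :
    PreAbstractSimplicialComplex V where
  faces := {s | s.Nonempty ∧ v ∉ s ∧ insert v s ∈ K}
  isRelLowerSet_faces := fun _ hs =>
    ⟨hs.1, fun _ hts ht => ⟨ht, fun hv => hs.2.1 (hts hv),
      (K.isRelLowerSet_faces hs.2.2).2 (Finset.insert_subset_insert v hts)
        (Finset.insert_nonempty _ _)⟩⟩

/-- `L` is a cycle `c 0, c 1, …, c (m - 1)` of length `m ≥ 3`: its faces are the vertices `c i`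
and the edges `{c i, c (i + 1)}`, indices modulo `m`. -/
def IsCycle [DecidableEq V] (L : PreAbstractSimplicialComplex V) : Prop :=
  ∃ m : ℕ, 3 ≤ m ∧ ∃ c : ZMod m → V, Function.Injective c ∧
    ∀ s : Finset V, s ∈ L ↔ ∃ i : ZMod m, s = {c i} ∨ s = {c i, c (i + 1)}

/-- A (finite) triangulated surface, i.e. a triangulation of a compact connected surface without
boundary: a connected complex in which the link of every vertex is a cycle. -/
structure IsTriangulatedSurface [DecidableEq V] (K : PreAbstractSimplicialComplex V) : Prop where
  finite : (K : Set (Finset V)).Finite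
  connected : (skeletonGraph K).Connected
  link_isCycle : ∀ v ∈ vertexSet K, IsCycle (link K v)

/-- Every face lies in a `2`-face, and there are no faces of dimension greater than `2`. -/
def IsPureTwoDim (D : PreAbstractSimplicialComplex V) : Prop :=
  ∀ s ∈ D, ∃ t ∈ D, s ⊆ t ∧ t.card = 3 ∧ ∀ r ∈ D, t ⊆ r → r = t

/-- The geometric realization of `K`, in barycentric coordinates. -/
def realization [Fintype V] (K : PreAbstractSimplicialComplex V) : Set (V → ℝ) :=
  {x | (∀ v, 0 ≤ x v) ∧ ∑ v, x v = 1 ∧ ∃ s ∈ K, ∀ v, x v ≠ 0 → v ∈ s}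

/-- The realization `|D|` is homeomorphic to the closed unit disk in the Euclidean plane. -/
def IsDisk [Fintype V] (D : PreAbstractSimplicialComplex V) : Prop :=
  Nonempty (realization D ≃ₜ Metric.closedBall (0 : EuclideanSpace ℝ (Fin 2)) 1)

/-- The boundary edges of a pure `2`-dimensional complex embedded in a surface: the edges that lie
in exactly one `2`-face. -/
def IsBoundaryEdge (D : PreAbstractSimplicialComplex V) (e : Finset V) : Prop :=
  e ∈ D ∧ e.card = 2 ∧ ∃! t : Finset V, t ∈ D ∧ t.card = 3 ∧ e ⊆ t

/-- The boundary of `D` is a triangle (a cycle on three vertices). -/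
def HasTriangleBoundary (D : PreAbstractSimplicialComplex V) : Prop :=
  ∃ T : Finset V, T.card = 3 ∧ ∀ e : Finset V, IsBoundaryEdge D e ↔ e ⊆ T ∧ e.card = 2

/-- The vertices of `D` that do not lie on the boundary. -/
def IsInternalVertex (D : PreAbstractSimplicialComplex V) (v : V) : Prop :=
  v ∈ vertexSet D ∧ ∀ e, IsBoundaryEdge D e → v ∉ e

/-- The edges of `D` that are incident to an internal vertex. -/
def IsInternalEdge (D : PreAbstractSimplicialComplex V) (e : Finset V) : Prop :=
  e ∈ D ∧ e.card = 2 ∧ ∃ v ∈ e, IsInternalVertex D v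

/-- `K` contains the three edges of the triangle `abc`, but not the triangle itself. -/
def IsMissingTriangle [DecidableEq V] (K : PreAbstractSimplicialComplex V) (a b c : V) : Prop :=
  a ≠ b ∧ a ≠ c ∧ b ≠ c ∧ {a, b} ∈ K ∧ {a, c} ∈ K ∧ {b, c} ∈ K ∧ {a, b, c} ∉ K

/-- `K` is the boundary complex of a tetrahedron. -/
def IsTetrahedronBoundary (K : PreAbstractSimplicialComplex V) : Prop :=
  ∃ T : Finset V, T.card = 4 ∧ ∀ s : Finset V, s ∈ K ↔ s.Nonempty ∧ s ⊂ T

/-- The edge `uv` of the triangulated surface `K` is contractible: it lies in no missing triangle,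
and `K` is not the boundary of a tetrahedron (no edge of which is contractible). -/
def IsContractible [DecidableEq V] (K : PreAbstractSimplicialComplex V) (u v : V) : Prop :=
  u ≠ v ∧ {u, v} ∈ K ∧ (∀ w, ¬ IsMissingTriangle K u v w) ∧ ¬ IsTetrahedronBoundary K

/-- The complex obtained from `K` by identifying the vertex `v` with `u`. -/
def contract [DecidableEq V] (K : PreAbstractSimplicialComplex V) (u v : V) :
    PreAbstractSimplicialComplex V :=
  PreAbstractSimplicialComplex.map K fun w => if w = v then u else w

end Complexes

/-! ### Exterior algebraic shifting -/

/-- The strict lexicographic order on finite sets of the same size: the smallest element in which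
the two sets differ belongs to the smaller set. -/
def LexLT {ι : Type*} [LinearOrder ι] (s t : Finset ι) : Prop :=
  ∃ a ∈ s, a ∉ t ∧ ∀ b < a, (b ∈ s ↔ b ∈ t)

section Shifting

variable {V : Type*} (K : PreAbstractSimplicialComplex V)

/-- The index set `[n] = {1, …, n}`, where `n` is the number of vertices of `K`. -/
abbrev Index : Type := Finset.Icc 1 (Nat.card (vertexSet K))

/-- The exterior algebra of the real vector space with basis `e_v`, for `v` a vertex of `K`. -/
abbrev ExtAlg : Type _ := ExteriorAlgebra ℝ (vertexSet K → ℝ)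

/-- The ideal generated by the monomials `e_σ = e_{v_1} ∧ ⋯ ∧ e_{v_k}` with
`σ = {v_1, …, v_k} ∉ K`. All orderings of `σ` are allowed, which only changes `e_σ` by a sign; the
empty set counts as a face of `K`. -/
def faceIdeal [DecidableEq V] : TwoSidedIdeal (ExtAlg K) :=
  TwoSidedIdeal.span
    {x | ∃ (k : ℕ) (v : Fin k ↪ vertexSet K), 0 < k ∧
      (Finset.univ.map v).map (Function.Embedding.subtype _) ∉ K ∧
      x = ExteriorAlgebra.ιMulti ℝ k fun j => Pi.single (v j) (1 : ℝ)}

/-- The exterior face ring `⋀ K`. -/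
abbrev ExteriorFaceRing [DecidableEq V] : Type _ := (faceIdeal K).ringCon.Quotient

/-- The quotient map onto the exterior face ring. -/
def quotientMap [DecidableEq V] : ExtAlg K →+* ExteriorFaceRing K := (faceIdeal K).ringCon.mk'

variable {K}

/-- All entries of the `n × n` real matrix `X` are algebraically independent over `ℚ`. -/
def IsGeneric (X : Matrix (Index K) (vertexSet K) ℝ) : Prop :=
  AlgebraicIndependent ℚ fun p : Index K × vertexSet K => X p.1 p.2

/-- `f_σ = f_{i_1} ∧ ⋯ ∧ f_{i_k}` for `σ = {i_1 < ⋯ < i_k} ⊆ [n]`, where `f_i = ∑ v, X i v • e_v`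
is the `i`-th row of `X`. -/
def rowWedge (X : Matrix (Index K) (vertexSet K) ℝ) (s : Finset (Index K)) : ExtAlg K :=
  ExteriorAlgebra.ιMulti ℝ s.card fun j => X (s.orderEmbOfFin rfl j)

/-- The exterior algebraic shifting `Δ(K)` with respect to the lexicographic order, computed with
the matrix `X`: the sets `σ ⊆ [n]` such that `q(f_σ)` is not in the linear span of the `q(f_τ)` with
`|τ| = |σ|` and `τ` lexicographically smaller than `σ`. -/
def exteriorShift [DecidableEq V] (X : Matrix (Index K) (vertexSet K) ℝ) : Set (Finset ℕ) :=
  {σ | ∃ s : Finset (Index K), σ = s.map (Function.Embedding.subtype _) ∧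
    quotientMap K (rowWedge X s) ∉
      Submodule.span ℝ
        {y | ∃ t : Finset (Index K), LexLT t s ∧ t.card = s.card ∧
          y = quotientMap K (rowWedge X t)}}

end Shifting

/-- The members of `S` of the size of `σ` that are lexicographically at least `σ`. -/
def lexTail (S : Set (Finset ℕ)) (σ : Finset ℕ) : Set (Finset ℕ) :=
  {δ | δ ∈ S ∧ δ.card = σ.card ∧ (δ = σ ∨ LexLT σ δ)}

end ExtShift

end

/-! Dualize. A triple {i < j < k} lies in the shifting exactly when some functional on the
degree-three part of the face ring kills every lexicographically smaller `f_τ` but not the given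
one. Such functionals are alternating functions `m` on ordered triangles, that is, real 2-chains
(`quotient_notMem_span_iff`). The tail from {1,4,5} consists of the triples with i = 1 and j ≥ 4 and
of those with i ≥ 2.

For i = 1, contract `m` with the first row: `c = con m (x 1)` is an antisymmetric edge weight, the
boundary of `m` weighted by that row. Vanishing on all {1,2,l} and {1,3,l} says that `c` is in
equilibrium at every vertex for rows 2 and 3; row 1 is automatic. The remaining conditions only see
`c`, so this part of the tail depends only on the space `boundaryStress` (`isShift_one_iff`). For i
≥ 2 the contraction vanishes and `m` is a weighted cycle. On a closed connected surface its rescaled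
values agree up to sign, and genericity makes it pair nontrivially with rows 2, 3, 4. Hence only
{2,3,4} can occur, and it occurs exactly when there is a nonzero cycle
(`IsSurf.isShift_iff_of_two_le`).

It remains to compare these two invariants for K = R ∪ D and K' = R ∪ D', where D' is the contracted
disk. Capping D with its boundary triangle pqr gives a closed surface with trivial first cohomology,
whose graph carries no nonzero generic stress (`IsSurf.stress_free`). This is an induction on
vertices: some edge lies in no missing triangle (`IsSurf.exists_good_edge`), contracting it gives a
surface of the same kind, and putting its two ends at the same point lifts stress-freeness back.
Therefore weights on D in equilibrium at the interior vertices vanish there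
(`eq_zero_of_equilibrium_off`). So if a chain on K has boundary in equilibrium, its part on D has
boundary supported on pqr, hence equal to a multiple of the boundary of pqr. Conversely the boundary
of pqr bounds a chain in D, since first cohomology vanishes. For the space of boundary stresses, D
can thus be exchanged for the single triangle pqr, and so can D' (`Plug.boundaryStress_eq`); the
same exchange settles cycles (`Plug.hasCycle_iff`).

Two adjustments finish the argument: K' has one vertex and one row fewer, which is harmless because
the stresses live on the smaller vertex set (`boundaryStress_pair_iff`), and the choice of generic
matrix is irrelevant (`IsShift.of_gen`). The topology of the disk enters only through
`IsDisk.trivialH1`. -/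

namespace ExtShift

/-! ### Čech 1-cocycles on contractible spaces, via covering maps. -/

section CoveringCohomology

open Topology unitInterval

/-- A covering map onto a contractible space with nonempty total space fibres has a section. -/
theorem exists_section_of_isCoveringMap {B E : Type*} [TopologicalSpace B] [TopologicalSpace E]
    [ContractibleSpace B] {p : E → B} (cov : IsCoveringMap p) (hp : Function.Surjective p) :
    ∃ s : B → E, Continuous s ∧ ∀ b, p (s b) = b := by
  obtain ⟨y, ⟨F⟩⟩ := id_nullhomotopic B
  obtain ⟨e, he⟩ := hp y
  -- A homotopy from a constant map to the identity. Lift it starting from the constant map at `e`;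
  -- the time-one end of the lift is the section.
  let G := F.symm
  have hG : ∀ a, (G : C(I × B, B)) (0, a) = p (ContinuousMap.const B e a) := by
    intro a
    simp [G, he]
  refine ⟨fun b => cov.liftHomotopy G (ContinuousMap.const B e) hG (1, b),
    by fun_prop, fun b => ?_⟩
  have := congrFun (cov.liftHomotopy_lifts G (ContinuousMap.const B e) hG) (1, b)
  simp only [Function.comp_apply] at this
  rw [this]
  simp [G]

/-- Čech cocycles on a contractible space with values in a discrete group are coboundaries of
locally constant functions. -/
theorem exists_locallyConstant_cochain {B ι A : Type*} [TopologicalSpace B] [ContractibleSpace B]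
    [AddCommGroup A] (U : ι → Set B) (hU : ∀ i, IsOpen (U i)) (hcov : ∀ x, ∃ i, x ∈ U i)
    (z : ι → ι → A)
    (hz : ∀ i j k, ∀ x ∈ U i ∩ U j ∩ U k, z i j + z j k = z i k) :
    ∃ s : ι → B → A,
      (∀ i, ∀ C ⊆ U i, IsPreconnected C → ∀ x ∈ C, ∀ y ∈ C, s i x = s i y) ∧
      ∀ i j, ∀ x ∈ U i ∩ U j, s j x = s i x + z i j := by
  classical
  let _ : TopologicalSpace A := ⊥
  have : DiscreteTopology A := ⟨rfl⟩
  choose idx hidx using hcov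
  -- The bundle with discrete fibre `A` glued by the translations `z i j`. It is a covering, and a
  -- global section read in the charts gives the potentials.
  let Z : FiberBundleCore ι B A :=
    { baseSet := U
      isOpen_baseSet := hU
      indexAt := idx
      mem_baseSet_at := hidx
      coordChange := fun i j _ a => a + z i j
      coordChange_self := by
        intro i x hx v
        have := hz i i i x ⟨⟨hx, hx⟩, hx⟩
        have h0 : z i i = 0 := by simpa using this
        simp [h0]
      continuousOn_coordChange := by
        intro i j
        exact ((continuous_of_discreteTopology (f := fun a : A => a + z i j)).comp
          continuous_snd).continuousOn
      coordChange_comp := by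
        intro i j k x hx v
        rw [add_assoc, hz i j k x hx] }
  have cov : IsCoveringMap (Bundle.TotalSpace.proj : Bundle.TotalSpace A Z.Fiber → B) := by
    have : ∀ x, DiscreteTopology (Z.Fiber x) := fun _ => inferInstanceAs (DiscreteTopology A)
    exact FiberBundle.isCoveringMap
  obtain ⟨s, hs, hps⟩ := exists_section_of_isCoveringMap cov (fun b => ⟨⟨b, (0 : A)⟩, rfl⟩)
  have hsrc : ∀ i x, x ∈ U i → s x ∈ (Z.localTriv i).source := by
    intro i x hx
    rw [Z.mem_localTriv_source]
    change (s x).proj ∈ U i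
    rwa [hps]
  refine ⟨fun i x => ((Z.localTriv i) (s x)).2, ?_, ?_⟩
  · intro i C hC hCc x hx y hy
    have hcont : ContinuousOn (fun x => ((Z.localTriv i) (s x)).2) C := by
      refine continuous_snd.comp_continuousOn ((Z.localTriv i).continuousOn_toFun.comp
        hs.continuousOn ?_)
      intro w hw
      exact hsrc i w (hC hw)
    exact hCc.constant hcont hx hy
  · intro i j x hx
    simp only [FiberBundleCore.localTriv_apply]
    have h1 : idx (s x).1 = idx x := congrArg idx (hps x)
    have h2 := hz (idx x) i j x ⟨⟨hidx x, hx.1⟩, hx.2⟩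
    have h3 : ∀ a : A, a + z (idx (s x).1) j = (a + z (idx (s x).1) i) + z i j := by
      intro a
      rw [h1, add_assoc, h2]
    exact h3 (s x).2

end CoveringCohomology

/-! ### Simplicial first cohomology of a disk. -/

section Realization

variable {V : Type*}

/-- The ordered `2`-faces of a complex. -/
def tri (K : PreAbstractSimplicialComplex V) [DecidableEq V] (a b c : V) : Prop :=
  a ≠ b ∧ a ≠ c ∧ b ≠ c ∧ ({a, b, c} : Finset V) ∈ K

/-- Vanishing of the first cohomology with coefficients in `A` of a `2`-complex, given by
its ordered triangles. -/
def TrivialH1 (t : V → V → V → Prop) (A : Type*) [AddCommGroup A] : Prop :=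
  ∀ z : V → V → A, (∀ a b, z b a = -z a b) → (∀ a b c, t a b c → z a b + z b c = z a c) →
    ∃ φ : V → A, ∀ a b c, t a b c → z a b = φ b - φ a

variable [DecidableEq V]

theorem tri_swap {K : PreAbstractSimplicialComplex V} {a b c : V} (h : tri K a b c) :
    tri K b a c :=
  ⟨h.1.symm, h.2.2.1, h.2.1, by rw [Finset.insert_comm]; exact h.2.2.2⟩

theorem tri_rot {K : PreAbstractSimplicialComplex V} {a b c : V} (h : tri K a b c) :
    tri K b c a :=
  ⟨h.2.2.1, h.1.symm, h.2.1.symm, by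
    have : ({b, c, a} : Finset V) = {a, b, c} := by ext; simp; tauto
    rw [this]; exact h.2.2.2⟩

omit [DecidableEq V] in
theorem face_mono {K : PreAbstractSimplicialComplex V} {s t : Finset V} (hs : s ∈ K) (ht : t ⊆ s)
    (hne : t.Nonempty) : t ∈ K :=
  (K.isRelLowerSet_faces hs).2 ht hne

theorem IsPureTwoDim.exists_tri_of_edge {D : PreAbstractSimplicialComplex V} (hD : IsPureTwoDim D)
    {a b : V} (hab : a ≠ b) (h : ({a, b} : Finset V) ∈ D) : ∃ c, tri D a b c := by
  obtain ⟨t, ht, hst, hcard, -⟩ := hD _ h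
  have hc : (t \ {a, b}).card = 1 := by
    rw [Finset.card_sdiff_of_subset hst, hcard, Finset.card_pair hab]
  obtain ⟨c, hc⟩ := Finset.card_eq_one.mp hc
  have hcm : c ∈ t \ {a, b} := by rw [hc]; simp
  have hcn : c ≠ a ∧ c ≠ b := by simpa using (Finset.mem_sdiff.mp hcm).2
  refine ⟨c, hab, hcn.1.symm, hcn.2.symm, ?_⟩
  refine face_mono ht ?_ ⟨a, by simp⟩
  intro x hx
  simp only [Finset.mem_insert, Finset.mem_singleton] at hx
  rcases hx with rfl | rfl | rfl
  · exact hst (by simp)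
  · exact hst (by simp)
  · exact (Finset.mem_sdiff.mp hcm).1

/-- The open stars of the vertices cover the realization, and stars with a common point have their
centres in a common face. So a simplicial cocycle is a Čech cocycle for this cover, hence a
coboundary. The potential at a vertex is the value there of the locally constant function on its
star. -/
theorem IsDisk.trivialH1 [Fintype V] {D : PreAbstractSimplicialComplex V} (hdisk : IsDisk D)
    (A : Type*) [AddCommGroup A] : TrivialH1 (tri D) A := by
  classical
  intro z hanti hz
  obtain ⟨h⟩ := hdisk
  have : ContractibleSpace (Metric.closedBall (0 : EuclideanSpace ℝ (Fin 2)) 1) :=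
    (convex_closedBall _ _).contractibleSpace ⟨0, by simp⟩
  have : ContractibleSpace (realization D) := h.contractibleSpace
  -- The diagonal is reset to zero because antisymmetry alone does not force `z a a = 0` in
  -- characteristic two.
  let z' : V → V → A := fun a b => if a = b then 0 else z a b
  let U : V → Set (realization D) := fun v => {x | 0 < x.1 v}
  have hface : ∀ (x : realization D) (s : Finset V), s.Nonempty → (∀ v ∈ s, x ∈ U v) → s ∈ D := by
    intro x s hs hv
    obtain ⟨-, -, t, ht, hxt⟩ := x.2
    exact face_mono ht (fun v hvs => hxt v (hv v hvs).ne') hs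
  have hz' : ∀ i j k, ∀ x ∈ U i ∩ U j ∩ U k, z' i j + z' j k = z' i k := by
    rintro i j k x ⟨⟨hi, hj⟩, hk⟩
    by_cases hij : i = j
    · subst hij; simp [z']
    by_cases hjk : j = k
    · subst hjk; simp [z']
    by_cases hik : i = k
    · subst hik
      simp [z', hij, hjk, hanti i j]
    · have : tri D i j k := ⟨hij, hik, hjk, hface x {i, j, k} ⟨i, by simp⟩ (by
        simp [hi, hj, hk])⟩
      simpa [z', hij, hjk, hik] using hz _ _ _ this
  obtain ⟨s, hs, hsz⟩ := exists_locallyConstant_cochain U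
    (fun v => isOpen_lt continuous_const ((continuous_apply v).comp continuous_subtype_val))
    (by
      intro x
      by_contra! hcon
      have h0 : ∀ v, x.1 v = 0 := fun v => le_antisymm (not_lt.mp (hcon v)) (x.2.1 v)
      have := x.2.2.1
      simp [h0] at this) z' hz'
  let vert : V → V → ℝ → V → ℝ := fun a b r v =>
    (1 - r) * (Pi.single a 1 : V → ℝ) v + r * (Pi.single b 1 : V → ℝ) v
  have hvert : ∀ a b, ({a, b} : Finset V) ∈ D → ∀ r ∈ Set.Icc (0 : ℝ) 1,
      vert a b r ∈ realization D := by
    intro a b hab r hr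
    refine ⟨fun v => ?_, ?_, {a, b}, hab, fun v hv => ?_⟩
    · have h1 : 0 ≤ (Pi.single a 1 : V → ℝ) v := by
        by_cases h : v = a <;> simp [h]
      have h2 : 0 ≤ (Pi.single b 1 : V → ℝ) v := by
        by_cases h : v = b <;> simp [h]
      exact add_nonneg (mul_nonneg (by linarith [hr.2]) h1) (mul_nonneg hr.1 h2)
    · simp [vert, Finset.sum_add_distrib, ← Finset.mul_sum]
    · by_contra hcon
      simp only [Finset.mem_insert, Finset.mem_singleton, not_or] at hcon
      apply hv
      simp [vert, Pi.single_apply, hcon.1, hcon.2]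
  let x₀ : realization D := h.symm ⟨0, by simp⟩
  let e : V → realization D := fun a => if ha : ({a, a} : Finset V) ∈ D then
    ⟨vert a a 0, hvert a a ha 0 (by simp)⟩ else x₀
  -- The half edge from `a` to the midpoint of `ab` is connected and stays in the star of `a`, so `s
  -- a` agrees at its ends. The midpoint lies in both stars, where the two potentials differ by `z a
  -- b`.
  have key : ∀ a b c, tri D a b c → ∃ m : realization D, m.1 = vert a b (1 / 2) ∧ m ∈ U a ∧
      s a m = s a (e a) := by
    intro a b c ht
    have hab : ({a, b} : Finset V) ∈ D := face_mono ht.2.2.2 (by simp [Finset.insert_subset_iff])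
      ⟨a, by simp⟩
    have haa : ({a, a} : Finset V) ∈ D := face_mono hab (by simp) ⟨a, by simp⟩
    let γ : Set.Icc (0 : ℝ) (1 / 2) → realization D := fun r => ⟨vert a b r.1,
      hvert a b hab r.1 ⟨r.2.1, r.2.2.trans (by norm_num)⟩⟩
    have hγ : Continuous γ := by
      refine Continuous.subtype_mk ?_ _
      refine continuous_pi fun v => ?_
      simp only [vert]
      fun_prop
    have hγU : Set.range γ ⊆ U a := by
      rintro _ ⟨r, rfl⟩
      change 0 < (1 - r.1) * (Pi.single a 1 : V → ℝ) a + r.1 * (Pi.single b 1 : V → ℝ) a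
      have : (Pi.single b 1 : V → ℝ) a = 0 := by simp [ht.1]
      rw [this]
      have := r.2.2
      simp
      linarith
    have : PreconnectedSpace (Set.Icc (0 : ℝ) (1 / 2)) :=
      Subtype.preconnectedSpace isPreconnected_Icc
    have hpre : IsPreconnected (Set.range γ) := isPreconnected_range hγ
    let h2 : Set.Icc (0 : ℝ) (1 / 2) := ⟨1 / 2, by norm_num⟩
    let h0 : Set.Icc (0 : ℝ) (1 / 2) := ⟨0, by norm_num⟩
    have he : γ h0 = e a := by
      apply Subtype.ext
      simp only [γ, h0, e, haa, dite_true]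
      funext v
      simp [vert]
    refine ⟨γ h2, rfl, hγU ⟨h2, rfl⟩, ?_⟩
    rw [← he]
    exact hs a _ hγU hpre _ ⟨h2, rfl⟩ _ ⟨h0, rfl⟩
  refine ⟨fun v => s v (e v), fun a b c ht => ?_⟩
  obtain ⟨m, hm, hma, hsa⟩ := key a b c ht
  obtain ⟨m', hm', hmb, hsb⟩ := key b a c (tri_swap ht)
  have hmm : m = m' := by
    apply Subtype.ext
    rw [hm, hm']
    funext v
    simp only [vert]
    ring
  subst hmm
  have := hsz a b m ⟨hma, hmb⟩
  have hab : z' a b = z a b := by simp [z', ht.1]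
  rw [hsa, hsb, hab] at this
  change z a b = s b (e b) - s a (e a)
  rw [this]
  abel

end Realization

/-! ### Alternating 2-chains and fillings of triangles. -/

section Chains

variable {V : Type*}

/-- Alternating functions supported on the ordered triangles `t`, i.e. the `2`-chains of `t`. -/
structure IsAlt {k : Type*} [Ring k] (t : V → V → V → Prop) (m : V → V → V → k) : Prop where
  swap : ∀ a b c, m b a c = -m a b c
  swap' : ∀ a b c, m a c b = -m a b c
  supp : ∀ a b c, m a b c ≠ 0 → t a b c

namespace IsAlt

variable {k : Type*} [Ring k] {t s : V → V → V → Prop} {m m' : V → V → V → k}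

theorem rot (h : IsAlt t m) (a b c : V) : m b c a = m a b c := by
  rw [h.swap' b a c, h.swap a b c, neg_neg]

theorem zero : IsAlt t (0 : V → V → V → k) := ⟨by simp, by simp, by simp⟩

theorem add (h : IsAlt t m) (h' : IsAlt t m') : IsAlt t (m + m') where
  swap a b c := by simp [h.swap a b c, h'.swap a b c]; abel
  swap' a b c := by simp [h.swap' a b c, h'.swap' a b c]; abel
  supp a b c hne := by
    by_contra hcon
    have h1 : m a b c = 0 := by_contra fun h0 => hcon (h.supp _ _ _ h0)
    have h2 : m' a b c = 0 := by_contra fun h0 => hcon (h'.supp _ _ _ h0)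
    simp [h1, h2] at hne

theorem smul (h : IsAlt t m) (r : k) : IsAlt t (r • m) where
  swap a b c := by simp [h.swap a b c]
  swap' a b c := by simp [h.swap' a b c]
  supp a b c hne := h.supp a b c fun h0 => hne (by simp [h0])

theorem mono (h : IsAlt t m) (hts : ∀ a b c, t a b c → s a b c) : IsAlt s m :=
  ⟨h.swap, h.swap', fun a b c hne => hts _ _ _ (h.supp a b c hne)⟩

end IsAlt

variable [DecidableEq V] (k : Type*) [CommRing k]

/-- The `1`-chain of the oriented edge `ab`. -/
def edgeChain (a b : V) : V → V → k := fun p q =>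
  (if p = a then 1 else 0) * (if q = b then 1 else 0) -
    (if p = b then 1 else 0) * (if q = a then 1 else 0)

/-- The `1`-cycle of the oriented triangle `abc`. -/
def cycleChain (a b c : V) : V → V → k := edgeChain k a b + edgeChain k b c + edgeChain k c a

/-- The `2`-chain of the oriented triangle `abc`. -/
def triChain (a b c : V) : V → V → V → k := fun p q r =>
  edgeChain k a b p q * (if r = c then 1 else 0) + edgeChain k b c p q * (if r = a then 1 else 0) +
    edgeChain k c a p q * (if r = b then 1 else 0)

variable {k}

theorem edgeChain_swap (a b : V) : edgeChain k b a = -edgeChain k a b := by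
  funext p q
  simp only [edgeChain, Pi.neg_apply]
  ring

theorem triChain_isAlt {t : V → V → V → Prop} (hs : ∀ a b c, t a b c → t b a c)
    (hr : ∀ a b c, t a b c → t b c a) {a b c : V} (h : t a b c) :
    IsAlt t (triChain k a b c) where
  swap p q r := by simp only [triChain, edgeChain]; ring
  swap' p q r := by simp only [triChain, edgeChain]; ring
  supp p q r hne := by
    have h1 := hr _ _ _ h
    have h2 := hr _ _ _ h1
    have h3 := hs _ _ _ h
    have h4 := hs _ _ _ h1
    have h5 := hs _ _ _ h2
    by_contra hcon
    apply hne
    have e : ∀ x y z : V, t x y z → (if p = x then 1 else 0) * (if q = y then 1 else 0) *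
        (if r = z then 1 else 0) = (0 : k) := by
      intro x y z hxyz
      by_cases hp : p = x
      · by_cases hq : q = y
        · have : r ≠ z := by
            rintro rfl
            subst hp hq
            exact hcon hxyz
          simp [this]
        · simp [hq]
      · simp [hp]
    simp only [triChain, edgeChain, sub_mul, e _ _ _ h, e _ _ _ h1, e _ _ _ h2, e _ _ _ h3,
      e _ _ _ h4, e _ _ _ h5]
    simp

theorem sum_triChain_mul [Fintype V] (a b c p q : V) (f : V → k) :
    ∑ r, triChain k a b c p q r * f r =
      edgeChain k a b p q * f c + edgeChain k b c p q * f a + edgeChain k c a p q * f b := by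
  simp [triChain, add_mul, Finset.sum_add_distrib]

/-- `ab` is an edge of a triangle of `t`. -/
def E (t : V → V → V → Prop) (a b : V) : Prop := ∃ c, t a b c

/-- If the first cohomology vanishes, then a triangle formed by three edges bounds. -/
theorem exists_filling [Fintype V] {k : Type*} [Field k] {t : V → V → V → Prop}
    (hs : ∀ a b c, t a b c → t b a c) (hr : ∀ a b c, t a b c → t b c a) (hH : TrivialH1 t k)
    {a b c : V} (hab : E t a b) (hbc : E t b c) (hca : E t c a) :
    ∃ d : V → V → V → k, IsAlt t d ∧ ∀ p q, ∑ r, d p q r = cycleChain k a b c p q := by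
  let S : Submodule k (V → V → k) := Submodule.span k {y | ∃ x y' z, t x y' z ∧
    y = cycleChain k x y' z}
  by_cases hmem : cycleChain k a b c ∈ S
  · have : ∀ y ∈ S, ∃ d : V → V → V → k, IsAlt t d ∧ ∀ p q, ∑ r, d p q r = y p q := by
      intro y hy
      induction hy using Submodule.span_induction with
      | mem y hy =>
        obtain ⟨x, y', z, ht, rfl⟩ := hy
        refine ⟨triChain k x y' z, triChain_isAlt hs hr ht, fun p q => ?_⟩
        have := sum_triChain_mul x y' z p q (fun _ => (1 : k))
        simpa [cycleChain] using this
      | zero => exact ⟨0, IsAlt.zero, by simp⟩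
      | add y y' _ _ h h' =>
        obtain ⟨d, hd, e⟩ := h
        obtain ⟨d', hd', e'⟩ := h'
        exact ⟨d + d', hd.add hd', by simp [Finset.sum_add_distrib, e, e']⟩
      | smul r y _ h =>
        obtain ⟨d, hd, e⟩ := h
        exact ⟨r • d, hd.smul r, by simp [← Finset.mul_sum, e]⟩
    exact this _ hmem
  · exfalso
    -- A functional separating the cycle from all triangle boundaries is a 1-cocycle on edges; being
    -- a coboundary, it must vanish on the cycle.
    obtain ⟨ζ, hζ, hker⟩ := Submodule.exists_le_ker_of_notMem hmem
    have hz0 : ∀ x y z, t x y z → ζ (cycleChain k x y z) = 0 := fun x y z h =>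
      hker (Submodule.subset_span ⟨x, y, z, h, rfl⟩)
    obtain ⟨φ, hφ⟩ := hH (fun p q => ζ (edgeChain k p q))
      (fun p q => by rw [edgeChain_swap, map_neg]) (by
      intro x y z h
      have := hz0 x y z h
      simp only [cycleChain, map_add, edgeChain_swap x z, map_neg] at this
      linear_combination this)
    obtain ⟨_, hab⟩ := hab
    obtain ⟨_, hbc⟩ := hbc
    obtain ⟨_, hca⟩ := hca
    apply hζ
    simp only [cycleChain, map_add]
    have h1 := hφ _ _ _ hab
    have h2 := hφ _ _ _ hbc
    have h3 := hφ _ _ _ hca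
    rw [h1, h2, h3]
    ring

end Chains

/-! ### Closed surfaces as ternary relations; connectedness is stated as propagation of predicates.
-/

section Surfaces

variable {V : Type*}

/-- Combinatorial closed connected surfaces, given by their ordered triangles. -/
structure IsSurf (t : V → V → V → Prop) : Prop where
  swap : ∀ a b c, t a b c → t b a c
  rot : ∀ a b c, t a b c → t b c a
  ne : ∀ a b c, t a b c → a ≠ b
  two : ∀ a b c, t a b c → ∃ d, d ≠ c ∧ t a b d ∧ ∀ e, t a b e → e = c ∨ e = d
  link : ∀ v (f : V → Prop), (∀ a b, t v a b → f a → f b) → ∀ a b, E t v a → E t v b → f a → f b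
  conn : ∀ f : V → Prop, (∀ a b c, t a b c → f a → f b) →
    ∀ a b, (∃ a', E t a a') → (∃ b', E t b b') → f a → f b

/-- The triangles of the complex obtained by identifying `v` with `u`. -/
def contr [DecidableEq V] (t : V → V → V → Prop) (u v : V) (x y z : V) : Prop :=
  x ≠ y ∧ x ≠ z ∧ y ≠ z ∧ ∃ a b c, t a b c ∧ (if a = v then u else a) = x ∧
    (if b = v then u else b) = y ∧ (if c = v then u else c) = z

/-- A `ZMod 2`-valued symmetric function with zero diagonal has sum zero. -/
theorem sum_symm_zmod_two {α : Type*} [DecidableEq α] (s : Finset α) (f : α → α → ZMod 2)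
    (hf : ∀ a b, f a b = f b a) (h0 : ∀ a, f a a = 0) : ∑ a ∈ s, ∑ b ∈ s, f a b = 0 := by
  induction s using Finset.induction_on with
  | empty => simp
  | insert x s hx ih =>
    rw [Finset.sum_insert hx]
    simp only [Finset.sum_insert hx, h0, Finset.sum_add_distrib, ih]
    rw [Finset.sum_congr rfl fun a _ => hf a x]
    simp [CharTwo.add_self_eq_zero]

variable [DecidableEq V] {t : V → V → V → Prop} {u v : V}

theorem contr_left (hr : ∀ a b c, t a b c → t b c a)
    (hne : ∀ a b c, t a b c → a ≠ b) (huv : u ≠ v) {y z : V} :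
    contr t u v u y z ↔ (t u y z ∨ t v y z) ∧ y ≠ v ∧ z ≠ v ∧ y ≠ u ∧ z ≠ u := by
  constructor
  · rintro ⟨h1, h2, h3, a, b, c, h, ha, rfl, rfl⟩
    grind
  · rintro ⟨h, h1, h2, h3, h4⟩
    rcases h with h | h
    · exact ⟨h3.symm, h4.symm, hne _ _ _ (hr _ _ _ h),
        u, y, z, h, by simp, by simp [h1], by simp [h2]⟩
    · exact ⟨h3.symm, h4.symm, hne _ _ _ (hr _ _ _ h),
        v, y, z, h, by simp, by simp [h1], by simp [h2]⟩

theorem contr_swap (hs : ∀ a b c, t a b c → t b a c) {x y z : V} (h : contr t u v x y z) :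
    contr t u v y x z := by
  obtain ⟨h1, h2, h3, a, b, c, h, ha, hb, hc⟩ := h
  exact ⟨h1.symm, h3, h2, b, a, c, hs _ _ _ h, hb, ha, hc⟩

theorem contr_rot (hr : ∀ a b c, t a b c → t b c a) {x y z : V} (h : contr t u v x y z) :
    contr t u v y z x := by
  obtain ⟨h1, h2, h3, a, b, c, h, ha, hb, hc⟩ := h
  exact ⟨h3, h1.symm, h2.symm, b, c, a, hr _ _ _ h, hb, hc, ha⟩

theorem contr_ne (huv : u ≠ v) {x y z : V} (h : contr t u v x y z) : x ≠ v ∧ y ≠ v ∧ z ≠ v := by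
  obtain ⟨-, -, -, a, b, c, -, rfl, rfl, rfl⟩ := h
  refine ⟨?_, ?_, ?_⟩ <;> split_ifs <;> assumption

/-- Pull the cocycle back along the collapse, with value zero on collapsed edges. The potential
upstairs takes equal values at `u` and `v`, because `uv` is an edge of a triangle, and so descends.
-/
theorem TrivialH1.contr {A : Type*} [AddCommGroup A] (huv : E t u v)
    (h : TrivialH1 t A) : TrivialH1 (contr t u v) A := by
  intro z hanti hz
  let g : V → V := fun w => if w = v then u else w
  obtain ⟨φ, hφ⟩ := h (fun p q => if g p = g q then 0 else z (g p) (g q)) (by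
      intro a b
      by_cases hab : g a = g b
      · simp [hab]
      · simp [hab, Ne.symm hab, hanti (g a)]) (by
    intro a b c habc
    by_cases hab : g a = g b
    · simp [hab]
    by_cases hbc : g b = g c
    · simp [hbc]
    by_cases hac : g a = g c
    · simp [hac, Ne.symm hbc, hbc, hanti (g b)]
    have := hz (g a) (g b) (g c) ⟨hab, hac, hbc, a, b, c, habc, rfl, rfl, rfl⟩
    simpa [hab, hbc, hac] using this)
  obtain ⟨w, huv⟩ := huv
  have huv' : φ v = φ u := by
    have := hφ _ _ _ huv
    simp only [g, if_true, ite_self] at this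
    simpa [sub_eq_zero, eq_comm] using this
  have hg : ∀ w, φ (g w) = φ w := by
    intro w
    by_cases hw : w = v
    · subst hw; simp [g, huv']
    · simp [g, hw]
  refine ⟨φ, ?_⟩
  rintro x y z' ⟨hxy, -, -, a, b, c, habc, rfl, rfl, rfl⟩
  have := hφ _ _ _ habc
  change z (g a) (g b) = φ (g b) - φ (g a)
  change g a ≠ g b at hxy
  rw [hg, hg, ← this]
  simp [hxy]

end Surfaces

/-! ### Edge contraction preserves closed surfaces. -/

section Contraction

variable {V : Type*} {t : V → V → V → Prop} {u v : V}

theorem IsSurf.E_symm (h : IsSurf t) {a b : V} : E t a b → E t b a :=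
  fun ⟨c, hc⟩ => ⟨c, h.swap _ _ _ hc⟩

theorem IsSurf.E_ne (h : IsSurf t) {a b : V} : E t a b → a ≠ b :=
  fun ⟨_, hc⟩ => h.ne _ _ _ hc

theorem IsSurf.E₂ (h : IsSurf t) {a b c : V} (habc : t a b c) : E t a c :=
  ⟨b, h.swap _ _ _ (h.rot _ _ _ (h.rot _ _ _ habc))⟩

theorem IsSurf.E₃ (h : IsSurf t) {a b c : V} (habc : t a b c) : E t b c :=
  ⟨a, h.rot _ _ _ habc⟩

theorem IsSurf.swap₂ (h : IsSurf t) {a b c : V} (habc : t a b c) : t a c b :=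
  h.swap _ _ _ (h.rot _ _ _ (h.rot _ _ _ habc))

variable [DecidableEq V]

/-- The edge `uv` can be contracted: it is not in a missing triangle, and the two vertices opposite
to it do not span triangles with both `u` and `v`. -/
structure Contractible (t : V → V → V → Prop) (u v : V) : Prop where
  edge : E t u v
  miss : ∀ w, E t u w → E t v w → t u v w
  tetra : ∀ a b, a ≠ b → t u v a → t u v b → t u a b → ¬ t v a b

/-- If `uvy` is a triangle, it collapses, and what remains at the merged edge is one further
triangle on `uy` and one on `vy`; their apexes differ because the four vertices do not span a
tetrahedron. Otherwise only one of `uy`, `vy` is an edge, and both its triangles survive. -/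
theorem IsSurf.contr_two_left (h : IsSurf t) (hc : Contractible t u v) {y z : V}
    (hyz : contr t u v u y z) :
    ∃ d, d ≠ z ∧ contr t u v u y d ∧ ∀ e, contr t u v u y e → e = z ∨ e = d := by
  have huv := h.E_ne hc.edge
  have hs := h.swap
  have hr := h.rot
  have hs2 := fun a b c => h.swap₂ (a := a) (b := b) (c := c)
  simp only [contr_left h.rot h.ne huv] at hyz ⊢
  obtain ⟨hyz, hyv, hzv, hyu, hzu⟩ := hyz
  by_cases hcom : t u v y
  · obtain ⟨q, hqv, hq, hq'⟩ := h.two u y v (hs2 _ _ _ hcom)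
    obtain ⟨r, hru, hr1, hr'⟩ := h.two v y u (hr _ _ _ hcom)
    have hqr : q ≠ r := by
      rintro rfl
      exact hc.tetra y q (h.ne _ _ _ (hr _ _ _ hq)) hcom
        (hc.miss q (h.E₂ hq) (h.E₂ hr1)) hq hr1
    have hqu : q ≠ u := (h.E_ne (h.E₂ hq)).symm
    have hrv : r ≠ v := (h.E_ne (h.E₂ hr1)).symm
    have key : ∀ e, (t u y e ∨ t v y e) ∧ y ≠ v ∧ e ≠ v ∧ y ≠ u ∧ e ≠ u ↔ e = q ∨ e = r := by
      intro e
      constructor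
      · rintro ⟨h1 | h1, h2⟩
        · exact Or.inl ((hq' e h1).resolve_left h2.2.1)
        · exact Or.inr ((hr' e h1).resolve_left h2.2.2.2)
      · rintro (rfl | rfl)
        · exact ⟨Or.inl hq, hyv, hqv, hyu, hqu⟩
        · exact ⟨Or.inr hr1, hyv, hrv, hyu, hru⟩
    simp only [key]
    rcases (key z).1 ⟨hyz, hyv, hzv, hyu, hzu⟩ with rfl | rfl
    · exact ⟨r, hqr.symm, Or.inr rfl, fun e he => he⟩
    · exact ⟨q, hqr, Or.inl rfl, fun e he => he.symm⟩
  · have hnot : ¬ (E t u y ∧ E t v y) := fun hh => hcom (hc.miss y hh.1 hh.2)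
    rcases hyz with hyz | hyz
    · have hv : ∀ e, ¬ t v y e := fun e he => hnot ⟨⟨z, hyz⟩, ⟨e, he⟩⟩
      obtain ⟨d, hdz, hd, hd'⟩ := h.two u y z hyz
      refine ⟨d, hdz, ⟨Or.inl hd, hyv, ?_, hyu, (h.E_ne (h.E₂ hd)).symm⟩, ?_⟩
      · rintro rfl
        exact hcom (hs2 _ _ _ hd)
      · rintro e ⟨he | he, -⟩
        · exact hd' e he
        · exact absurd he (hv e)
    · have hv : ∀ e, ¬ t u y e := fun e he => hnot ⟨⟨e, he⟩, ⟨z, hyz⟩⟩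
      obtain ⟨d, hdz, hd, hd'⟩ := h.two v y z hyz
      refine ⟨d, hdz, ⟨Or.inr hd, hyv, (h.E_ne (h.E₂ hd)).symm, hyu, ?_⟩, ?_⟩
      · rintro rfl
        exact hcom (hs _ _ _ (hs2 _ _ _ hd))
      · rintro e ⟨he | he, -⟩
        · exact absurd he (hv e)
        · exact hd' e he

/-- The two triangles at an edge avoiding `u` and `v` could only be identified if their apexes were
`u` and `v`; then all four triangles of a tetrahedron would be present. -/
theorem IsSurf.contr_two_ne (h : IsSurf t) (hc : Contractible t u v) {x y z : V} (hx : x ≠ u)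
    (hy : y ≠ u) (hxyz : contr t u v x y z) :
    ∃ d, d ≠ z ∧ contr t u v x y d ∧ ∀ e, contr t u v x y e → e = z ∨ e = d := by
  have huv := h.E_ne hc.edge
  have hne := contr_ne huv hxyz
  obtain ⟨hxy, -, -, a, b, c, habc, ha, hb, rfl⟩ := hxyz
  have ha' : a = x := by grind
  have hb' : b = y := by grind
  subst ha' hb'
  obtain ⟨d, hdc, hd, hd'⟩ := h.two _ _ _ habc
  let g : V → V := fun w => if w = v then u else w
  have mk : ∀ e, t a b e → contr t u v a b (g e) := by
    intro e he
    have h1 := h.E_ne (h.E₂ he)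
    have h2 := h.E_ne (h.E₃ he)
    refine ⟨hxy, ?_, ?_, a, b, e, he, ha, hb, rfl⟩ <;> simp only [g] <;> split_ifs <;> assumption
  refine ⟨g d, ?_, mk d hd, ?_⟩
  · intro hg
    have h3 : (c = v ∧ d = u) ∨ (c = u ∧ d = v) := by
      simp only [g] at hg
      grind
    have h4 : t a b u ∧ t a b v := by
      rcases h3 with ⟨rfl, rfl⟩ | ⟨rfl, rfl⟩
      · exact ⟨hd, habc⟩
      · exact ⟨habc, hd⟩
    have e1 := h.rot _ _ _ (h.rot _ _ _ h4.1)
    have e2 := h.rot _ _ _ (h.rot _ _ _ h4.2)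
    exact hc.tetra a b hxy (hc.miss a ⟨_, e1⟩ ⟨_, e2⟩)
      (hc.miss b (h.E₂ e1) (h.E₂ e2)) e1 e2
  · rintro e ⟨-, -, -, a', b', c', h', ha', hb', rfl⟩
    have e1 : a' = a := by grind
    have e2 : b' = b := by grind
    subst e1 e2
    rcases hd' _ h' with rfl | rfl
    · exact Or.inl rfl
    · exact Or.inr rfl

/-- The link of an endpoint of an edge stays connected after removal of the other endpoint. -/
theorem IsSurf.link_minus [Fintype V] (h : IsSurf t) {a b : V} (hab : a ≠ b) (ha : t u v a)
    (hb : t u v b) (f : V → Prop) (hf : ∀ x y, x ≠ v → y ≠ v → t u x y → f x → f y) (hfa : f a) :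
    f b := by
  classical
  by_contra hfb
  -- Parity argument in the link graph of `u`. If `f` failed at `b`, every vertex of `C` would have
  -- two neighbours in `C`, except `a`, whose other neighbour is `v`. The degree sum would be odd.
  let C : Finset V := Finset.univ.filter fun x => E t u x ∧ x ≠ v ∧ f x
  have hzero := sum_symm_zmod_two C (fun x y => if t u x y then (1 : ZMod 2) else 0)
    (fun x y => by
      have : t u x y ↔ t u y x := ⟨h.swap₂, h.swap₂⟩
      simp [this])
    (fun x => by
      have : ¬ t u x x := fun hx => h.E_ne (h.E₃ hx) rfl
      simp [this])
  have hav : a ≠ v := (h.E_ne (h.E₃ ha)).symm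
  have haC : a ∈ C := by simp [C, h.E₂ ha, hav, hfa]
  have hone : ∀ x ∈ C, ∑ y ∈ C, (if t u x y then (1 : ZMod 2) else 0) = if x = a then 1 else 0 := by
    intro x hx
    obtain ⟨hxu, hxv, hfx⟩ : E t u x ∧ x ≠ v ∧ f x := by simpa [C] using hx
    have hmem : ∀ y, y ≠ v → t u x y → y ∈ C := fun y hyv hy => by
      simp [C, h.E₂ hy, hyv, hf x y hxv hyv hy hfx]
    rw [← Finset.sum_filter]
    split_ifs with hxa
    · subst hxa
      obtain ⟨d, hdv, hd, hd'⟩ := h.two _ _ _ (h.swap₂ ha)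
      have : C.filter (fun y => t u x y) = {d} := by
        ext y
        simp only [Finset.mem_filter, Finset.mem_singleton]
        constructor
        · rintro ⟨hy, hy'⟩
          refine (hd' y hy').resolve_left ?_
          simp only [C, Finset.mem_filter] at hy
          exact hy.2.2.1
        · rintro rfl
          exact ⟨hmem _ hdv hd, hd⟩
      simp [this]
    · obtain ⟨c, hc⟩ := hxu
      obtain ⟨d, hdc, hd, hd'⟩ := h.two _ _ _ hc
      have hnv : ∀ y, t u x y → y ≠ v := by
        rintro y hy rfl
        obtain ⟨w, -, -, hw⟩ := h.two _ _ _ ha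
        have h1 := hw b hb
        have h2 := hw x (h.swap₂ hy)
        have : x = b := by grind
        subst this
        exact hfb hfx
      have : C.filter (fun y => t u x y) = {c, d} := by
        ext y
        simp only [Finset.mem_filter, Finset.mem_insert, Finset.mem_singleton]
        constructor
        · rintro ⟨-, hy⟩
          exact hd' y hy
        · rintro (rfl | rfl)
          · exact ⟨hmem _ (hnv _ hc) hc, hc⟩
          · exact ⟨hmem _ (hnv _ hd) hd, hd⟩
      rw [this, Finset.sum_pair hdc.symm]
      exact CharTwo.add_self_eq_zero _
  rw [Finset.sum_congr rfl hone] at hzero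
  simp [haC] at hzero

/-- The link of the merged vertex is the union of the link of `u` without `v` and the link of `v`
without `u`. Each piece is connected, and both contain the two apexes `p`, `q` over `uv`. -/
theorem IsSurf.contr_link_left [Fintype V] (h : IsSurf t) (hc : Contractible t u v) (f : V → Prop)
    (hf : ∀ a b, contr t u v u a b → f a → f b) {a b : V} (ha : E (contr t u v) u a)
    (hb : E (contr t u v) u b) (hfa : f a) : f b := by
  have huv := h.E_ne hc.edge
  simp only [contr_left h.rot h.ne huv] at hf
  simp only [E, contr_left h.rot h.ne huv] at ha hb
  obtain ⟨p, hp⟩ := hc.edge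
  obtain ⟨q, hqp, hq, hq'⟩ := h.two _ _ _ hp
  have hf1 : ∀ x y, x ≠ v → y ≠ v → t u x y → f x → f y := fun x y hx hy hxy hfx =>
    hf x y ⟨Or.inl hxy, hx, hy, (h.ne _ _ _ hxy).symm, (h.E_ne (h.E₂ hxy)).symm⟩ hfx
  have hf2 : ∀ x y, x ≠ u → y ≠ u → t v x y → f x → f y := fun x y hx hy hxy hfx =>
    hf x y ⟨Or.inr hxy, (h.ne _ _ _ hxy).symm, (h.E_ne (h.E₂ hxy)).symm, hx, hy⟩ hfx
  have hpq : f p ↔ f q := ⟨h.link_minus hqp.symm hp hq f hf1, h.link_minus hqp hq hp f hf1⟩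
  have all1 : ∀ x y, E t u x → E t u y → x ≠ v → y ≠ v → f x → f y := by
    intro x y hx hy hxv hyv hfx
    -- The predicate `f` need not make sense at `v`. Giving it there the common truth value at `p`
    -- and `q`, the neighbours of `v` in the link, makes it propagate around the full link.
    have := h.link u (fun w => if w = v then f p else f w) (by
      intro c d hcd hfc
      by_cases hcv : c = v
      · subst hcv
        have hd : d ≠ c := (h.E_ne (h.E₃ hcd)).symm
        simp only [hd, if_false, if_true] at hfc ⊢
        rcases hq' d hcd with rfl | rfl
        · exact hfc
        · exact hpq.1 hfc
      · by_cases hdv : d = v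
        · subst hdv
          simp only [hcv, if_false, if_true] at hfc ⊢
          rcases hq' c (h.swap₂ hcd) with rfl | rfl
          · exact hfc
          · exact hpq.2 hfc
        · simp only [hcv, hdv, if_false] at hfc ⊢
          exact hf1 c d hcv hdv hcd hfc) x y hx hy (by simpa [hxv] using hfx)
    simpa [hyv] using this
  have all2 : ∀ x y, E t v x → E t v y → x ≠ u → y ≠ u → f x → f y := by
    intro x y hx hy hxv hyv hfx
    have hpv : t v u p := h.swap _ _ _ hp
    have := h.link v (fun w => if w = u then f p else f w) (by
      intro c d hcd hfc
      by_cases hcv : c = u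
      · subst hcv
        have hd : d ≠ c := (h.E_ne (h.E₃ hcd)).symm
        simp only [hd, if_false, if_true] at hfc ⊢
        rcases hq' d (h.swap _ _ _ hcd) with rfl | rfl
        · exact hfc
        · exact hpq.1 hfc
      · by_cases hdv : d = u
        · subst hdv
          simp only [hcv, if_false, if_true] at hfc ⊢
          rcases hq' c (h.swap _ _ _ (h.swap₂ hcd)) with rfl | rfl
          · exact hfc
          · exact hpq.2 hfc
        · simp only [hcv, hdv, if_false] at hfc ⊢
          exact hf2 c d hcv hdv hcd hfc) x y hx hy (by simpa [hxv] using hfx)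
    simpa [hyv] using this
  have hup := h.E₂ hp
  have hvp := h.E₃ hp
  have hpv : p ≠ v := (h.E_ne hvp).symm
  have hpu : p ≠ u := (h.E_ne hup).symm
  have hfp : f p := by
    obtain ⟨c, h1 | h1, h2, h3, h4, h5⟩ := ha
    · exact all1 a p ⟨c, h1⟩ hup h2 hpv hfa
    · exact all2 a p ⟨c, h1⟩ hvp h4 hpu hfa
  obtain ⟨c, h1 | h1, h2, h3, h4, h5⟩ := hb
  · exact all1 p b hup ⟨c, h1⟩ hpv h2 hfp
  · exact all2 p b hvp ⟨c, h1⟩ hpu h4 hfp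

/-- A triangle at `cd` degenerates only if its apex is identified with `c` or `d`; then the other
triangle at `cd` has a different apex and survives. -/
theorem IsSurf.contr_edge (h : IsSurf t) (hc : Contractible t u v) {c d : V} (hcd : E t c d)
    (hg : (if c = v then u else c) ≠ if d = v then u else d) :
    E (contr t u v) (if c = v then u else c) (if d = v then u else d) := by
  have huv := h.E_ne hc.edge
  obtain ⟨e, hcde⟩ := hcd
  let g : V → V := fun w => if w = v then u else w
  have hdeg : ∃ e', t c d e' ∧ g c ≠ g e' ∧ g d ≠ g e' := by
    obtain ⟨e', he', hcde', -⟩ := h.two _ _ _ hcde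
    have h1 := h.E_ne (h.E₂ hcde)
    have h2 := h.E_ne (h.E₃ hcde)
    have h3 := h.E_ne (h.E₂ hcde')
    have h4 := h.E_ne (h.E₃ hcde')
    by_cases hh : g c ≠ g e ∧ g d ≠ g e
    · exact ⟨e, hcde, hh⟩
    · refine ⟨e', hcde', ?_⟩
      simp only [g] at *
      grind
  obtain ⟨e', hcde', h1, h2⟩ := hdeg
  exact ⟨g e', hg, h1, h2, c, d, e', hcde', rfl, rfl, rfl⟩

theorem IsSurf.contr [Fintype V] (h : IsSurf t) (hc : Contractible t u v) :
    IsSurf (contr t u v) := by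
  have huv := h.E_ne hc.edge
  let g : V → V := fun w => if w = v then u else w
  refine ⟨fun _ _ _ => contr_swap h.swap, fun _ _ _ => contr_rot h.rot, fun _ _ _ hh => hh.1,
    ?_, ?_, ?_⟩
  · intro a b c habc
    by_cases hau : a = u
    · subst hau
      exact h.contr_two_left hc habc
    by_cases hbu : b = u
    · subst hbu
      obtain ⟨d, h1, h2, h3⟩ := h.contr_two_left hc (contr_swap h.swap habc)
      exact ⟨d, h1, contr_swap h.swap h2, fun e he => h3 e (contr_swap h.swap he)⟩
    · exact h.contr_two_ne hc hau hbu habc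
  · intro x f hf a b ha hb hfa
    by_cases hxu : x = u
    · subst hxu
      exact h.contr_link_left hc f hf ha hb hfa
    have lift : ∀ y, E (ExtShift.contr t u v) x y → ∃ y', E t x y' ∧ g y' = y := by
      rintro y ⟨c, -, -, -, x', y', c', h', hx', rfl, rfl⟩
      have : x' = x := by grind
      subst this
      exact ⟨y', ⟨c', h'⟩, rfl⟩
    have hxv : x ≠ v := by
      obtain ⟨c, hc⟩ := ha
      exact (contr_ne huv hc).1
    obtain ⟨a', ha', rfl⟩ := lift a ha
    obtain ⟨b', hb', rfl⟩ := lift b hb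
    refine h.link x (fun w => f (g w)) ?_ a' b' ha' hb' hfa
    intro c d hcd hfc
    by_cases hgcd : g c = g d
    · rwa [← hgcd]
    · refine hf (g c) (g d) ⟨?_, ?_, hgcd, x, c, d, hcd, by simp [hxv], rfl, rfl⟩ hfc
      · have := h.ne _ _ _ hcd
        simp only [g]
        split_ifs <;> assumption
      · have := h.E_ne (h.E₂ hcd)
        simp only [g]
        split_ifs <;> assumption
  · intro f hf a b ha hb hfa
    have lift : ∀ y, (∃ y', E (ExtShift.contr t u v) y y') → ∃ w, (∃ w', E t w w') ∧ g w = y := by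
      rintro y ⟨y', c, -, -, -, x₁, x₂, x₃, h', rfl, -, -⟩
      exact ⟨x₁, ⟨x₂, x₃, h'⟩, rfl⟩
    obtain ⟨a', ha', rfl⟩ := lift a ha
    obtain ⟨b', hb', rfl⟩ := lift b hb
    refine h.conn (fun w => f (g w)) ?_ a' b' ha' hb' hfa
    intro c d e hcde hfc
    by_cases hgcd : g c = g d
    · rwa [← hgcd]
    obtain ⟨e', he'⟩ := h.contr_edge hc ⟨e, hcde⟩ hgcd
    exact hf (g c) (g d) e' he' hfc

end Contraction

/-! ### Existence of an edge in no missing triangle. -/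

section GoodEdge

variable {V : Type*} [DecidableEq V] [Fintype V] {t : V → V → V → Prop}

theorem IsAlt.sum_two {k : Type*} [Ring k] {m : V → V → V → k} (hm : IsAlt t m)
    {a b c d : V} (hcd : d ≠ c) (hd : ∀ e, t a b e → e = c ∨ e = d) :
    ∑ r, m a b r = m a b c + m a b d := by
  rw [← Finset.sum_pair hcd.symm]
  refine (Finset.sum_subset (Finset.subset_univ _) fun e _ he => ?_).symm
  by_contra hne
  have := hd e (hm.supp _ _ _ hne)
  simp only [Finset.mem_insert, Finset.mem_singleton] at he
  exact he this

theorem zmod_two_eq {a b : ZMod 2} (h : a + b = 0) : a = b := by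
  revert a b; decide

theorem zmod_two_cases (a : ZMod 2) : a = 0 ∨ a = 1 := by
  revert a; decide

/-- `A` is one of the two sides of the closed curve `vuw`, as a mod `2` chain. -/
structure IsSide (t : V → V → V → Prop) (v u w : V) (A : V → V → V → ZMod 2) : Prop where
  alt : IsAlt t A
  bd : ∀ p q, ∑ r, A p q r = cycleChain (ZMod 2) v u w p q

/-- The neighbours of `v` that lie strictly on the side `A`. -/
def inside (t : V → V → V → Prop) (v u w : V) (A : V → V → V → ZMod 2) : Set V :=
  {x | E t v x ∧ x ≠ u ∧ x ≠ w ∧ ∀ z, t v x z → A v x z = 1}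

variable {v u w : V} {A : V → V → V → ZMod 2}

omit [Fintype V] in
theorem cycleChain_eq_zero {k : Type*} [CommRing k] {a b c p q : V} (h1 : q ≠ a) (h2 : q ≠ b)
    (h3 : q ≠ c) : cycleChain k a b c p q = 0 := by
  simp [cycleChain, edgeChain, h1, h2, h3]

theorem IsSide.const (h : IsSurf t) (hA : IsSide t v u w A) {p q r s : V} (hq : q ≠ v) (hu : q ≠ u)
    (hw : q ≠ w) (h1 : t p q r) (h2 : t p q s) : A p q r = A p q s := by
  obtain ⟨d, hdr, -, hd⟩ := h.two _ _ _ h1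
  have := hA.alt.sum_two hdr hd
  rw [hA.bd, cycleChain_eq_zero hq hu hw] at this
  rcases hd s h2 with rfl | rfl
  · rfl
  · exact zmod_two_eq this.symm

/-- All triangles at a vertex off the curve are on the same side. -/
theorem IsSide.star_const (h : IsSurf t) (hA : IsSide t v u w A) {x p q r s : V} (hx : x ≠ v)
    (hu : x ≠ u) (hw : x ≠ w) (h1 : t x p q) (h2 : t x r s) (hpq : A x p q = 1) : A x r s = 1 := by
  have edge : ∀ {p q r}, t x p q → t x p r → A x p q = 1 → A x p r = 1 := by
    intro p q r h1 h2 h3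
    have hsw : ∀ a b, A x a b = A a x b := by
      intro a b
      rw [hA.alt.swap a x b, CharTwo.neg_eq]
    rw [← h3, hsw, hsw]
    exact hA.const h hx hu hw (h.swap _ _ _ h2) (h.swap _ _ _ h1)
  have := h.link x (fun a => ∀ z, t x a z → A x a z = 1) (by
    intro a b hab ha z hz
    have h3 : A x b a = 1 := by
      rw [hA.alt.swap' x a b, CharTwo.neg_eq]
      exact ha b hab
    exact edge (h.swap₂ hab) hz h3) p r ⟨_, h1⟩ ⟨_, h2⟩ (fun z hz => edge h1 hz hpq)
  exact this s h2

/-- The sum of all triangles is a mod 2 cycle; adding it to a side gives the other side. -/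
theorem IsSide.compl (h : IsSurf t) (hA : IsSide t v u w A) :
    ∃ B, IsSide t v u w B ∧ ∀ a b c, t a b c → B a b c = 1 - A a b c := by
  classical
  let o : V → V → V → ZMod 2 := fun a b c => if t a b c then 1 else 0
  have ho : IsAlt t o := by
    refine ⟨fun a b c => ?_, fun a b c => ?_, fun a b c hne => ?_⟩
    · have : t b a c ↔ t a b c := ⟨h.swap _ _ _, h.swap _ _ _⟩
      simp [o, this, CharTwo.neg_eq]
    · have : t a c b ↔ t a b c := ⟨h.swap₂, h.swap₂⟩
      simp [o, this, CharTwo.neg_eq]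
    · by_contra hcon
      simp [o, hcon] at hne
  refine ⟨o + A, ⟨ho.add hA.alt, fun p q => ?_⟩, fun a b c habc => ?_⟩
  · have : ∑ r, o p q r = 0 := by
      by_cases hpq : E t p q
      · obtain ⟨c, hc⟩ := hpq
        obtain ⟨d, hdc, hdt, hd⟩ := h.two _ _ _ hc
        rw [ho.sum_two hdc hd]
        simp [o, hc, hdt, CharTwo.add_self_eq_zero]
      · refine Finset.sum_eq_zero fun r _ => ?_
        simp only [o, ite_eq_right_iff]
        exact fun hr => absurd ⟨r, hr⟩ hpq
    simp [Finset.sum_add_distrib, this, hA.bd]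
  · simp [o, habc, CharTwo.sub_eq_add]

/-- In a closed surface with vanishing first cohomology every vertex lies on an edge that is in no
missing triangle. -/
theorem IsSurf.exists_good_edge (h : IsSurf t) (hH : TrivialH1 t (ZMod 2)) {v x₀ : V}
    (hv : E t v x₀) : ∃ u, E t v u ∧ ∀ w, E t v w → E t u w → t v u w := by
  classical
  by_contra! hbad
  have side : ∀ {u w}, E t v u → E t v w → E t u w → ∃ A, IsSide t v u w A := by
    intro u w h1 h2 h3
    obtain ⟨d, hd, hd'⟩ := exists_filling h.swap h.rot hH h1 h3 (h.E_symm h2)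
    exact ⟨d, hd, hd'⟩
  -- Descent: a missing triangle through `v` bounds a mod 2 chain `A`. From it a second missing
  -- triangle is produced whose side contains strictly fewer neighbours of `v`.
  suffices H : ∀ n, ∀ u w A, E t v u → E t v w → E t u w → ¬ t v u w → IsSide t v u w A →
      (inside t v u w A).ncard = n → False by
    obtain ⟨w, h1, h2, h3⟩ := hbad x₀ hv
    obtain ⟨A, hA⟩ := side hv h1 h2
    exact H _ x₀ w A hv h1 h2 h3 hA rfl
  intro n
  induction n using Nat.strong_induction_on with
  | _ n ih =>
  intro u w A hu hw huw hmiss hA hn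
  have hvu := h.E_ne hu
  have hvw := h.E_ne hw
  have huw' := h.E_ne huw
  -- the triangles at the edges `vu` and `vw`
  have ends : ∀ p, p = u ∨ p = w → ∃ c d, d ≠ c ∧ t v p c ∧ t v p d ∧
      (∀ e, t v p e → e = c ∨ e = d) ∧ A v p c = 1 ∧ A v p d = 0 := by
    intro p hp
    have hpE : E t v p := by rcases hp with rfl | rfl <;> assumption
    obtain ⟨c, hc⟩ := hpE
    obtain ⟨d, hdc, hdt, hd⟩ := h.two _ _ _ hc
    have hsum := hA.alt.sum_two hdc hd
    have hone : cycleChain (ZMod 2) v u w v p = 1 := by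
      rcases hp with rfl | rfl
      · simp [cycleChain, edgeChain, hvu, hvw, hvu.symm, huw']
      · simp [cycleChain, edgeChain, hvu, hvw, hvw.symm, huw'.symm, CharTwo.neg_eq]
    rw [hA.bd, hone] at hsum
    rcases zmod_two_cases (A v p c) with h0 | h0 <;> rcases zmod_two_cases (A v p d) with h1 | h1
    · simp [h0, h1] at hsum
    · exact ⟨d, c, hdc.symm, hdt, hc, fun e he => (hd e he).symm, h1, h0⟩
    · exact ⟨c, d, hdc, hc, hdt, hd, h0, h1⟩
    · rw [h0, h1] at hsum
      exact absurd hsum (by decide)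
  -- `x` and `u'` are the apexes over `vu` on the inner and on the outer side of the curve. The edge
  -- `vx` supplies the next missing triangle.
  obtain ⟨x, u', hxu', hx, hu', hux, hAx, hAu'⟩ := ends u (Or.inl rfl)
  obtain ⟨-, w', -, -, hw', hwx, -, hAw'⟩ := ends w (Or.inr rfl)
  have hxv : x ≠ v := (h.E_ne (h.E₂ hx)).symm
  have hxu : x ≠ u := (h.E_ne (h.E₃ hx)).symm
  have hxw : x ≠ w := by rintro rfl; exact hmiss hx
  have hxA : A x u v = 1 := by
    rw [hA.alt.rot v x u, hA.alt.swap' v u x, CharTwo.neg_eq]; exact hAx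
  have hxuv : t x u v := h.swap _ _ _ (h.rot _ _ _ hx)
  have starx : ∀ r s, t x r s → A x r s = 1 := fun r s hrs =>
    hA.star_const h hxv hxu hxw hxuv hrs hxA
  have hxI : x ∈ inside t v u w A := ⟨h.E₂ hx, hxu, hxw, fun z hz => by
    rw [hA.alt.swap x v z, CharTwo.neg_eq]; exact starx _ _ (h.swap _ _ _ hz)⟩
  obtain ⟨y, hvy, hxy, hmiss'⟩ := hbad x (h.E₂ hx)
  have hyv : y ≠ v := (h.E_ne hvy).symm
  -- The whole star of `x` lies on the side `A`, so its neighbour `y` is inside or on the curve.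
  have hyI : y = u ∨ y = w ∨ y ∈ inside t v u w A := by
    by_cases hyu : y = u
    · exact Or.inl hyu
    by_cases hyw : y = w
    · exact Or.inr (Or.inl hyw)
    refine Or.inr (Or.inr ⟨hvy, hyu, hyw, fun z hz => ?_⟩)
    obtain ⟨r, hr⟩ := hxy
    have h1 := starx y r hr
    have h2 : A y x r = 1 := by rw [hA.alt.swap x y r, CharTwo.neg_eq]; exact h1
    have h3 := hA.star_const h hyv hyu hyw (h.swap _ _ _ hr) (h.swap _ _ _ hz) h2
    rw [hA.alt.swap y v z, CharTwo.neg_eq]; exact h3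
  obtain ⟨B₀, hB₀⟩ := side (h.E₂ hx) hvy hxy
  -- the part of a side of the curve `vxy` outside `A` around `v`
  have outer : ∀ B, IsSide t v x y B → ∀ p, p ≠ u → p ≠ w →
      ∑ q, (1 - A v p q) * B v p q = 0 := by
    intro B hB p hpu hpw
    by_cases hp : E t v p
    · by_cases hpI : p ∈ inside t v u w A
      · refine Finset.sum_eq_zero fun q _ => ?_
        by_cases hq : t v p q
        · simp [hpI.2.2.2 q hq]
        · have : B v p q = 0 := by
            by_contra hne
            exact hq (hB.alt.supp _ _ _ hne)
          simp [this]
      · have hpx : p ≠ x := by rintro rfl; exact hpI hxI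
        have hpy : p ≠ y := by
          rintro rfl
          rcases hyI with h1 | h1 | h1
          · exact hpu h1
          · exact hpw h1
          · exact hpI h1
        have hpv : p ≠ v := (h.E_ne hp).symm
        have hsum : ∑ q, B v p q = 0 := by rw [hB.bd, cycleChain_eq_zero hpv hpx hpy]
        rw [← hsum]
        refine Finset.sum_congr rfl fun q _ => ?_
        by_cases hq : t v p q
        · have : A v p q = 0 := by
            refine (zmod_two_cases _).resolve_right fun h1 => hpI ⟨hp, hpu, hpw, fun z hz => ?_⟩
            rw [← hA.const h hpv hpu hpw hq hz]
            exact h1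
          simp [this]
        · have : B v p q = 0 := by
            by_contra hne
            exact hq (hB.alt.supp _ _ _ hne)
          simp [this]
    · refine Finset.sum_eq_zero fun q _ => ?_
      have : B v p q = 0 := by
        by_contra hne
        exact hp ⟨q, hB.alt.supp _ _ _ hne⟩
      simp [this]
  have outer_end : ∀ B, IsSide t v x y B → ∀ p c d, d ≠ c → t v p c → t v p d →
      (∀ e, t v p e → e = c ∨ e = d) → A v p c = 1 → A v p d = 0 →
      ∑ q, (1 - A v p q) * B v p q = B v p d := by
    intro B hB p c d hdc h1 h2 h3 h4 h5
    rw [Finset.sum_eq_single d]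
    · simp [h5]
    · intro e _ hed
      by_cases he : t v p e
      · rcases h3 e he with rfl | rfl
        · simp [h4]
        · exact absurd rfl hed
      · have : B v p e = 0 := by
          by_contra hne
          exact he (hB.alt.supp _ _ _ hne)
        simp [this]
    · simp
  -- The matrix `(1 - A v p q) * B v p q` is symmetric with zero diagonal, so its entries sum to
  -- zero mod 2. Only the rows `u` and `w` can contribute, each through its single outer triangle.
  have same : ∀ B, IsSide t v x y B → B v u u' = B v w w' := by
    intro B hB
    have hs := sum_symm_zmod_two Finset.univ (fun p q => (1 - A v p q) * B v p q)
      (fun p q => by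
        rw [hA.alt.swap' v p q, hB.alt.swap' v p q, CharTwo.neg_eq, CharTwo.neg_eq])
      (fun p => by
        have : B v p p = 0 := by
          by_contra hne
          exact h.E_ne (h.E₃ (hB.alt.supp _ _ _ hne)) rfl
        simp [this])
    obtain ⟨c, d, h1, h2, h3, h4, h5, h6⟩ := ends w (Or.inr rfl)
    have hdw : d = w' := by
      rcases h4 w' hw' with rfl | rfl
      · rw [h5] at hAw'; exact absurd hAw' (by decide)
      · rfl
    subst hdw
    have e1 := outer_end B hB u x u' hxu' hx hu' hux hAx hAu'
    have e2 := outer_end B hB w c d h1 h2 h3 h4 h5 h6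
    rw [← Finset.sum_subset (Finset.subset_univ {u, w}), Finset.sum_pair huw', e1, e2] at hs
    · exact zmod_two_eq hs
    · intro p _ hp
      simp only [Finset.mem_insert, Finset.mem_singleton, not_or] at hp
      exact outer B hB p hp.1 hp.2
  -- Of the two sides of `vxy` take the one missing the outer triangle at `vu`. Connectedness of the
  -- link of `v` then puts all its triangles at `v` inside `A`, and `x` itself, now on the curve,
  -- makes the inclusion strict.
  obtain ⟨B, hB, hBu⟩ : ∃ B, IsSide t v x y B ∧ B v u u' = 0 := by
    rcases zmod_two_cases (B₀ v u u') with h0 | h0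
    · exact ⟨B₀, hB₀, h0⟩
    · obtain ⟨B, hB, hB'⟩ := hB₀.compl h
      exact ⟨B, hB, by rw [hB' _ _ _ hu', h0]; simp⟩
  have hBw : B v w w' = 0 := by rw [← same B hB, hBu]
  have hzero : ∀ p, ∑ q, (1 - A v p q) * B v p q = 0 := by
    intro p
    by_cases hpu : p = u
    · subst hpu
      rw [outer_end B hB p x u' hxu' hx hu' hux hAx hAu', hBu]
    by_cases hpw : p = w
    · subst hpw
      obtain ⟨c, d, h1, h2, h3, h4, h5, h6⟩ := ends p (Or.inr rfl)
      have hdw : d = w' := by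
        rcases h4 w' hw' with rfl | rfl
        · rw [h5] at hAw'; exact absurd hAw' (by decide)
        · rfl
      subst hdw
      rw [outer_end B hB p c d h1 h2 h3 h4 h5 h6, hBw]
    · exact outer B hB p hpu hpw
  have hsum2 : ∀ p c d, d ≠ c → (∀ e, t v p e → e = c ∨ e = d) →
      (1 - A v p c) * B v p c + (1 - A v p d) * B v p d = 0 := by
    intro p c d hdc hd
    rw [← hzero p, ← Finset.sum_pair (f := fun q => (1 - A v p q) * B v p q) hdc.symm]
    refine Finset.sum_subset (Finset.subset_univ _) fun e _ he => ?_
    have : B v p e = 0 := by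
      by_contra hne
      have := hd e (hB.alt.supp _ _ _ hne)
      simp only [Finset.mem_insert, Finset.mem_singleton] at he
      exact he this
    simp [this]
  have edge : ∀ {p q r}, t v p q → t v p r → (1 - A v p q) * B v p q = 0 →
      (1 - A v p r) * B v p r = 0 := by
    intro p q r hq hr h0
    obtain ⟨d, hdq, -, hd⟩ := h.two _ _ _ hq
    rcases hd r hr with rfl | rfl
    · exact h0
    · have := hsum2 p q r hdq hd
      rwa [h0, zero_add] at this
  have all : ∀ p z, t v p z → (1 - A v p z) * B v p z = 0 := by
    intro p z hpz
    refine h.link v (fun p => ∀ z, t v p z → (1 - A v p z) * B v p z = 0) ?_ u p hu ⟨z, hpz⟩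
      (fun z hz => edge hu' hz (by simp [hBu])) z hpz
    intro a b hab ha z hz
    have h1 := ha b hab
    refine edge (h.swap₂ hab) hz ?_
    rw [hA.alt.swap' v a b, hB.alt.swap' v a b, CharTwo.neg_eq, CharTwo.neg_eq]
    exact h1
  have hBA : ∀ p z, t v p z → B v p z = 1 → A v p z = 1 := by
    intro p z hpz h1
    have := all p z hpz
    rw [h1, mul_one, sub_eq_zero] at this
    exact this.symm
  have hsub : inside t v x y B ⊂ inside t v u w A := by
    refine ⟨fun p hp => ⟨hp.1, ?_, ?_, fun z hz => hBA p z hz (hp.2.2.2 z hz)⟩, fun hcon => ?_⟩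
    · rintro rfl
      have := hBA _ _ hu' (hp.2.2.2 _ hu')
      rw [hAu'] at this
      exact absurd this (by decide)
    · rintro rfl
      have := hBA _ _ hw' (hp.2.2.2 _ hw')
      rw [hAw'] at this
      exact absurd this (by decide)
    · exact (hcon hxI).2.1 rfl
  have hlt := Set.ncard_lt_ncard hsub (Set.toFinite _)
  exact ih _ (hn ▸ hlt) x y B (h.E₂ hx) hvy hxy hmiss' hB rfl

end GoodEdge

open scoped Matrix

/-! ### Linear algebra with generic rows. -/

section Generic

variable {V : Type*}

/-- The values `x i v`, `i ∈ I`, `v ∈ U`, are algebraically independent. -/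
def Gen (I : Finset ℕ) (U : Finset V) (x : ℕ → V → ℝ) : Prop :=
  AlgebraicIndependent ℚ fun p : I × U => x p.1 p.2

variable {I : Finset ℕ} {U : Finset V} {x : ℕ → V → ℝ}

theorem Gen.mono (h : Gen I U x) {I' : Finset ℕ} {U' : Finset V} (hI : I' ⊆ I) (hU : U' ⊆ U) :
    Gen I' U' x :=
  h.comp (fun p : I' × U' => ((⟨p.1, hI p.1.2⟩, ⟨p.2, hU p.2.2⟩) : I × U)) (by
    rintro ⟨⟨a, ha⟩, ⟨b, hb⟩⟩ ⟨⟨c, hc⟩, ⟨d, hd⟩⟩ h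
    simp at h
    simp [h])

theorem Gen.aeval_ne_zero (h : Gen I U x) {p : MvPolynomial (I × U) ℚ} (hp : p ≠ 0) :
    MvPolynomial.aeval (fun p : I × U => x p.1 p.2) p ≠ 0 :=
  fun h0 => hp ((injective_iff_map_eq_zero _).1 h p h0)

/-- Square submatrices of generic matrices are invertible. -/
theorem Gen.det_ne_zero (h : Gen I U x) {ι : Type*} [Fintype ι] [DecidableEq ι] (e : ι → ℕ)
    (he : Function.Injective e) (heI : ∀ i, e i ∈ I) (g : ι → V) (hg : Function.Injective g)
    (hgU : ∀ i, g i ∈ U) : (Matrix.of fun i j => x (e i) (g j)).det ≠ 0 := by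
  have h1 : AlgebraicIndependent ℚ fun p : ι × ι => x (e p.1) (g p.2) :=
    h.comp (fun p : ι × ι => ((⟨e p.1, heI p.1⟩, ⟨g p.2, hgU p.2⟩) : I × U)) (by
      rintro ⟨a, b⟩ ⟨c, d⟩ h
      simp only [Prod.mk.injEq, Subtype.mk.injEq] at h
      rw [he h.1, hg h.2])
  have h2 : (Matrix.of fun i j => x (e i) (g j)) =
      (Matrix.mvPolynomialX ι ι ℚ).map (MvPolynomial.aeval fun p : ι × ι => x (e p.1) (g p.2)) := by
    ext i j
    simp
  rw [h2, ← AlgHom.mapMatrix_apply, ← AlgHom.map_det]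
  exact fun h0 => Matrix.det_mvPolynomialX_ne_zero ι ℚ ((injective_iff_map_eq_zero _).1 h1 _ h0)

/-- A vector with as many entries as there are generic rows, and orthogonal to them, vanishes. -/
theorem Gen.eq_zero_of_sum_eq_zero [Fintype V] (h : Gen I U x) (hIU : I.card = U.card) (r : V → ℝ)
    (hr : ∀ a ∉ U, r a = 0) (h0 : ∀ i ∈ I, ∑ a, r a * x i a = 0) : r = 0 := by
  classical
  let e : U ≃ I := Finset.equivOfCardEq hIU.symm
  have hdet := h.det_ne_zero (fun i : U => (e i : ℕ)) (Subtype.val_injective.comp e.injective)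
    (fun i => (e i).2) (fun i : U => (i : V)) Subtype.val_injective (fun i => i.2)
  have hmul : (Matrix.of fun i j : U => x (e i) j) *ᵥ (fun j : U => r j) = 0 := by
    funext i
    have := h0 (e i) (e i).2
    rw [← Finset.sum_subset (Finset.subset_univ U) (fun a _ ha => by rw [hr a ha, zero_mul]),
      ← Finset.sum_coe_sort] at this
    simp only [Matrix.mulVec, dotProduct, Matrix.of_apply, Pi.zero_apply]
    rw [← this]
    exact Finset.sum_congr rfl fun a _ => mul_comm _ _
  have := Matrix.eq_zero_of_mulVec_eq_zero hdet hmul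
  funext a
  by_cases ha : a ∈ U
  · exact congrFun this ⟨a, ha⟩
  · exact hr a ha

theorem Gen.indep₃ [Fintype V] [DecidableEq V] (h : Gen {1, 2, 3} U x) {p q r : V} (hpq : p ≠ q)
    (hpr : p ≠ r) (hqr : q ≠ r) (hU : p ∈ U ∧ q ∈ U ∧ r ∈ U) (α : V → ℝ)
    (hα : ∀ a, a ≠ p → a ≠ q → a ≠ r → α a = 0)
    (h0 : ∀ i ∈ ({1, 2, 3} : Finset ℕ), ∑ a, α a * x i a = 0) : α = 0 := by
  refine (h.mono subset_rfl (U' := {p, q, r}) ?_).eq_zero_of_sum_eq_zero ?_ α ?_ h0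
  · simp [Finset.insert_subset_iff, hU]
  · rw [Finset.card_eq_three.2 ⟨p, q, r, hpq, hpr, hqr, rfl⟩]; rfl
  · intro a ha
    simp only [Finset.mem_insert, Finset.mem_singleton, not_or] at ha
    exact hα a ha.1 ha.2.1 ha.2.2

/-- Injectivity of a polynomial family of matrices at one point implies injectivity at every
generic point. -/
theorem mulVec_injective_of_generic {m n σ : Type*} [Fintype m] [Fintype n] [DecidableEq n]
    (M : Matrix m n (MvPolynomial σ ℚ)) {x y : σ → ℝ} (hx : AlgebraicIndependent ℚ x)
    (hy : ∀ c, (M.map (MvPolynomial.aeval y)) *ᵥ c = 0 → c = 0) (c : n → ℝ)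
    (hc : (M.map (MvPolynomial.aeval x)) *ᵥ c = 0) : c = 0 := by
  -- Over the reals a matrix is injective exactly when its Gram determinant is nonzero. That
  -- determinant is a rational polynomial, nonzero because of the point `y`, so it cannot vanish at
  -- an algebraically independent point.
  have gram : ∀ z : σ → ℝ, MvPolynomial.aeval z (M.transpose * M).det =
      ((M.map (MvPolynomial.aeval z)).transpose * M.map (MvPolynomial.aeval z)).det := by
    intro z
    rw [AlgHom.map_det]
    congr 1
    rw [AlgHom.mapMatrix_apply, ← Matrix.transpose_map]
    exact Matrix.map_mul (L := M.transpose) (f := MvPolynomial.aeval z)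
  have hdet : (M.transpose * M).det ≠ 0 := by
    intro h0
    have h1 := gram y
    rw [h0, map_zero] at h1
    obtain ⟨w, hw, hw'⟩ := Matrix.exists_mulVec_eq_zero_iff.2 h1.symm
    refine hw (hy w ?_)
    have := (Matrix.conjTranspose_mul_self_mulVec_eq_zero (M.map (MvPolynomial.aeval y)) w).1
    rw [Matrix.conjTranspose_eq_transpose_of_trivial] at this
    exact this hw'
  have hne : ((M.map (MvPolynomial.aeval x)).transpose * M.map (MvPolynomial.aeval x)).det ≠ 0 := by
    rw [← gram]
    exact fun h0 => hdet ((injective_iff_map_eq_zero _).1 hx _ h0)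
  refine Matrix.eq_zero_of_mulVec_eq_zero hne ?_
  rw [← Matrix.mulVec_mulVec, hc, Matrix.mulVec_zero]

end Generic

/-! ### Stresses as the kernel of a polynomial matrix. -/

section Stress

variable {V : Type*} [Fintype V]

/-- Antisymmetric edge weights on the graph of `t` that are in equilibrium for the rows `x i`,
`i ∈ I`. -/
structure IsStress (t : V → V → V → Prop) (I : Finset ℕ) (x : ℕ → V → ℝ) (c : V → V → ℝ) :
    Prop where
  swap : ∀ a b, c b a = -c a b
  supp : ∀ a b, c a b ≠ 0 → E t a b
  eq : ∀ i ∈ I, ∀ a, ∑ b, c a b * x i b = 0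

variable [DecidableEq V] {t : V → V → V → Prop} {I : Finset ℕ} {x y : ℕ → V → ℝ} {U : Finset V}

open Classical in
/-- The linear system defining stresses. -/
noncomputable def stressMatrix (t : V → V → V → Prop) (I : Finset ℕ) (U : Finset V) :
    Matrix ((V × V) ⊕ (V × V) ⊕ (I × V)) (V × V) (MvPolynomial (I × U) ℚ) :=
  Matrix.of fun r q => match r with
    | Sum.inl p => (if q = p then 1 else 0) + if q = p.swap then 1 else 0
    | Sum.inr (Sum.inl p) => if q = p then (if E t p.1 p.2 then 0 else 1) else 0
    | Sum.inr (Sum.inr p) => if q.1 = p.2 then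
        (if h : q.2 ∈ U then MvPolynomial.X (p.1, ⟨q.2, h⟩) else 0) else 0

/-- The three blocks of rows express antisymmetry, support and equilibrium. Variables exist only for
vertices in `U`; the default zero elsewhere is harmless, since edges end in `U`. -/
theorem isStress_iff (hU : ∀ a b, E t a b → b ∈ U) (c : V × V → ℝ) :
    ((stressMatrix t I U).map (MvPolynomial.aeval fun p : I × U => x p.1 p.2)) *ᵥ c = 0 ↔
      IsStress t I x fun a b => c (a, b) := by
  classical
  have h1 : ∀ p, (((stressMatrix t I U).map (MvPolynomial.aeval fun p : I × U => x p.1 p.2)) *ᵥ c)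
      (Sum.inl p) = c p + c p.swap := by
    intro p
    simp only [Matrix.mulVec, dotProduct, stressMatrix, Matrix.map_apply, Matrix.of_apply, map_add,
      apply_ite (MvPolynomial.aeval _), map_one, map_zero, add_mul, Finset.sum_add_distrib]
    simp
  have h2 : ∀ p, (((stressMatrix t I U).map (MvPolynomial.aeval fun p : I × U => x p.1 p.2)) *ᵥ c)
      (Sum.inr (Sum.inl p)) = if E t p.1 p.2 then 0 else c p := by
    intro p
    simp only [Matrix.mulVec, dotProduct, stressMatrix, Matrix.map_apply, Matrix.of_apply,
      apply_ite (MvPolynomial.aeval _), map_one, map_zero]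
    simp
  have h3 : ∀ i a, (((stressMatrix t I U).map (MvPolynomial.aeval fun p : I × U => x p.1 p.2)) *ᵥ c)
      (Sum.inr (Sum.inr (i, a))) = ∑ b, c (a, b) * if b ∈ U then x i b else 0 := by
    intro i a
    simp only [Matrix.mulVec, dotProduct, stressMatrix, Matrix.map_apply, Matrix.of_apply]
    rw [Fintype.sum_prod_type, Finset.sum_eq_single a]
    · refine Finset.sum_congr rfl fun b _ => ?_
      by_cases hb : b ∈ U <;> simp [hb, mul_comm]
    · intro b _ hb
      simp [hb]
    · simp
  have h4 : (∀ a b, c (a, b) ≠ 0 → E t a b) → ∀ i a,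
      ∑ b, c (a, b) * (if b ∈ U then x i b else 0) = ∑ b, c (a, b) * x i b := by
    intro hs i a
    refine Finset.sum_congr rfl fun b _ => ?_
    by_cases hb : b ∈ U
    · simp [hb]
    · have : c (a, b) = 0 := by
        by_contra hne
        exact hb (hU _ _ (hs _ _ hne))
      simp [this]
  constructor
  · intro h
    have hs : ∀ a b, c (a, b) ≠ 0 → E t a b := by
      intro a b hne
      by_contra hE
      have := h2 (a, b)
      rw [h] at this
      simp [hE, hne.symm] at this
    refine ⟨fun a b => ?_, hs, fun i hi a => ?_⟩
    · have := h1 (a, b)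
      rw [h] at this
      simp only [Pi.zero_apply, Prod.swap_prod_mk] at this
      linarith
    · have := h3 ⟨i, hi⟩ a
      rw [h] at this
      rw [← h4 hs]
      exact this.symm
  · intro h
    funext r
    rcases r with p | p | p
    · rw [h1]
      have := h.swap p.1 p.2
      simp only [Prod.swap, Pi.zero_apply]
      simp only [Prod.mk.eta] at this
      rw [this]
      ring
    · rw [h2]
      split_ifs with hE
      · rfl
      · by_contra hne
        exact hE (h.supp _ _ hne)
    · rw [show p = (p.1, p.2) from rfl, h3, h4 h.supp]
      exact h.eq _ p.1.2 _

/-- If some position admits no stress, then no generic position does. -/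
theorem stress_eq_zero_of_generic (hU : ∀ a b, E t a b → b ∈ U) (hx : Gen I U x)
    (hy : ∀ c, IsStress t I y c → c = 0) {c : V → V → ℝ} (hc : IsStress t I x c) : c = 0 := by
  have := mulVec_injective_of_generic (stressMatrix t I U) hx (y := fun p => y p.1 p.2) (by
    intro c hc
    have := hy _ ((isStress_iff hU c).1 hc)
    funext p
    exact congrFun (congrFun this p.1) p.2) (fun p => c p.1 p.2) ((isStress_iff hU _).2 hc)
  funext a b
  exact congrFun this (a, b)

end Stress

/-! ### Generic stress-freeness of surfaces with trivial first cohomology. -/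

section Acyclic

variable {V : Type*} [Fintype V] [DecidableEq V] {t : V → V → V → Prop} {x : ℕ → V → ℝ}
  {U : Finset V} {u v : V}

/-- Stress-freeness lifts along an edge contraction, with `v` placed at the position of `u`. -/
theorem IsSurf.stress_free_of_contr (h : IsSurf t) (hc : Contractible t u v)
    (hU : ∀ a b, E t a b → b ∈ U) (hx : Gen {1, 2, 3} U x)
    (hfree : ∀ c, IsStress (ExtShift.contr t u v) {1, 2, 3} x c → c = 0) (c : V → V → ℝ)
    (hcs : IsStress t {1, 2, 3} (fun i w => x i (if w = v then u else w)) c) : c = 0 := by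
  have huv := h.E_ne hc.edge
  let g : V → V := fun w => if w = v then u else w
  -- The push-forward of `c` along the collapse. Since `v` sits at the position of `u`, it is a
  -- stress of the contraction and hence zero.
  let c' : V → V → ℝ := fun a b => ∑ a', ∑ b', if g a' = a ∧ g b' = b then c a' b' else 0
  have hsw : ∀ a b, c' b a = -c' a b := by
    intro a b
    simp only [c']
    rw [Finset.sum_comm, ← Finset.sum_neg_distrib]
    refine Finset.sum_congr rfl fun a' _ => ?_
    rw [← Finset.sum_neg_distrib]
    refine Finset.sum_congr rfl fun b' _ => ?_
    rw [hcs.swap a' b']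
    simp only [and_comm (a := g b' = b)]
    split_ifs <;> simp
  have hc' : c' = 0 := by
    refine hfree c' ⟨hsw, fun a b hne => ?_, fun i hi a => ?_⟩
    · have hab : a ≠ b := by
        rintro rfl
        have := hsw a a
        exact hne (by linarith)
      obtain ⟨a', -, ha'⟩ := Finset.exists_ne_zero_of_sum_ne_zero hne
      obtain ⟨b', -, hb'⟩ := Finset.exists_ne_zero_of_sum_ne_zero ha'
      rw [ne_eq, ite_eq_right_iff, Classical.not_imp] at hb'
      obtain ⟨⟨rfl, rfl⟩, hne'⟩ := hb'
      exact h.contr_edge hc (hcs.supp _ _ hne') hab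
    · have : ∀ b, c' a b * x i b =
          ∑ a', ∑ b', if g a' = a ∧ g b' = b then c a' b' * x i (g b') else 0 := by
        intro b
        simp only [c', Finset.sum_mul]
        refine Finset.sum_congr rfl fun a' _ => Finset.sum_congr rfl fun b' _ => ?_
        split_ifs with hh
        · rw [hh.2]
        · simp
      rw [Finset.sum_congr rfl fun b _ => this b, Finset.sum_comm]
      refine Finset.sum_eq_zero fun a' _ => ?_
      rw [Finset.sum_comm]
      by_cases ha' : g a' = a
      · simp only [ha', true_and, Finset.sum_ite_eq, Finset.mem_univ, if_true]
        exact hcs.eq i hi a'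
      · simp [ha']
  have hval : ∀ a b, ∑ a', ∑ b', (if g a' = a ∧ g b' = b then c a' b' else 0) = 0 := fun a b =>
    congrFun (congrFun hc' a) b
  have hfib : ∀ a, a ≠ u → a ≠ v → ∀ w, g w = a ↔ w = a := by
    intro a h1 h2 w
    simp only [g]
    grind
  have hfibu : ∀ w, g w = u ↔ w = u ∨ w = v := by
    intro w
    simp only [g]
    grind
  have h1 : ∀ a b, a ≠ u → a ≠ v → b ≠ u → b ≠ v → c a b = 0 := by
    intro a b ha ha' hb hb'
    have := hval a b
    simp only [hfib a ha ha', hfib b hb hb', ite_and] at this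
    simpa using this
  have h2 : ∀ b, b ≠ u → b ≠ v → c u b + c v b = 0 := by
    intro b hb hb'
    have := hval u b
    simp only [hfib b hb hb', hfibu, ite_and] at this
    rw [← Finset.sum_subset (Finset.subset_univ {u, v}), Finset.sum_pair huv] at this
    · simpa using this
    · intro w _ hw
      simp only [Finset.mem_insert, Finset.mem_singleton] at hw
      simp [hw]
  obtain ⟨p, hp⟩ := hc.edge
  obtain ⟨q, hqp, hq, hq'⟩ := h.two _ _ _ hp
  -- Weights of `u` and `v` cancel in the push-forward, so a vertex carrying one carries both. It
  -- then spans a triangle with `uv`, and only `p` and `q` do.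
  have h3 : ∀ b, b ≠ u → b ≠ v → b ≠ p → b ≠ q → c u b = 0 := by
    intro b hb hb' hbp hbq
    by_contra hne
    have hne' : c v b ≠ 0 := by
      intro h0
      have := h2 b hb hb'
      rw [h0, add_zero] at this
      exact hne this
    rcases hq' b (hc.miss b (hcs.supp _ _ hne) (hcs.supp _ _ hne')) with rfl | rfl
    · exact hbp rfl
    · exact hbq rfl
  have hdiag : ∀ a, c a a = 0 := fun a => by
    have := hcs.swap a a
    linarith
  have hpv := (h.E_ne (h.E₃ hp)).symm
  have hqv := (h.E_ne (h.E₃ hq)).symm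
  have hpu := (h.E_ne (h.E₂ hp)).symm
  have hqu := (h.E_ne (h.E₂ hq)).symm
  -- Equilibrium at `u` now involves only `v`, `p`, `q`. As `v` is placed at `u`, the weight `c u v`
  -- is recorded at `u`, and the positions of `u`, `p`, `q` are independent.
  have hα := hx.indep₃ hpu.symm hqu.symm hqp.symm
    ⟨hU _ _ (h.E_symm hc.edge), hU _ _ (h.E₂ hp), hU _ _ (h.E₂ hq)⟩
    (fun b => if b = u then c u v else if b = v then 0 else c u b) (by
      intro b hbu hbp hbq
      by_cases hbv : b = v
      · simp [hbv, huv.symm]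
      · simp [hbu, hbv, h3 b hbu hbv hbp hbq]) (by
      intro i hi
      refine Eq.trans ?_ (hcs.eq i hi u)
      rw [← Finset.sum_subset (Finset.subset_univ {u, p, q}),
        ← Finset.sum_subset (Finset.subset_univ {v, p, q})]
      · rw [Finset.sum_insert (by simp [hpu.symm, hqu.symm]), Finset.sum_pair hqp.symm,
          Finset.sum_insert (by simp [hpv.symm, hqv.symm]), Finset.sum_pair hqp.symm]
        simp [hpu, hpv, hqu, hqv]
      · intro b _ hb
        simp only [Finset.mem_insert, Finset.mem_singleton, not_or] at hb
        by_cases hbu : b = u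
        · simp [hbu, hdiag]
        · simp [h3 b hbu hb.1 hb.2.1 hb.2.2]
      · intro b _ hb
        simp only [Finset.mem_insert, Finset.mem_singleton, not_or] at hb
        by_cases hbv : b = v
        · simp [hbv, huv.symm]
        · simp [hb.1, hbv, h3 b hb.1 hbv hb.2.1 hb.2.2])
  have hcu : ∀ b, c u b = 0 := by
    intro b
    by_cases hbu : b = u
    · rw [hbu, hdiag]
    by_cases hbv : b = v
    · have := congrFun hα u
      simpa [hbv] using this
    · have := congrFun hα b
      simpa [hbu, hbv] using this
  have hcv : ∀ b, c v b = 0 := by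
    intro b
    by_cases hbu : b = u
    · rw [hbu, hcs.swap u v, hcu, neg_zero]
    by_cases hbv : b = v
    · rw [hbv, hdiag]
    · have := h2 b hbu hbv
      rwa [hcu, zero_add] at this
  funext a b
  by_cases hau : a = u
  · rw [hau, hcu]; rfl
  by_cases hav : a = v
  · rw [hav, hcv]; rfl
  by_cases hbu : b = u
  · rw [hbu, hcs.swap u a, hcu, neg_zero]; rfl
  by_cases hbv : b = v
  · rw [hbv, hcs.swap v a, hcv, neg_zero]; rfl
  exact h1 a b hau hav hbu hbv

omit [Fintype V] [DecidableEq V] in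
/-- A surface in which an edge violates the last condition of contractibility is the boundary of a
tetrahedron. -/
theorem IsSurf.tetra_vertices (h : IsSurf t) {a b : V} (hab : a ≠ b) (h1 : t u v a) (h2 : t u v b)
    (h3 : t u a b) (h4 : t v a b) {w z : V} (hw : E t w z) : w = u ∨ w = v ∨ w = a ∨ w = b := by
  have key : ∀ u v a b, a ≠ b → t u v a → t u v b → t u a b → ∀ z, E t u z →
      z = v ∨ z = a ∨ z = b := by
    intro u v a b hab h1 h2 h3 z hz
    refine h.link u (fun z => z = v ∨ z = a ∨ z = b) ?_ v z ⟨_, h1⟩ hz (Or.inl rfl)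
    have nbr : ∀ {p q r s : V}, q ≠ r → t u p q → t u p r → t u p s → s = q ∨ s = r := by
      intro p q r s hqr hq hr hs
      obtain ⟨d, -, -, hd⟩ := h.two _ _ _ hq
      have e1 := hd r hr
      have e2 := hd s hs
      grind
    have hva : v ≠ a := h.E_ne (h.E₃ h1)
    have hvb : v ≠ b := h.E_ne (h.E₃ h2)
    rintro p q hpq (rfl | rfl | rfl)
    · rcases nbr hab h1 h2 hpq with e | e <;> simp [e]
    · rcases nbr hvb (h.swap₂ h1) h3 hpq with e | e <;> simp [e]
    · rcases nbr hva (h.swap₂ h2) (h.swap₂ h3) hpq with e | e <;> simp [e]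
  have hu := key u v a b hab h1 h2 h3
  have hv := key v u a b hab (h.swap _ _ _ h1) (h.swap _ _ _ h2) h4
  have ha := key a u v b (h.E_ne (h.E₃ h2)) (h.rot _ _ _ (h.rot _ _ _ h1)) (h.swap _ _ _ h3)
    (h.swap _ _ _ h4)
  have hb := key b u v a (h.E_ne (h.E₃ h1)) (h.rot _ _ _ (h.rot _ _ _ h2))
    (h.rot _ _ _ (h.rot _ _ _ h3)) (h.rot _ _ _ (h.rot _ _ _ h4))
  refine h.conn (fun w => w = u ∨ w = v ∨ w = a ∨ w = b) ?_ u w ⟨v, _, h1⟩ ⟨z, hw⟩ (Or.inl rfl)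
  rintro p q r hpq (rfl | rfl | rfl | rfl)
  · have := hu q ⟨_, hpq⟩; tauto
  · have := hv q ⟨_, hpq⟩; tauto
  · have := ha q ⟨_, hpq⟩; tauto
  · have := hb q ⟨_, hpq⟩; tauto

/-- The graph of a triangulated sphere admits no nonzero stress in generic position. -/
theorem IsSurf.stress_free (h : IsSurf t) (hH : TrivialH1 t (ZMod 2))
    (hU : ∀ a b, E t a b → b ∈ U) (hx : Gen {1, 2, 3} U x) {c : V → V → ℝ}
    (hc : IsStress t {1, 2, 3} x c) : c = 0 := by
  induction hn : U.card using Nat.strong_induction_on generalizing U t c with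
  | _ n ih =>
  by_cases hE : ∃ a b, E t a b
  swap
  · funext a b
    by_contra hne
    exact hE ⟨a, b, hc.supp _ _ hne⟩
  obtain ⟨u, b, hub⟩ := hE
  obtain ⟨v, huv, hmiss⟩ := h.exists_good_edge hH hub
  -- Base case: on a tetrahedron the stress at each vertex is a relation among three independent
  -- vectors.
  by_cases htet : ∃ a b, a ≠ b ∧ t u v a ∧ t u v b ∧ t u a b ∧ t v a b
  · obtain ⟨p, q, hpq, h1, h2, h3, h4⟩ := htet
    have hvert := fun w z (hw : E t w z) => h.tetra_vertices hpq h1 h2 h3 h4 hw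
    have huv' := h.E_ne huv
    have hup := h.E_ne (h.E₂ h1)
    have huq := h.E_ne (h.E₂ h2)
    have hvp := h.E_ne (h.E₃ h1)
    have hvq := h.E_ne (h.E₃ h2)
    have hd : ∀ a, c a a = 0 := fun a => by
      have := hc.swap a a
      linarith
    have row : ∀ a, ∀ b₁ b₂ b₃, b₁ ≠ b₂ → b₁ ≠ b₃ → b₂ ≠ b₃ → (b₁ ∈ U ∧ b₂ ∈ U ∧ b₃ ∈ U) →
        (∀ w, (w = u ∨ w = v ∨ w = p ∨ w = q) → w = a ∨ w = b₁ ∨ w = b₂ ∨ w = b₃) → c a = 0 := by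
      intro a b₁ b₂ b₃ e1 e2 e3 hbU hw
      refine hx.indep₃ e1 e2 e3 hbU (c a) (fun w w1 w2 w3 => ?_) (fun i hi => hc.eq i hi a)
      by_contra hne
      rcases hw w (hvert w a (h.E_symm (hc.supp _ _ hne))) with rfl | rfl | rfl | rfl
      · exact hne (hd _)
      · exact w1 rfl
      · exact w2 rfl
      · exact w3 rfl
    have mu : u ∈ U := hU _ _ (h.E_symm huv)
    have mv : v ∈ U := hU _ _ huv
    have mp : p ∈ U := hU _ _ (h.E₂ h1)
    have mq : q ∈ U := hU _ _ (h.E₂ h2)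
    funext a
    by_cases ha : ∃ b, c a b ≠ 0
    · obtain ⟨b, hb⟩ := ha
      rcases hvert a b (hc.supp _ _ hb) with rfl | rfl | rfl | rfl
      · exact row _ v p q hvp hvq hpq ⟨mv, mp, mq⟩ (by tauto)
      · exact row _ u p q hup huq hpq ⟨mu, mp, mq⟩ (by tauto)
      · exact row _ u v q huv' huq hvq ⟨mu, mv, mq⟩ (by tauto)
      · exact row _ u v p huv' hup hvp ⟨mu, mv, mp⟩ (by tauto)
    · funext b
      by_contra hne
      exact ha ⟨b, hne⟩
  · have hcon : Contractible t u v := ⟨huv, fun w h1 h2 => hmiss w h1 h2,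
      fun a b hab h1 h2 h3 h4 => htet ⟨a, b, hab, h1, h2, h3, h4⟩⟩
    -- Specialize by placing `v` at `u`: stress-freeness at this one position, inherited from the
    -- contraction, gives it at every generic position.
    refine stress_eq_zero_of_generic hU hx (h.stress_free_of_contr hcon hU hx fun c' hc' => ?_) hc
    have hvU : v ∈ U := hU _ _ huv
    refine ih (U.erase v).card (hn ▸ Finset.card_erase_lt_of_mem hvU) (U := U.erase v)
      (h.contr hcon) (hH.contr huv) ?_ (hx.mono subset_rfl (Finset.erase_subset _ _)) hc' rfl
    rintro a b ⟨z, hz⟩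
    refine Finset.mem_erase.2 ⟨(contr_ne (h.E_ne huv) hz).2.1, ?_⟩
    obtain ⟨-, -, -, a', b', c', h', -, rfl, -⟩ := hz
    split_ifs
    · exact hU _ _ (h.E_symm huv)
    · exact hU _ _ ⟨_, h'⟩

end Acyclic

open scoped Matrix

/-! ### Weights in equilibrium off a triangle. -/

section Pinned

variable {V : Type*} [Fintype V] [DecidableEq V] {t : V → V → V → Prop} {x : ℕ → V → ℝ}
  {I : Finset ℕ} {U T : Finset V}

theorem Gen.exists_sum_eq (h : Gen I U x) (hIU : I.card = U.card) (R : ℕ → ℝ) :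
    ∃ α : V → ℝ, (∀ a ∉ U, α a = 0) ∧ ∀ i ∈ I, ∑ a, α a * x i a = R i := by
  let e : U ≃ I := Finset.equivOfCardEq hIU.symm
  have hdet := h.det_ne_zero (fun i : U => (e i : ℕ)) (Subtype.val_injective.comp e.injective)
    (fun i => (e i).2) (fun i : U => (i : V)) Subtype.val_injective (fun i => i.2)
  set M : Matrix U U ℝ := Matrix.of fun i j : U => x (e i) j with hM
  let β : U → ℝ := M⁻¹ *ᵥ fun j => R (e j)
  have hβ : M *ᵥ β = fun j => R (e j) := by
    rw [Matrix.mulVec_mulVec, Matrix.mul_nonsing_inv _ (isUnit_iff_ne_zero.2 hdet),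
      Matrix.one_mulVec]
  refine ⟨fun a => if ha : a ∈ U then β ⟨a, ha⟩ else 0, fun a ha => by simp [ha], fun i hi => ?_⟩
  have := congrFun hβ (e.symm ⟨i, hi⟩)
  simp only [Equiv.apply_symm_apply, Matrix.mulVec, dotProduct, hM, Matrix.of_apply] at this
  rw [← this, ← Finset.sum_subset (Finset.subset_univ U) (fun a _ ha => by simp [ha]),
    ← Finset.sum_coe_sort]
  exact Finset.sum_congr rfl fun a _ => by simp [mul_comm]

/-- If the whole graph is stress free, then weights in equilibrium away from a triangle vanish
away from the triangle. -/
theorem eq_zero_of_equilibrium_off (hfree : ∀ c, IsStress t {1, 2, 3} x c → c = 0)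
    (hx : Gen {1, 2, 3} U x) (hTU : T ⊆ U) (hT : T.card = 3)
    (hTE : ∀ a ∈ T, ∀ b ∈ T, a ≠ b → E t a b) {c : V → V → ℝ} (hsw : ∀ a b, c b a = -c a b)
    (hsupp : ∀ a b, c a b ≠ 0 → E t a b)
    (heq : ∀ i ∈ ({1, 2, 3} : Finset ℕ), ∀ a ∉ T, ∑ b, c a b * x i b = 0) {a : V} (ha : a ∉ T)
    (b : V) : c a b = 0 := by
  have hxT : Gen {1, 2, 3} T x := hx.mono subset_rfl hTU
  have hcard : ({1, 2, 3} : Finset ℕ).card = T.card := by rw [hT]; rfl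
  -- For each vertex a correction supported on `T` that cancels the resultant of `c` there; it will
  -- be used only at vertices of `T`.
  choose α hα0 hα using fun a => hxT.exists_sum_eq hcard (fun i => -∑ b, c a b * x i b)
  let cT : V → V → ℝ := fun a b => if a ∈ T then α a b else 0
  have hcT0 : ∀ a b, b ∉ T → cT a b = 0 := fun a b hb => by simp [cT, hα0 a b hb]
  have hcT0' : ∀ a b, a ∉ T → cT a b = 0 := fun a b hb => by simp [cT, hb]
  have hbar : ∀ i ∈ ({1, 2, 3} : Finset ℕ), ∀ a, ∑ b, (c a b + cT a b) * x i b = 0 := by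
    intro i hi a
    simp only [add_mul, Finset.sum_add_distrib]
    by_cases haT : a ∈ T
    · simp only [cT, haT, if_true]
      rw [hα a i hi]
      ring
    · rw [heq i hi a haT]
      simp [cT, haT]
  -- Pair the corrected equilibrium with two rows in both orders and add. The antisymmetric `c`
  -- drops out, so the symmetric part of `cT` pairs to zero with all pairs of the three rows. On `T`
  -- these form a basis, so the correction is antisymmetric and the corrected weight is a stress.
  have hs : ∀ a b, cT a b + cT b a = 0 := by
    have h1 : ∀ i ∈ ({1, 2, 3} : Finset ℕ), ∀ j ∈ ({1, 2, 3} : Finset ℕ),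
        ∑ b, (∑ a, (cT a b + cT b a) * x i a) * x j b = 0 := by
      intro i hi j hj
      have e1 : ∑ a, (∑ b, (c a b + cT a b) * x j b) * x i a = 0 :=
        Finset.sum_eq_zero fun a _ => by rw [hbar j hj, zero_mul]
      have e2 : ∑ b, (∑ a, (c b a + cT b a) * x i a) * x j b = 0 :=
        Finset.sum_eq_zero fun a _ => by rw [hbar i hi, zero_mul]
      simp only [Finset.sum_mul] at e1 e2 ⊢
      rw [Finset.sum_comm] at e1
      rw [← add_zero (0 : ℝ)]
      nth_rewrite 1 [← e1]
      rw [← e2, ← Finset.sum_add_distrib]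
      refine Finset.sum_congr rfl fun b _ => ?_
      rw [← Finset.sum_add_distrib]
      refine Finset.sum_congr rfl fun a _ => ?_
      rw [hsw a b]
      ring
    have h2 : ∀ i ∈ ({1, 2, 3} : Finset ℕ), ∀ b, ∑ a, (cT a b + cT b a) * x i a = 0 := by
      intro i hi b
      have := hxT.eq_zero_of_sum_eq_zero hcard (fun b => ∑ a, (cT a b + cT b a) * x i a)
        (fun b hb => Finset.sum_eq_zero fun a _ => by rw [hcT0 _ _ hb, hcT0' _ _ hb]; simp)
        (h1 i hi)
      exact congrFun this b
    intro a b
    have := hxT.eq_zero_of_sum_eq_zero hcard (fun a => cT a b + cT b a)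
      (fun a ha => by rw [hcT0 _ _ ha, hcT0' _ _ ha]; simp) (fun i hi => h2 i hi b)
    exact congrFun this a
  have hzero := hfree (fun a b => c a b + cT a b) ⟨fun a b => ?_, fun a b hne => ?_, hbar⟩
  · have := congrFun (congrFun hzero a) b
    simpa [cT, ha] using this
  · have := hs a b
    rw [hsw a b]
    linarith
  · by_cases h0 : cT a b = 0
    · exact hsupp _ _ (by simpa [h0] using hne)
    · have haT : a ∈ T := by_contra fun h => h0 (hcT0' _ _ h)
      have hbT : b ∈ T := by_contra fun h => h0 (hcT0 _ _ h)
      refine hTE a haT b hbT ?_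
      rintro rfl
      have := hs a a
      exact h0 (by linarith)

end Pinned

/-! ### Subcomplexes bounded by a triangle, and capping them. -/

section Patch

variable {V : Type*} {K D : V → V → V → Prop} {T : Finset V}

/-- The triangle with vertex set `T`. -/
def triangleOf (T : Finset V) (a b c : V) : Prop :=
  (a ∈ T ∧ b ∈ T ∧ c ∈ T) ∧ a ≠ b ∧ a ≠ c ∧ b ≠ c

/-- `D` is a subcomplex of the surface `K` whose boundary edges are those of the triangle `T`. -/
structure Patch (K D : V → V → V → Prop) (T : Finset V) : Prop where
  swap : ∀ a b c, D a b c → D b a c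
  rot : ∀ a b c, D a b c → D b c a
  le : ∀ a b c, D a b c → K a b c
  card : T.card = 3
  bdry : ∀ a b, a ≠ b → ((a ∈ T ∧ b ∈ T) ↔ ∃! c, D a b c)
  notT : ∀ a b c, D a b c → ¬ (a ∈ T ∧ b ∈ T ∧ c ∈ T)

variable (hK : IsSurf K)
include hK

/-- An edge in at least two triangles of `D` uses up both triangles of the surface at that edge. -/
theorem full_of_not_mem (le : ∀ a b c, D a b c → K a b c) {a b c d : V} (hD : D a b c)
    (hb : ¬ ∃! c, D a b c) (hd : K a b d) : D a b d := by
  have : ∃ e, e ≠ c ∧ D a b e := by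
    by_contra! hcon
    exact hb ⟨c, hD, fun e he => by_contra fun hne => hcon e hne he⟩
  obtain ⟨e, hec, he⟩ := this
  obtain ⟨c', -, -, hc'⟩ := hK.two _ _ _ hd
  have h1 := hc' _ (le _ _ _ hD)
  have h2 := hc' _ (le _ _ _ he)
  have h3 : d = c ∨ d = e := by grind
  rcases h3 with rfl | rfl
  · exact hD
  · exact he

/-- All triangles of the surface at an interior vertex of a subcomplex are in the subcomplex. -/
theorem star_full (swap : ∀ a b c, D a b c → D b a c) (rot : ∀ a b c, D a b c → D b c a)
    (le : ∀ a b c, D a b c → K a b c) {v a b c d : V}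
    (hv : ∀ a, ¬ ∃! c, D v a c) (hD : D v a b) (hKv : K v c d) : D v c d := by
  have := hK.link v (fun z => E D v z) (by
    rintro p q hpq ⟨z, hz⟩
    exact ⟨p, swap _ _ _ (rot _ _ _ (rot _ _ _
      (full_of_not_mem hK le hz (hv p) hpq)))⟩) a c ⟨b, le _ _ _ hD⟩ ⟨d, hKv⟩ ⟨b, hD⟩
  obtain ⟨z, hz⟩ := this
  exact full_of_not_mem hK le hz (hv c) hKv

variable [DecidableEq V]

/-- If there is an interior vertex, the boundary triangle is not a triangle of the subcomplex. -/
theorem Patch.mk' (swap : ∀ a b c, D a b c → D b a c) (rot : ∀ a b c, D a b c → D b c a)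
    (le : ∀ a b c, D a b c → K a b c) (card : T.card = 3)
    (bdry : ∀ a b, a ≠ b → ((a ∈ T ∧ b ∈ T) ↔ ∃! c, D a b c)) {w : V} (hw : ∃ a b, D w a b)
    (hwT : w ∉ T) : Patch K D T := by
  refine ⟨swap, rot, le, card, bdry, ?_⟩
  have swap₂ : ∀ a b c, D a b c → D a c b := fun a b c h => swap _ _ _ (rot _ _ _ (rot _ _ _ h))
  rintro p q r hpqr ⟨hp, hq, hr⟩
  have hne : ∀ {a b c}, D a b c → a ≠ b := fun h => hK.ne _ _ _ (le _ _ _ h)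
  have hpq := hne hpqr
  have hqr := hne (rot _ _ _ hpqr)
  have hpr := (hne (rot _ _ _ (rot _ _ _ hpqr))).symm
  have hTeq : ∀ z, z ∈ T ↔ z = p ∨ z = q ∨ z = r := by
    have : ({p, q, r} : Finset V) = T := by
      refine Finset.eq_of_subset_of_card_le (by simp [Finset.insert_subset_iff, hp, hq, hr]) ?_
      rw [card, Finset.card_eq_three.2 ⟨p, q, r, hpq, hpr, hqr, rfl⟩]
    intro z
    rw [← this]
    simp
  -- no interior vertex is adjacent to a boundary vertex
  have key : ∀ p q r, D p q r → p ∈ T → q ∈ T → r ∈ T → (∀ z, z ∈ T ↔ z = p ∨ z = q ∨ z = r) →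
      ∀ z, E D p z → z ∈ T := by
    intro p q r hpqr hp hq hr hTeq z hz
    by_contra hzT
    have hpq := hne hpqr
    have hpr := (hne (rot _ _ _ (rot _ _ _ hpqr))).symm
    have uq : ∀ y, D p q y → y = r := fun y hy => by
      obtain ⟨y', -, h'⟩ := (bdry p q hpq).1 ⟨hp, hq⟩
      rw [h' y hy, h' r hpqr]
    have ur : ∀ y, D p r y → y = q := fun y hy => by
      obtain ⟨y', -, h'⟩ := (bdry p r hpr).1 ⟨hp, hr⟩
      rw [h' y hy, h' q (swap₂ _ _ _ hpqr)]
    obtain ⟨y, hy⟩ := hz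
    have := hK.link p (fun z => z ∉ T ∧ E D p z) (by
      rintro a b hab ⟨haT, c, hc⟩
      have hDab : D p a b := full_of_not_mem hK le hc
        (fun h => haT ((bdry p a (hne hc)).2 h).2) hab
      refine ⟨fun hbT => ?_, ⟨a, swap₂ _ _ _ hDab⟩⟩
      rcases (hTeq b).1 hbT with rfl | rfl | rfl
      · exact hK.E_ne (hK.E₂ hab) rfl
      · exact haT (uq a (swap₂ _ _ _ hDab) ▸ hr)
      · exact haT (ur a (swap₂ _ _ _ hDab) ▸ hq)) z q ⟨y, le _ _ _ hy⟩ ⟨r, le _ _ _ hpqr⟩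
      ⟨hzT, y, hy⟩
    exact this.1 hq
  have keyT : ∀ a ∈ T, ∀ z, E D a z → z ∈ T := by
    intro a ha z hz
    rcases (hTeq a).1 ha with rfl | rfl | rfl
    · exact key a q r hpqr hp hq hr hTeq z hz
    · exact key a r p (rot _ _ _ hpqr) hq hr hp (fun z => by rw [hTeq]; tauto) z hz
    · exact key a p q (rot _ _ _ (rot _ _ _ hpqr)) hr hp hq (fun z => by rw [hTeq]; tauto) z hz
  obtain ⟨a, b, hab⟩ := hw
  -- The vertices of `D` off `T` are then closed under adjacency in `K`; connectedness would put `p`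
  -- among them.
  have := hK.conn (fun z => z ∉ T ∧ ∃ c d, D z c d) (by
    rintro x y z hxyz ⟨hxT, c, d, hcd⟩
    have hD : D x y z := star_full hK swap rot le (fun a h => by
      obtain ⟨e, he, -⟩ := id h
      exact hxT ((bdry x a (hne he)).2 h).1) hcd hxyz
    exact ⟨fun hyT => hxT (keyT y hyT x ⟨z, swap _ _ _ hD⟩), x, z, swap _ _ _ hD⟩) w p
    ⟨a, b, le _ _ _ hab⟩ ⟨q, r, le _ _ _ hpqr⟩ ⟨hwT, a, b, hab⟩
  exact this.1 hp

namespace Patch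

variable (h : Patch K D T)
include h

omit hK [DecidableEq V] in
theorem swap₂ {a b c : V} (hD : D a b c) : D a c b :=
  h.swap _ _ _ (h.rot _ _ _ (h.rot _ _ _ hD))

omit [DecidableEq V] in
theorem ne {a b c : V} (hD : D a b c) : a ≠ b := hK.ne _ _ _ (h.le _ _ _ hD)

omit [DecidableEq V] in
theorem full_of_left {v a b c d : V} (hv : v ∉ T) (hD : D v a b) (hKv : K v c d) : D v c d :=
  star_full hK h.swap h.rot h.le (fun a hu => by
    obtain ⟨e, he, -⟩ := id hu
    exact hv ((h.bdry v a (h.ne hK he)).2 hu).1) hD hKv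

omit [DecidableEq V] in
theorem full_of_edge {a b c d : V} (hD : D a b c) (hb : ¬ (a ∈ T ∧ b ∈ T)) (hd : K a b d) :
    D a b d :=
  full_of_not_mem hK h.le hD (fun hu => hb ((h.bdry a b (h.ne hK hD)).2 hu)) hd

omit hK [DecidableEq V] in
theorem edge {a b : V} (ha : a ∈ T) (hb : b ∈ T) (hab : a ≠ b) : E D a b :=
  ((h.bdry a b hab).1 ⟨ha, hb⟩).exists

omit hK in
theorem third {a b : V} (ha : a ∈ T) (hb : b ∈ T) (hab : a ≠ b) :
    ∃ c ∈ T, c ≠ a ∧ c ≠ b ∧ ∀ e ∈ T, e = a ∨ e = b ∨ e = c := by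
  have h1 : ((T.erase a).erase b).card = 1 := by
    rw [Finset.card_erase_of_mem (Finset.mem_erase.2 ⟨hab.symm, hb⟩),
      Finset.card_erase_of_mem ha, h.card]
  obtain ⟨c, hc⟩ := Finset.card_eq_one.1 h1
  have hmem : ∀ e, e ∈ (T.erase a).erase b ↔ e = c := fun e => by rw [hc]; simp
  simp only [Finset.mem_erase] at hmem
  have hcm := (hmem c).2 rfl
  refine ⟨c, hcm.2.2, hcm.2.1, hcm.1, fun e he => ?_⟩
  by_cases h1 : e = a
  · exact Or.inl h1
  by_cases h2 : e = b
  · exact Or.inr (Or.inl h2)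
  · exact Or.inr (Or.inr ((hmem e).1 ⟨h2, h1, he⟩))

omit [DecidableEq V] in
-- A walk around the link of `v` in `K` can leave `D` only across an edge `vw` with both ends in
-- `T`. The hypothesis `hgT` keeps `g` away from such `w`, so `g` spreads over the whole link.
theorem link_eq {v : V} (g : V → Prop)
    (hg : ∀ w z, (D v w z ∨ triangleOf T v w z) → g w → g z)
    (hgT : ∀ w, g w → v ∈ T → w ∉ T) {a : V} (ha : E D v a) (hga : g a) {z : V} (hz : E K v z) :
    g z := by
  obtain ⟨b, hb⟩ := ha
  refine (hK.link v (fun w => g w ∧ E D v w) ?_ a z ⟨b, h.le _ _ _ hb⟩ hz ⟨hga, b, hb⟩).1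
  rintro p q hpq ⟨hgp, c, hc⟩
  have hD := h.full_of_edge hK hc (fun hh => hgT p hgp hh.1 hh.2) hpq
  exact ⟨hg p q (Or.inl hD) hgp, p, h.swap₂ hD⟩

/-- Off `T` nothing changes. At `v ∈ T`, a predicate holding at some neighbour but at no other
vertex of `T` would spread around the link in `K`, which contains vertices of `T`. So it reaches
`T`, whose triangle joins its two other vertices; applying this to `f` and to its negation gives the
claim. -/
theorem cap_link (v : V) (f : V → Prop) (hf : ∀ a b, (D v a b ∨ triangleOf T v a b) → f a → f b)
    (a b : V) (ha : E (fun a b c => D a b c ∨ triangleOf T a b c) v a)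
    (hb : E (fun a b c => D a b c ∨ triangleOf T a b c) v b) (hfa : f a) : f b := by
  by_cases hv : v ∈ T
  · have lem : ∀ g : V → Prop, (∀ a b, (D v a b ∨ triangleOf T v a b) → g a → g b) →
        (∀ y ∈ T, y ≠ v → ¬ g y) →
        ∀ a, E (fun a b c => D a b c ∨ triangleOf T a b c) v a → ¬ g a := by
      rintro g hg hgy a ⟨z, hz | hz⟩ hga
      · have h1 : ∃ y ∈ T, y ≠ v := by
          have : 1 < T.card := by rw [h.card]; norm_num
          obtain ⟨y, hy, hyv⟩ := Finset.exists_mem_ne this v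
          exact ⟨y, hy, hyv⟩
        obtain ⟨y, hy, hyv⟩ := h1
        obtain ⟨y', hy'⟩ := h.edge hv hy hyv.symm
        let g' : V → Prop := fun w => g w ∧ w ≠ v
        refine hgy y hy hyv (h.link_eq hK g' ?_ ?_ ⟨z, hz⟩ ⟨hga, (h.ne hK hz).symm⟩
          ⟨y', h.le _ _ _ hy'⟩).1
        · rintro w z hwz ⟨hgw, -⟩
          refine ⟨hg w z hwz hgw, ?_⟩
          rcases hwz with h1 | h1
          · exact (h.ne hK (h.swap₂ h1)).symm
          · exact h1.2.2.1.symm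
        · rintro w ⟨hgw, hwv⟩ _ hwT
          exact hgy w hwT hwv hgw
      · exact hgy a hz.1.2.1 hz.2.1.symm hga
    have hT1 : ∀ y ∈ T, ∀ y' ∈ T, y ≠ v → y' ≠ v → f y → f y' := by
      intro y hy y' hy' h1 h2 h3
      by_cases hyy : y = y'
      · exact hyy ▸ h3
      · exact hf y y' (Or.inr ⟨⟨hv, hy, hy'⟩, h1.symm, h2.symm, hyy⟩) h3
    have hsymm : ∀ a b, (D v a b ∨ triangleOf T v a b) → (D v b a ∨ triangleOf T v b a) := by
      rintro a b (h1 | h1)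
      · exact Or.inl (h.swap₂ h1)
      · exact Or.inr ⟨⟨h1.1.1, h1.1.2.2, h1.1.2.1⟩, h1.2.2.1, h1.2.1, h1.2.2.2.symm⟩
    by_cases hall : ∃ y ∈ T, y ≠ v ∧ f y
    · obtain ⟨y, hy, hyv, hfy⟩ := hall
      by_contra hfb
      refine lem (fun w => ¬ f w) (fun a b hab hfa hfb => hfa (hf b a (hsymm a b hab) hfb)) ?_ b hb
        hfb
      intro y' hy' hyv'
      exact not_not.2 (hT1 y hy y' hy' hyv hyv' hfy)
    · push Not at hall
      exact absurd hfa (lem f hf hall a ha)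
  · have red : ∀ a, E (fun a b c => D a b c ∨ triangleOf T a b c) v a → E D v a := by
      rintro a ⟨z, hz | hz⟩
      · exact ⟨z, hz⟩
      · exact absurd hz.1.1 hv
    obtain ⟨z, hz⟩ := red b hb
    exact h.link_eq hK f hf (fun _ _ hh => absurd hh hv) (red a ha) hfa ⟨z, h.le _ _ _ hz⟩

/-- A predicate on vertices of `D` false on `T` only meets vertices whose full star is in `D`, so it
would spread through the connected surface and reach `T`. Apply this to `f` and to its negation. -/
theorem cap_conn (f : V → Prop) (hf : ∀ a b c, (D a b c ∨ triangleOf T a b c) → f a → f b)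
    (a b : V) (ha : ∃ a', E (fun a b c => D a b c ∨ triangleOf T a b c) a a')
    (hb : ∃ b', E (fun a b c => D a b c ∨ triangleOf T a b c) b b') (hfa : f a) : f b := by
  obtain ⟨p, hp⟩ : T.Nonempty := Finset.card_pos.1 (by rw [h.card]; norm_num)
  have hT : ∀ g : V → Prop, (∀ a b c, (D a b c ∨ triangleOf T a b c) → g a → g b) →
      ∀ y ∈ T, ∀ z ∈ T, g y → g z := by
    intro g hg y hy z hz hgy
    by_cases hyz : y = z
    · exact hyz ▸ hgy
    · obtain ⟨w, hw, hwy, hwz, -⟩ := h.third hy hz hyz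
      exact hg y z w (Or.inr ⟨⟨hy, hz, hw⟩, hyz, hwy.symm, hwz.symm⟩) hgy
  have hverts : ∀ a, (∃ a', E (fun a b c => D a b c ∨ triangleOf T a b c) a a') →
      a ∈ T ∨ ∃ c d, D a c d := by
    rintro a ⟨a', c, hc | hc⟩
    · exact Or.inr ⟨a', c, hc⟩
    · exact Or.inl hc.1.1
  have lem : ∀ g : V → Prop, (∀ a b c, (D a b c ∨ triangleOf T a b c) → g a → g b) → ¬ g p →
      ∀ a, (∃ a', E (fun a b c => D a b c ∨ triangleOf T a b c) a a') → ¬ g a := by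
    intro g hg hgp a ha hga
    have hgT : ∀ y ∈ T, ¬ g y := fun y hy hgy => hgp (hT g hg y hy p hp hgy)
    obtain ⟨c, d, hcd⟩ := (hverts a ha).resolve_left fun hh => hgT a hh hga
    obtain ⟨q, hq, hqp⟩ : ∃ q ∈ T, q ≠ p :=
      Finset.exists_mem_ne (by rw [h.card]; norm_num) p
    obtain ⟨r, hr⟩ := h.edge hp hq hqp.symm
    refine hgp (hK.conn (fun w => g w ∧ ∃ c d, D w c d) ?_ a p ⟨c, d, h.le _ _ _ hcd⟩
      ⟨q, r, h.le _ _ _ hr⟩ ⟨hga, c, d, hcd⟩).1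
    rintro x y z hxyz ⟨hgx, c, d, hcd⟩
    have hD := h.full_of_left hK (fun hx => hgT x hx hgx) hcd hxyz
    exact ⟨hg x y z (Or.inl hD) hgx, x, z, h.swap _ _ _ hD⟩
  by_cases hfp : f p
  · by_contra hfb
    refine lem (fun w => ¬ f w) (fun a b c habc hfa hfb => hfa (hf b a c ?_ hfb)) (not_not.2 hfp)
      b hb hfb
    rcases habc with h1 | h1
    · exact Or.inl (h.swap _ _ _ h1)
    · exact Or.inr ⟨⟨h1.1.2.1, h1.1.1, h1.1.2.2⟩, h1.2.1.symm, h1.2.2.2, h1.2.2.1⟩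
  · exact absurd hfa (lem f hf hfp a ha)

/-- Closing a patch with its boundary triangle gives a closed surface. -/
theorem cap : IsSurf fun a b c => D a b c ∨ triangleOf T a b c where
  swap := by
    rintro a b c (h1 | h1)
    · exact Or.inl (h.swap _ _ _ h1)
    · exact Or.inr ⟨⟨h1.1.2.1, h1.1.1, h1.1.2.2⟩, h1.2.1.symm, h1.2.2.2, h1.2.2.1⟩
  rot := by
    rintro a b c (h1 | h1)
    · exact Or.inl (h.rot _ _ _ h1)
    · exact Or.inr ⟨⟨h1.1.2.1, h1.1.2.2, h1.1.1⟩, h1.2.2.2, h1.2.1.symm, h1.2.2.1.symm⟩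
  ne := by
    rintro a b c (h1 | h1)
    · exact h.ne hK h1
    · exact h1.2.1
  two := by
    intro a b c habc
    by_cases hab : a ∈ T ∧ b ∈ T
    · have hne : a ≠ b := by
        rcases habc with h1 | h1
        · exact h.ne hK h1
        · exact h1.2.1
      obtain ⟨d, hd, hd'⟩ := (h.bdry a b hne).1 hab
      obtain ⟨e, he, hea, heb, he'⟩ := h.third hab.1 hab.2 hne
      have hde : d ≠ e := by
        rintro rfl
        exact h.notT _ _ _ hd ⟨hab.1, hab.2, he⟩
      have key : ∀ z, (D a b z ∨ triangleOf T a b z) ↔ z = d ∨ z = e := by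
        intro z
        constructor
        · rintro (h1 | h1)
          · exact Or.inl (hd' z h1)
          · rcases he' z h1.1.2.2 with rfl | rfl | rfl
            · exact absurd rfl h1.2.2.1
            · exact absurd rfl h1.2.2.2
            · exact Or.inr rfl
        · rintro (rfl | rfl)
          · exact Or.inl hd
          · exact Or.inr ⟨⟨hab.1, hab.2, he⟩, hne, hea.symm, heb.symm⟩
      simp only [key] at habc ⊢
      rcases habc with rfl | rfl
      · exact ⟨e, hde.symm, Or.inr rfl, fun z hz => hz⟩
      · exact ⟨d, hde, Or.inl rfl, fun z hz => hz.symm⟩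
    · have red : ∀ z, (D a b z ∨ triangleOf T a b z) → D a b z := by
        rintro z (h1 | h1)
        · exact h1
        · exact absurd ⟨h1.1.1, h1.1.2.1⟩ hab
      have h1 := red c habc
      obtain ⟨d, hdc, hd, hd'⟩ := hK.two _ _ _ (h.le _ _ _ h1)
      exact ⟨d, hdc, Or.inl (h.full_of_edge hK h1 hab hd), fun e he => hd' e (h.le _ _ _ (red e he))⟩
  link := h.cap_link hK
  conn := h.cap_conn hK

omit hK [DecidableEq V] in
-- The edges of the added triangle already belong to triangles of `D`, so the potential found on `D`
-- serves.
theorem cap_trivialH1 {A : Type*} [AddCommGroup A] (hH : TrivialH1 D A) :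
    TrivialH1 (fun a b c => D a b c ∨ triangleOf T a b c) A := by
  intro z hz hz'
  obtain ⟨φ, hφ⟩ := hH z hz (fun a b c habc => hz' a b c (Or.inl habc))
  refine ⟨φ, ?_⟩
  rintro a b c (h1 | h1)
  · exact hφ a b c h1
  · obtain ⟨d, hd⟩ := h.edge h1.1.1 h1.1.2.1 h1.2.1
    exact hφ a b d hd

end Patch

end Patch

/-! ### Contracting a 2-chain with a vector: the weighted boundary. -/

section Contractions

variable {V : Type*} [Fintype V]

/-- Contraction of the last argument of `m` with `f`. -/
def con (m : V → V → V → ℝ) (f : V → ℝ) (a b : V) : ℝ := ∑ c, m a b c * f c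

theorem con_add (m m' : V → V → V → ℝ) (f : V → ℝ) : con (m + m') f = con m f + con m' f := by
  funext a b
  simp [con, add_mul, Finset.sum_add_distrib]

theorem con_smul (r : ℝ) (m : V → V → V → ℝ) (f : V → ℝ) : con (r • m) f = r • con m f := by
  funext a b
  simp [con, Finset.mul_sum, mul_assoc]

theorem con_sub (m m' : V → V → V → ℝ) (f : V → ℝ) : con (m - m') f = con m f - con m' f := by
  funext a b
  simp [con, sub_mul, Finset.sum_sub_distrib]

variable {t : V → V → V → Prop} {m : V → V → V → ℝ}

theorem IsAlt.con_swap (hm : IsAlt t m) (f : V → ℝ) (a b : V) : con m f b a = -con m f a b := by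
  simp [con, hm.swap a b]

theorem IsAlt.con_supp (hm : IsAlt t m) (f : V → ℝ) {a b : V} (h : con m f a b ≠ 0) : E t a b := by
  obtain ⟨c, -, hc⟩ := Finset.exists_ne_zero_of_sum_ne_zero h
  exact ⟨c, hm.supp _ _ _ (left_ne_zero_of_mul hc)⟩

/-- Alternation cancels the repeated vector. Thus a boundary weighted by row 1 is automatically in
equilibrium for row 1. -/
theorem IsAlt.con_con_self (hm : IsAlt t m) (f : V → ℝ) (a : V) : ∑ b, con m f a b * f b = 0 := by
  have : ∑ b, con m f a b * f b = -∑ b, con m f a b * f b := by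
    conv_lhs => simp only [con, Finset.sum_mul]
    rw [Finset.sum_comm, ← Finset.sum_neg_distrib]
    refine Finset.sum_congr rfl fun b _ => ?_
    simp only [con, Finset.sum_mul, ← Finset.sum_neg_distrib]
    refine Finset.sum_congr rfl fun c _ => ?_
    rw [hm.swap' a b c]
    ring
  linarith

omit [Fintype V] in
theorem IsAlt.sub {s : V → V → V → Prop} {m m' : V → V → V → ℝ} (h : IsAlt s m) (h' : IsAlt s m') :
    IsAlt s (m - m') := by
  have := h.add (h'.smul (-1))
  rwa [neg_one_smul, ← sub_eq_add_neg] at this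

open Classical in
/-- The part of a chain on the triangles of `D`. -/
noncomputable def restrict (D : V → V → V → Prop) (m : V → V → V → ℝ) (a b c : V) : ℝ :=
  if D a b c then m a b c else 0

omit [Fintype V] in
theorem IsAlt.restrict {D : V → V → V → Prop} (hm : IsAlt t m) (hs : ∀ a b c, D a b c → D b a c)
    (hr : ∀ a b c, D a b c → D b c a) : IsAlt D (restrict D m) where
  swap a b c := by
    have : D b a c ↔ D a b c := ⟨hs _ _ _, hs _ _ _⟩
    by_cases hD : D a b c
    · simpa [ExtShift.restrict, hD, this] using hm.swap a b c
    · simp [ExtShift.restrict, hD, this]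
  swap' a b c := by
    have hs2 : ∀ a b c, D a b c → D a c b := fun a b c h => hs _ _ _ (hr _ _ _ (hr _ _ _ h))
    have : D a c b ↔ D a b c := ⟨hs2 _ _ _, hs2 _ _ _⟩
    by_cases hD : D a b c
    · simpa [ExtShift.restrict, hD, this] using hm.swap' a b c
    · simp [ExtShift.restrict, hD, this]
  supp a b c hne := by
    by_contra hD
    exact hne (by simp [ExtShift.restrict, hD])

end Contractions

/-! ### Exchanging a glued piece for a single triangle. -/

section Plug

variable {V : Type*} [Fintype V] [DecidableEq V] {R D : V → V → V → Prop} {x : ℕ → V → ℝ}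
  {p q r : V}

/-- The complex `D`, glued to `R` along the triangle `pqr`, does not contribute to the stresses. -/
structure Plug (R D : V → V → V → Prop) (p q r : V) (x : ℕ → V → ℝ) : Prop where
  swap : ∀ a b c, D a b c → D b a c
  rot : ∀ a b c, D a b c → D b c a
  swapR : ∀ a b c, R a b c → R b a c
  rotR : ∀ a b c, R a b c → R b c a
  ne : p ≠ q ∧ p ≠ r ∧ q ≠ r
  int : ∀ a b c, D a b c → a ∉ ({p, q, r} : Finset V) → ∀ b' c', ¬ R a b' c'
  disj : R p q r → ¬ D p q r
  pin : ∀ c : V → V → ℝ, (∀ a b, c b a = -c a b) → (∀ a b, c a b ≠ 0 → E D a b) →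
    (∀ i ∈ ({1, 2, 3} : Finset ℕ), ∀ a ∉ ({p, q, r} : Finset V), ∑ b, c a b * x i b = 0) →
    ∀ a ∉ ({p, q, r} : Finset V), ∀ b, c a b = 0
  fill : ∃ d, IsAlt D d ∧ con d (x 1) = con (triChain ℝ p q r) (x 1)
  pos : x 1 p ≠ 0 ∧ x 1 q ≠ 0 ∧ x 1 r ≠ 0

/-- The weights on edges which are the boundary of a chain and in equilibrium. -/
def boundaryStress (t : V → V → V → Prop) (x : ℕ → V → ℝ) : Set (V → V → ℝ) :=
  {c | ∃ m, IsAlt t m ∧ c = con m (x 1) ∧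
    ∀ i ∈ ({2, 3} : Finset ℕ), ∀ a, ∑ b, c a b * x i b = 0}

theorem con_triChain (f : V → ℝ) (a b : V) : con (triChain ℝ p q r) f a b =
    edgeChain ℝ p q a b * f r + edgeChain ℝ q r a b * f p + edgeChain ℝ r p a b * f q :=
  sum_triChain_mul p q r a b f

omit [Fintype V] in
theorem perm_of_mem {S : V → V → V → Prop} (hs : ∀ a b c, S a b c → S b a c)
    (hr : ∀ a b c, S a b c → S b c a) {a b c : V} (ha : a ∈ ({p, q, r} : Finset V))
    (hb : b ∈ ({p, q, r} : Finset V)) (hc : c ∈ ({p, q, r} : Finset V)) (hab : a ≠ b) (hac : a ≠ c)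
    (hbc : b ≠ c) (h : S p q r) : S a b c := by
  have h1 := hr _ _ _ h
  have h2 := hr _ _ _ h1
  have h3 := hs _ _ _ h
  have h4 := hs _ _ _ h1
  have h5 := hs _ _ _ h2
  simp only [Finset.mem_insert, Finset.mem_singleton] at ha hb hc
  rcases ha with rfl | rfl | rfl <;> rcases hb with rfl | rfl | rfl <;>
    rcases hc with rfl | rfl | rfl <;> first | contradiction | assumption

/-- A cycle on the edges of a triangle is a multiple of the boundary of the triangle. -/
theorem exists_eq_smul_con_triChain (hne : p ≠ q ∧ p ≠ r ∧ q ≠ r) {f : V → ℝ} (hr : f r ≠ 0)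
    {γ : V → V → ℝ} (hsw : ∀ a b, γ b a = -γ a b)
    (hsupp : ∀ a ∉ ({p, q, r} : Finset V), ∀ b, γ a b = 0) (h0 : ∀ a, ∑ b, γ a b * f b = 0) :
    ∃ l : ℝ, γ = l • con (triChain ℝ p q r) f := by
  obtain ⟨hpq, hpr, hqr⟩ := hne
  have hdiag : ∀ a, γ a a = 0 := fun a => by
    have := hsw a a
    linarith
  have hsum : ∀ a, γ a p * f p + γ a q * f q + γ a r * f r = 0 := by
    intro a
    have := h0 a
    rw [← Finset.sum_subset (Finset.subset_univ {p, q, r}),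
      Finset.sum_insert (by simp [hpq, hpr]), Finset.sum_pair hqr] at this
    · linarith
    · intro b _ hb
      rw [hsw b a, hsupp b hb, neg_zero, zero_mul]
  have hp := hsum p
  have hq := hsum q
  rw [hdiag] at hp hq
  have e1 : γ q p = -γ p q := hsw p q
  have e2 : γ r p = -γ p r := hsw p r
  have e3 : γ r q = -γ q r := hsw q r
  -- The weighted boundary of the triangle takes the value `f r` on `pq`.
  refine ⟨γ p q / f r, ?_⟩
  have v1 : γ p q = γ p q / f r * f r := by field_simp
  have v2 : γ p r = -(γ p q / f r * f q) := by
    field_simp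
    linarith
  have v3 : γ q r = γ p q / f r * f p := by
    rw [e1] at hq
    field_simp
    linarith
  funext a b
  simp only [Pi.smul_apply, smul_eq_mul, con_triChain]
  by_cases ha : a ∈ ({p, q, r} : Finset V)
  · by_cases hb : b ∈ ({p, q, r} : Finset V)
    · simp only [Finset.mem_insert, Finset.mem_singleton] at ha hb
      rcases ha with rfl | rfl | rfl <;> rcases hb with rfl | rfl | rfl <;>
        simp [edgeChain, hpq, hpr, hqr, hpq.symm, hpr.symm, hqr.symm, hdiag]
      · exact v1
      · linarith
      · linarith
      · exact v3
      · linarith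
      · linarith
    · rw [hsw b a, hsupp b hb]
      simp only [Finset.mem_insert, Finset.mem_singleton, not_or] at hb
      simp [edgeChain, hb]
  · rw [hsupp a ha]
    simp only [Finset.mem_insert, Finset.mem_singleton, not_or] at ha
    simp [edgeChain, ha]

namespace Plug

variable (h : Plug R D p q r x)
include h

theorem triChain_isAlt : IsAlt (triangleOf ({p, q, r} : Finset V)) (triChain ℝ p q r) := by
  refine ExtShift.triChain_isAlt ?_ ?_ ⟨by simp, h.ne⟩
  · intro a b c h1
    exact ⟨⟨h1.1.2.1, h1.1.1, h1.1.2.2⟩, h1.2.1.symm, h1.2.2.2, h1.2.2.1⟩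
  · intro a b c h1
    exact ⟨⟨h1.1.2.1, h1.1.2.2, h1.1.1⟩, h1.2.2.2, h1.2.1.symm, h1.2.2.1.symm⟩

/-- The boundary of the part of a chain on `D` is supported on the triangle `pqr` as soon as the
boundary of the whole chain vanishes at the interior vertices. -/
theorem exists_boundary_eq {m : V → V → V → ℝ} (hm : IsAlt (fun a b c => R a b c ∨ D a b c) m)
    (hint : ∀ a ∉ ({p, q, r} : Finset V), (∃ b, E D a b) → ∀ b, con m (x 1) a b = 0) :
    ∃ l : ℝ, con (restrict D m) (x 1) = l • con (triChain ℝ p q r) (x 1) := by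
  have hD := hm.restrict h.swap h.rot
  refine exists_eq_smul_con_triChain h.ne h.pos.2.2 (hD.con_swap _) ?_ (hD.con_con_self _)
  intro a ha b
  by_cases haD : ∃ b, E D a b
  · rw [← hint a ha haD b]
    refine Finset.sum_congr rfl fun c _ => ?_
    simp only [restrict]
    split_ifs with hc
    · rfl
    · by_cases h0 : m a b c = 0
      · rw [h0]
      · obtain ⟨b', c', h'⟩ := haD
        exact absurd ((hm.supp _ _ _ h0).resolve_right hc) (h.int _ _ _ h' ha _ _)
  · by_contra hne
    exact haD ⟨b, hD.con_supp _ hne⟩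

theorem sub_restrict_isAlt {m : V → V → V → ℝ} (hm : IsAlt (fun a b c => R a b c ∨ D a b c) m) :
    IsAlt R (m - restrict D m) := by
  have h1 : IsAlt (fun a b c => R a b c ∨ D a b c) (m - restrict D m) :=
    hm.sub ((hm.restrict h.swap h.rot).mono fun _ _ _ => Or.inr)
  refine ⟨h1.swap, h1.swap', fun a b c hne => ?_⟩
  have hnD : ¬ D a b c := fun hD => hne (by simp [restrict, hD])
  exact (h1.supp _ _ _ hne).resolve_right hnD

/-- Pinning kills the boundary at interior vertices, so the part of the chain on `D` has the same
boundary as a multiple of the triangle `pqr` and may be replaced by it. In the other direction the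
filling replaces the triangle by a chain on `D`. The right side no longer mentions `D`. -/
theorem boundaryStress_eq :
    boundaryStress (fun a b c => R a b c ∨ D a b c) x =
      boundaryStress (fun a b c => R a b c ∨ triangleOf ({p, q, r} : Finset V) a b c) x := by
  classical
  ext c
  constructor
  · rintro ⟨m, hm, rfl, heq⟩
    have hDsymm : ∀ a b, E D b a ↔ E D a b := fun a b =>
      ⟨fun ⟨z, hz⟩ => ⟨z, h.swap _ _ _ hz⟩, fun ⟨z, hz⟩ => ⟨z, h.swap _ _ _ hz⟩⟩
    have hmem : ∀ a ∉ ({p, q, r} : Finset V), (∃ b, E D a b) → ∀ b, con m (x 1) a b ≠ 0 →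
        E D a b := by
      rintro a ha ⟨b', c', h'⟩ b hne
      obtain ⟨z, hz | hz⟩ := hm.con_supp _ hne
      · exact absurd hz (h.int _ _ _ h' ha _ _)
      · exact ⟨z, hz⟩
    -- The boundary is cut down to edges of `D`; at an interior vertex of `D` this discards nothing,
    -- so equilibrium there is kept.
    have hpin := h.pin (fun a b => if E D a b then con m (x 1) a b else 0) (by
        intro a b
        simp only [hDsymm a b]
        split_ifs
        · exact hm.con_swap _ a b
        · simp) (by
        intro a b hne
        by_contra hcon
        exact hne (by simp [hcon])) (by
        intro i hi a ha
        by_cases haD : ∃ b, E D a b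
        · have : ∑ b, con m (x 1) a b * x i b = 0 := by
            simp only [Finset.mem_insert, Finset.mem_singleton] at hi
            rcases hi with rfl | rfl | rfl
            · exact hm.con_con_self _ a
            · exact heq 2 (by simp) a
            · exact heq 3 (by simp) a
          refine Eq.trans (Finset.sum_congr rfl fun b _ => ?_) this
          split_ifs with hE
          · rfl
          · have : con m (x 1) a b = 0 := by
              by_contra hne
              exact hE (hmem a ha haD b hne)
            rw [this]
        · refine Finset.sum_eq_zero fun b _ => ?_
          have : ¬ E D a b := fun hb => haD ⟨b, hb⟩
          simp [this])
    obtain ⟨l, hl⟩ := h.exists_boundary_eq hm (by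
      intro a ha haD b
      by_contra hne
      have := hpin a ha b
      rw [if_pos (hmem a ha haD b hne)] at this
      exact hne this)
    refine ⟨(m - restrict D m) + l • triChain ℝ p q r,
      ((h.sub_restrict_isAlt hm).mono fun _ _ _ => Or.inl).add
        ((h.triChain_isAlt.smul l).mono fun _ _ _ => Or.inr), ?_, heq⟩
    rw [con_add, con_smul, ← hl, ← con_add, sub_add_cancel]
  · rintro ⟨m, hm, rfl, heq⟩
    obtain ⟨d, hd, hd'⟩ := h.fill
    -- If `pqr` is already a triangle of `R` nothing has to be removed; otherwise `m p q r` is its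
    -- coefficient, since `triChain` has value one there.
    let l : ℝ := if R p q r then 0 else m p q r
    have hmR : IsAlt R (m - l • triChain ℝ p q r) := by
      have h1 := hm.sub ((h.triChain_isAlt.smul l).mono fun _ _ _ => Or.inr)
      refine ⟨h1.swap, h1.swap', fun a b c hne => ?_⟩
      refine (h1.supp _ _ _ hne).elim id fun hT => ?_
      by_contra hR
      apply hne
      have hval : (m - l • triChain ℝ p q r) p q r = 0 ∨ R p q r := by
        by_cases hpqr : R p q r
        · exact Or.inr hpqr
        · left
          simp [l, hpqr, triChain, edgeChain, h.ne.1, h.ne.2.1.symm, h.ne.2.2.symm, h.ne.1.symm]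
      obtain ⟨⟨ha, hb, hc⟩, hab, hac, hbc⟩ := hT
      rcases hval with hval | hval
      · exact perm_of_mem (S := fun a b c => (m - l • triChain ℝ p q r) a b c = 0)
          (fun a b c h0 => by rw [h1.swap a b c, h0, neg_zero])
          (fun a b c h0 => by rw [h1.rot a b c, h0]) ha hb hc hab hac hbc hval
      · exact absurd (perm_of_mem h.swapR h.rotR ha hb hc hab hac hbc hval) hR
    refine ⟨(m - l • triChain ℝ p q r) + l • d, (hmR.mono fun _ _ _ => Or.inl).add
      ((hd.smul l).mono fun _ _ _ => Or.inr), ?_, heq⟩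
    rw [con_add, con_smul, hd', ← con_smul, ← con_add, sub_add_cancel]

end Plug

/-- The existence of a nonzero `2`-cycle, weighted by `f`. -/
def HasCycle (t : V → V → V → Prop) (f : V → ℝ) : Prop :=
  ∃ m, IsAlt t m ∧ m ≠ 0 ∧ con m f = 0

omit [DecidableEq V] in
/-- In a closed connected surface a nonzero cycle does not vanish anywhere; its values agree up
to sign after rescaling. -/
theorem IsSurf.cycle_abs {t : V → V → V → Prop} (h : IsSurf t) {f : V → ℝ}
    {m : V → V → V → ℝ} (hm : IsAlt t m) (hc : con m f = 0)
    {a b c a' b' c' : V} (h1 : t a b c) (h2 : t a' b' c') :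
    |m a b c * (f a * f b * f c)| = |m a' b' c' * (f a' * f b' * f c')| := by
  classical
  let M : V → V → V → ℝ := fun a b c => |m a b c * (f a * f b * f c)|
  have Msw : ∀ a b c, M b a c = M a b c := fun a b c => by
    simp only [M]
    rw [hm.swap a b c, neg_mul, abs_neg]
    congr 1; ring
  have Mrot : ∀ a b c, M b c a = M a b c := fun a b c => by
    simp only [M]
    rw [hm.rot a b c]
    congr 1; ring
  have edge : ∀ a b c d, t a b c → t a b d → M a b c = M a b d := by
    intro a b c d hc1 hd1
    obtain ⟨e, hec, he, he'⟩ := h.two _ _ _ hc1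
    rcases he' d hd1 with rfl | rfl
    · rfl
    · have h0 := congrFun (congrFun hc a) b
      have : con m f a b = m a b c * f c + m a b d * f d := by
        rw [con, ← Finset.sum_pair (f := fun z => m a b z * f z) hec.symm]
        refine (Finset.sum_subset (Finset.subset_univ _) fun z _ hz => ?_).symm
        have : m a b z = 0 := by
          by_contra hne
          have := he' z (hm.supp _ _ _ hne)
          simp only [Finset.mem_insert, Finset.mem_singleton] at hz
          exact hz this
        simp [this]
      rw [this] at h0
      simp only [M]
      have e1 : m a b c * f c = -(m a b d * f d) := by
        simp only [Pi.zero_apply] at h0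
        linarith
      have e2 : m a b c * (f a * f b * f c) = -(m a b d * (f a * f b * f d)) := by
        linear_combination f a * f b * e1
      rw [e2, abs_neg]
  let κ := M a b c
  have star : ∀ v p q r s, t v p q → t v r s → M v p q = κ → M v r s = κ := by
    intro v p q r s hpq hrs hk
    have := h.link v (fun z => ∀ w, t v z w → M v z w = κ) (by
      intro z w hzw hz y hy
      rw [← edge v w z y (h.swap₂ hzw) hy, ← Msw, ← Mrot w v z, ← Mrot v z w, ← Msw]
      have := hz w hzw
      rw [← Mrot, ← Mrot, ← Msw, ← Mrot] at this
      rw [← Mrot, ← Mrot, ← Msw, ← Mrot]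
      simpa only [Msw, Mrot] using this) p r ⟨q, hpq⟩ ⟨s, hrs⟩
      (fun w hw => by rw [← hk]; exact edge v p w q hw hpq)
    exact this s hrs
  have := h.conn (fun v => ∀ p q, t v p q → M v p q = κ) (by
    intro v w z hvwz hv p q hpq
    refine star w v z p q (h.swap _ _ _ hvwz) hpq ?_
    rw [Msw]
    exact hv w z hvwz) a a' ⟨b, c, h1⟩ ⟨b', c', h2⟩ (fun p q hpq => star a b c p q h1 hpq rfl)
  exact (this b' c' h2).symm

omit [DecidableEq V] in
theorem IsSurf.cycle_ne_zero {t : V → V → V → Prop} (h : IsSurf t) {f : V → ℝ}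
    (hf : ∀ a b c, t a b c → f a ≠ 0) {m : V → V → V → ℝ} (hm : IsAlt t m) (hm0 : m ≠ 0)
    (hc : con m f = 0) {a b c : V} (habc : t a b c) : m a b c ≠ 0 := by
  intro h0
  apply hm0
  funext a' b' c'
  by_contra hne
  have ht := hm.supp _ _ _ hne
  have := h.cycle_abs hm hc habc ht
  rw [h0, zero_mul, abs_zero, eq_comm, abs_eq_zero] at this
  exact mul_ne_zero hne (mul_ne_zero (mul_ne_zero (hf _ _ _ ht) (hf _ _ _ (h.rot _ _ _ ht)))
    (hf _ _ _ (h.rot _ _ _ (h.rot _ _ _ ht)))) this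

/-- The right side does not involve `D`, so two plugs in the same `R` can be compared. A cycle of
the whole surface vanishes on no triangle, so its part on `R` is nonzero; conversely subtracting a
filling cannot cancel it, as `R` and `D` share no triangle. -/
theorem Plug.hasCycle_iff (h : Plug R D p q r x) (hS : IsSurf fun a b c => R a b c ∨ D a b c)
    (hf : ∀ a b c, R a b c ∨ D a b c → x 1 a ≠ 0) (hR : ∃ a b c, R a b c ∧ ¬ D a b c) :
    HasCycle (fun a b c => R a b c ∨ D a b c) (x 1) ↔
      ∃ s, IsAlt R s ∧ s ≠ 0 ∧ ∃ l : ℝ, con s (x 1) = l • con (triChain ℝ p q r) (x 1) := by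
  constructor
  · rintro ⟨m, hm, hm0, hc⟩
    obtain ⟨l, hl⟩ := h.exists_boundary_eq hm (fun a _ _ b => by rw [hc]; rfl)
    refine ⟨m - restrict D m, h.sub_restrict_isAlt hm, ?_, -l, ?_⟩
    · obtain ⟨a, b, c, hR1, hD1⟩ := hR
      intro h0
      have := congrFun (congrFun (congrFun h0 a) b) c
      simp only [Pi.sub_apply, restrict, hD1, if_false, sub_zero] at this
      exact hS.cycle_ne_zero hf hm hm0 hc (Or.inl hR1) this
    · rw [con_sub, hc, hl, zero_sub, neg_smul]
  · rintro ⟨s, hs, hs0, l, hl⟩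
    obtain ⟨d, hd, hd'⟩ := h.fill
    refine ⟨s - l • d, (hs.mono fun _ _ _ => Or.inl).sub ((hd.smul l).mono fun _ _ _ => Or.inr),
      ?_, ?_⟩
    · intro h0
      apply hs0
      funext a b c
      by_contra hne
      have hRabc := hs.supp _ _ _ hne
      have h1 := congrFun (congrFun (congrFun h0 a) b) c
      have h2 : d a b c ≠ 0 := by
        intro hd0
        simp [hd0] at h1
        exact hne h1
      -- A triangle common to `R` and `D` has no interior vertex of `D`, so it would be `pqr`, which
      -- `disj` excludes.
      have hDabc := hd.supp _ _ _ h2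
      have hR2 := h.rotR _ _ _ hRabc
      have hR3 := h.rotR _ _ _ hR2
      have hD2 := h.rot _ _ _ hDabc
      have hD3 := h.rot _ _ _ hD2
      have ha : a ∈ ({p, q, r} : Finset V) := by_contra fun hh => h.int _ _ _ hDabc hh _ _ hRabc
      have hb : b ∈ ({p, q, r} : Finset V) := by_contra fun hh => h.int _ _ _ hD2 hh _ _ hR2
      have hc : c ∈ ({p, q, r} : Finset V) := by_contra fun hh => h.int _ _ _ hD3 hh _ _ hR3
      have hab := hS.ne _ _ _ (Or.inl hRabc)
      have hbc := hS.ne _ _ _ (Or.inl hR2)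
      have hac := (hS.ne _ _ _ (Or.inl hR3)).symm
      have hmem : p ∈ ({a, b, c} : Finset V) ∧ q ∈ ({a, b, c} : Finset V) ∧
          r ∈ ({a, b, c} : Finset V) := by
        simp only [Finset.mem_insert, Finset.mem_singleton] at ha hb hc ⊢
        grind
      obtain ⟨n1, n2, n3⟩ := h.ne
      exact h.disj (perm_of_mem h.swapR h.rotR hmem.1 hmem.2.1 hmem.2.2 n1 n2 n3 hRabc)
        (perm_of_mem h.swap h.rot hmem.1 hmem.2.1 hmem.2.2 n1 n2 n3 hDabc)
    · rw [con_sub, con_smul, hd', hl, sub_self]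

end Plug

/-! ### A patch and its contraction are plugs in the same complement. -/

section PlugOfPatch

variable {V : Type*} [Fintype V] [DecidableEq V] {K D : V → V → V → Prop} {x : ℕ → V → ℝ}
  {p q r u v : V} {U : Finset V}

omit [Fintype V] [DecidableEq V] in
theorem Gen.ne_zero {I : Finset ℕ} (h : Gen I U x) {i : ℕ} (hi : i ∈ I) {a : V} (ha : a ∈ U) :
    x i a ≠ 0 :=
  AlgebraicIndependent.ne_zero h (⟨i, hi⟩, ⟨a, ha⟩)

omit [Fintype V] in
theorem edgeChain_mul (a b : V) (g : V → V → ℝ) (hg : ∀ a b, g a b = g b a) :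
    edgeChain ℝ p q a b * g a b = edgeChain ℝ p q a b * g p q := by
  by_cases h1 : a = p ∧ b = q
  · rw [h1.1, h1.2]
  · by_cases h2 : a = q ∧ b = p
    · rw [h2.1, h2.2, hg]
    · have : edgeChain ℝ p q a b = 0 := by
        simp only [edgeChain]
        by_cases ha : a = p
        · have hb : b ≠ q := fun hb => h1 ⟨ha, hb⟩
          by_cases ha' : a = q
          · have hb' : b ≠ p := fun hb => h2 ⟨ha', hb⟩
            simp [hb, hb']
          · simp [hb, ha']
        · by_cases ha' : a = q
          · have hb' : b ≠ p := fun hb => h2 ⟨ha', hb⟩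
            simp [ha, hb']
          · simp [ha, ha']
      rw [this, zero_mul, zero_mul]

/-- The weighted form of the fact that a triangle formed by edges bounds. -/
theorem exists_weighted_filling {t : V → V → V → Prop} (hs : ∀ a b c, t a b c → t b a c)
    (hr : ∀ a b c, t a b c → t b c a) (hH : TrivialH1 t ℝ) (hab : E t p q) (hbc : E t q r)
    (hca : E t r p) {f : V → ℝ} (hf : ∀ a b, E t a b → f a ≠ 0) :
    ∃ d, IsAlt t d ∧ con d f = con (triChain ℝ p q r) f := by
  obtain ⟨d, hd, hd'⟩ := exists_filling hs hr hH hab hbc hca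
  have hp := hf _ _ hab
  have hq := hf _ _ hbc
  have hr' := hf _ _ hca
  -- Dividing by `f a * f b * f c` cancels the weight in the contraction with `f`; the factor `κ`
  -- restores the opposite weight on each of the three edges, such as `f r` on `pq`.
  let κ := f p * f q * f r
  refine ⟨fun a b c => d a b c * (κ / (f a * f b * f c)), ⟨fun a b c => ?_, fun a b c => ?_,
    fun a b c hne => hd.supp _ _ _ (left_ne_zero_of_mul hne)⟩, ?_⟩
  · rw [hd.swap a b c, mul_comm (f b) (f a)]
    ring
  · rw [hd.swap' a b c, mul_right_comm (f a) (f c) (f b)]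
    ring
  · funext a b
    have h1 : con (fun a b c => d a b c * (κ / (f a * f b * f c))) f a b =
        (∑ c, d a b c) * (κ / (f a * f b)) := by
      rw [con, Finset.sum_mul]
      refine Finset.sum_congr rfl fun c _ => ?_
      by_cases h0 : d a b c = 0
      · simp [h0]
      · have hc : f c ≠ 0 := hf c a ⟨b, hr _ _ _ (hr _ _ _ (hd.supp _ _ _ h0))⟩
        rw [mul_assoc]
        congr 1
        rw [div_mul_eq_mul_div, mul_div_mul_right _ _ hc]
    have hg : ∀ a b, κ / (f a * f b) = κ / (f b * f a) := fun a b => by rw [mul_comm]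
    rw [h1, hd', con_triChain]
    simp only [cycleChain, Pi.add_apply, add_mul]
    rw [edgeChain_mul a b _ hg, edgeChain_mul a b _ hg, edgeChain_mul a b _ hg]
    simp only [κ]
    field_simp

/-- The complement of a patch. -/
def rest (K D : V → V → V → Prop) (a b c : V) : Prop := K a b c ∧ ¬ D a b c

variable (hK : IsSurf K) (hP : Patch K D {p, q, r}) (hne : p ≠ q ∧ p ≠ r ∧ q ≠ r)
  (hU : ∀ a b, E K a b → b ∈ U) (hx : Gen {1, 2, 3} U x) (h2 : TrivialH1 D (ZMod 2))
  (hR : TrivialH1 D ℝ)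

include hK hP

omit [Fintype V] in
theorem Patch.rest_swap (a b c : V) (h : rest K D a b c) : rest K D b a c :=
  ⟨hK.swap _ _ _ h.1, fun hD => h.2 (hP.swap _ _ _ hD)⟩

omit [Fintype V] in
theorem Patch.rest_rot (a b c : V) (h : rest K D a b c) : rest K D b c a :=
  ⟨hK.rot _ _ _ h.1, fun hD => h.2 (hP.rot _ _ _ (hP.rot _ _ _ hD))⟩

include hne in
omit hK [Fintype V] in
theorem Patch.edges : E D p q ∧ E D q r ∧ E D r p :=
  ⟨hP.edge (by simp) (by simp) hne.1, hP.edge (by simp) (by simp) hne.2.2,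
    hP.edge (by simp) (by simp) hne.2.1.symm⟩

include hne hU hx h2 hR

/-- Pinning is stress-freeness of the capped patch; the filling comes from the vanishing of real
first cohomology of `D`. -/
theorem Patch.plug : Plug (rest K D) D p q r x := by
  have hE : ∀ a b, E D a b → E K a b := fun a b ⟨c, hc⟩ => ⟨c, hP.le _ _ _ hc⟩
  obtain ⟨e1, e2, e3⟩ := hP.edges hne
  have hUp : p ∈ U := hU _ _ (hE _ _ e3)
  have hUq : q ∈ U := hU _ _ (hE _ _ e1)
  have hUr : r ∈ U := hU _ _ (hE _ _ e2)
  have hS := hP.cap hK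
  refine ⟨hP.swap, hP.rot, hP.rest_swap hK, hP.rest_rot hK, hne, ?_, fun h => h.2, ?_, ?_, ?_⟩
  · intro a b c hD ha b' c' h'
    exact h'.2 (hP.full_of_left hK ha hD h'.1)
  · intro c hsw hsupp heq a ha b
    have hU' : ∀ a b, E (fun a b c => D a b c ∨ triangleOf {p, q, r} a b c) a b → b ∈ U := by
      rintro a b ⟨c, hc | hc⟩
      · exact hU _ _ (hE _ _ ⟨c, hc⟩)
      · have := hc.1.2.1
        simp only [Finset.mem_insert, Finset.mem_singleton] at this
        rcases this with rfl | rfl | rfl <;> assumption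
    refine eq_zero_of_equilibrium_off (t := fun a b c => D a b c ∨ triangleOf {p, q, r} a b c)
      (fun c hc => hS.stress_free (hP.cap_trivialH1 h2) hU' hx hc) hx (T := {p, q, r}) ?_ hP.card
      ?_ hsw ?_ heq ha b
    · simp [Finset.insert_subset_iff, hUp, hUq, hUr]
    · intro a ha b hb hab
      obtain ⟨c, hc⟩ := hP.edge ha hb hab
      exact ⟨c, Or.inl hc⟩
    · intro a b h0
      obtain ⟨c, hc⟩ := hsupp a b h0
      exact ⟨c, Or.inl hc⟩
  · exact exists_weighted_filling hP.swap hP.rot hR e1 e2 e3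
      (fun a b hab => hx.ne_zero (by simp) (hU _ _ (hK.E_symm (hE _ _ hab))))
  · exact ⟨hx.ne_zero (by simp) hUp, hx.ne_zero (by simp) hUq, hx.ne_zero (by simp) hUr⟩

omit [Fintype V] hne hU hx h2 hR in
/-- Boundary edges survive the contraction. -/
theorem Patch.contr_edge (huv : E D u v) (hv : v ∉ ({p, q, r} : Finset V)) {a b : V}
    (ha : a ∈ ({p, q, r} : Finset V)) (hb : b ∈ ({p, q, r} : Finset V)) (hab : a ≠ b) :
    E (contr D u v) a b := by
  have main : ∀ a b, a ∈ ({p, q, r} : Finset V) → b ∈ ({p, q, r} : Finset V) → a ≠ b → a = u →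
      ∀ c, D a b c → E (contr D u v) a b := by
    rintro a b ha hb hab rfl c hc
    have hav : a ≠ v := fun h => hv (h ▸ ha)
    have hbv : b ≠ v := fun h => hv (h ▸ hb)
    have hne1 := hP.ne hK (hP.rot _ _ _ hc)
    have hne2 := (hP.ne hK (hP.rot _ _ _ (hP.rot _ _ _ hc))).symm
    by_cases hcv : c = v
    · subst hcv
      have h1 := hP.rot _ _ _ hc
      obtain ⟨w, hwa, hw, -⟩ := hK.two _ _ _ (hK.rot _ _ _ (hP.le _ _ _ hc))
      have hw' := hP.full_of_edge hK h1 (fun hh => hv hh.2) hw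
      have e1 := hP.ne hK (hP.rot _ _ _ hw')
      have e2 := (hP.ne hK (hP.rot _ _ _ (hP.rot _ _ _ hw'))).symm
      exact ⟨w, hab, hwa.symm, e2, c, b, w, hP.swap _ _ _ hw', by simp, by simp [hbv],
        by simp [e1.symm]⟩
    · exact ⟨c, hab, hne2, hne1, a, b, c, hc, by simp [hav], by simp [hbv], by simp [hcv]⟩
  obtain ⟨c, hc⟩ := hP.edge ha hb hab
  have hav : a ≠ v := fun h => hv (h ▸ ha)
  have hbv : b ≠ v := fun h => hv (h ▸ hb)
  by_cases hau : a = u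
  · exact main a b ha hb hab hau c hc
  by_cases hbu : b = u
  · obtain ⟨d, hd⟩ := main b a hb ha hab.symm hbu c (hP.swap _ _ _ hc)
    exact ⟨d, contr_swap hP.swap hd⟩
  have hne1 := hP.ne hK (hP.rot _ _ _ hc)
  have hne2 := (hP.ne hK (hP.rot _ _ _ (hP.rot _ _ _ hc))).symm
  by_cases hcv : c = v
  · exact ⟨u, hab, hau, hbu, a, b, c, hc, by simp [hav], by simp [hbv], by simp [hcv]⟩
  · exact ⟨c, hab, hne2, hne1, a, b, c, hc, by simp [hav], by simp [hbv], by simp [hcv]⟩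

omit [Fintype V] hK hP hne hU hx h2 hR in
-- Contraction commutes with capping, because the deleted vertex is off the boundary triangle.
theorem contr_or_triangleOf (hv : v ∉ ({p, q, r} : Finset V)) :
    contr (fun a b c => D a b c ∨ triangleOf {p, q, r} a b c) u v =
      fun a b c => contr D u v a b c ∨ triangleOf {p, q, r} a b c := by
  funext a b c
  apply propext
  constructor
  · rintro ⟨n1, n2, n3, a', b', c', h | h, rfl, rfl, rfl⟩
    · exact Or.inl ⟨n1, n2, n3, a', b', c', h, rfl, rfl, rfl⟩
    · right
      have e1 : a' ≠ v := fun hh => hv (hh ▸ h.1.1)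
      have e2 : b' ≠ v := fun hh => hv (hh ▸ h.1.2.1)
      have e3 : c' ≠ v := fun hh => hv (hh ▸ h.1.2.2)
      simpa [e1, e2, e3] using h
  · rintro (⟨n1, n2, n3, a', b', c', h, rfl, rfl, rfl⟩ | h)
    · exact ⟨n1, n2, n3, a', b', c', Or.inl h, rfl, rfl, rfl⟩
    · have e1 : a ≠ v := fun hh => hv (hh ▸ h.1.1)
      have e2 : b ≠ v := fun hh => hv (hh ▸ h.1.2.1)
      have e3 : c ≠ v := fun hh => hv (hh ▸ h.1.2.2)
      exact ⟨h.2.1, h.2.2.1, h.2.2.2, a, b, c, Or.inr h, by simp [e1], by simp [e2], by simp [e3]⟩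

omit [Fintype V] hne hU hx h2 hR in
-- All triangles at the interior vertex `v` belong to `D`, so the complement of `D` is untouched.
theorem Patch.contr_eq (hv : v ∉ ({p, q, r} : Finset V)) (hvD : ∃ a b, D v a b) :
    contr K u v = fun a b c => rest K D a b c ∨ contr D u v a b c := by
  obtain ⟨y, z, hyz⟩ := hvD
  funext a b c
  apply propext
  have hrest : ∀ a b c, rest K D a b c → a ≠ v := by
    rintro a b c h rfl
    exact h.2 (hP.full_of_left hK hv hyz h.1)
  have hrest3 : ∀ a b c, rest K D a b c → a ≠ v ∧ b ≠ v ∧ c ≠ v := fun a b c h =>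
    ⟨hrest _ _ _ h, hrest _ _ _ (hP.rest_rot hK _ _ _ h),
      hrest _ _ _ (hP.rest_rot hK _ _ _ (hP.rest_rot hK _ _ _ h))⟩
  constructor
  · rintro ⟨n1, n2, n3, a', b', c', h, rfl, rfl, rfl⟩
    by_cases hD : D a' b' c'
    · exact Or.inr ⟨n1, n2, n3, a', b', c', hD, rfl, rfl, rfl⟩
    · obtain ⟨e1, e2, e3⟩ := hrest3 _ _ _ ⟨h, hD⟩
      left
      have hr : rest K D a' b' c' := ⟨h, hD⟩
      rw [if_neg e1, if_neg e2, if_neg e3]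
      exact hr
  · rintro (h | ⟨n1, n2, n3, a', b', c', h, rfl, rfl, rfl⟩)
    · obtain ⟨e1, e2, e3⟩ := hrest3 _ _ _ h
      exact ⟨hK.ne _ _ _ h.1, (hK.E_ne (hK.E₂ h.1)), (hK.E_ne (hK.E₃ h.1)), a, b, c, h.1,
        by simp [e1], by simp [e2], by simp [e3]⟩
    · exact ⟨n1, n2, n3, a', b', c', hP.le _ _ _ h, rfl, rfl, rfl⟩

/-- The cap of the contracted patch is the contraction of the cap, hence again a closed surface with
trivial first cohomology, provided `uv` is contractible in the cap. This fails only when the cap is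
a tetrahedron boundary, and then the contracted patch has no interior vertex. -/
theorem Patch.plug_contr (hc : Contractible K u v) (hv : v ∉ ({p, q, r} : Finset V))
    (hvD : ∃ a b, D v a b) : Plug (rest K D) (contr D u v) p q r x := by
  have hE : ∀ a b, E D a b → E K a b := fun a b ⟨c, hc⟩ => ⟨c, hP.le _ _ _ hc⟩
  obtain ⟨y, z, hyz⟩ := hvD
  have huv := hK.E_ne hc.edge
  have full : ∀ {c d}, K v c d → D v c d := fun h => hP.full_of_left hK hv hyz h
  have huvD : E D u v := by
    obtain ⟨w, hw⟩ := hc.edge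
    exact ⟨w, hP.swap _ _ _ (full (hK.swap _ _ _ hw))⟩
  have hle : ∀ {w}, K u v w → D u v w := fun h => hP.swap _ _ _ (full (hK.swap _ _ _ h))
  have hPl := hP.plug hK hne hU hx h2 hR
  have hS := hP.cap hK
  have hU' : ∀ a b, E (fun a b c => D a b c ∨ triangleOf {p, q, r} a b c) a b → E D a b := by
    rintro a b ⟨c, hc | hc⟩
    · exact ⟨c, hc⟩
    · exact hP.edge hc.1.1 hc.1.2.1 hc.2.1
  have hUC : ∀ a b, E (contr D u v) a b → a ∈ U := by
    rintro a b ⟨c, n1, n2, n3, a', b', c', h, rfl, rfl, rfl⟩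
    split_ifs with h1
    · exact hU _ _ (hK.E_symm (hE _ _ huvD))
    · exact hU _ _ (hK.E_symm (hE _ _ ⟨_, h⟩))
  have vert : ∀ a b c, contr D u v a b c → a ∉ ({p, q, r} : Finset V) → ∃ b c, D a b c := by
    rintro a b c ⟨n1, n2, n3, a', b', c', h, rfl, rfl, rfl⟩ ha
    by_cases h1 : a' = v
    · obtain ⟨w, hw⟩ := huvD
      exact ⟨v, w, by simpa [h1] using hw⟩
    · exact ⟨b', c', by simpa [h1] using h⟩
  have hswap : ∀ a b c, contr D u v a b c → contr D u v b a c :=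
    fun _ _ _ => contr_swap hP.swap
  have hrot : ∀ a b c, contr D u v a b c → contr D u v b c a :=
    fun _ _ _ => contr_rot hP.rot
  refine ⟨hswap, hrot, hP.rest_swap hK, hP.rest_rot hK, hne, ?_, ?_, ?_, ?_, hPl.pos⟩
  · intro a b c h ha b' c' h'
    obtain ⟨b₁, c₁, h₁⟩ := vert a b c h ha
    exact h'.2 (hP.full_of_left hK ha h₁ h'.1)
  · rintro hRest ⟨-, -, -, a, b, c, h, ha, hb, hc'⟩
    -- one of the vertices of the triangle is `v`, and the image of the triangle is `pqr`
    have main : ∀ {a b a₁ b₁ : V}, D v a b → K u a₁ b₁ → a₁ = a → b₁ = b → False := by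
      rintro a b _ _ hD hKu rfl rfl
      have k1 := hP.le _ _ _ hD
      have hab := hK.ne _ _ _ (hK.rot _ _ _ k1)
      -- Otherwise `u`, `v`, `a`, `b` would span all four triangles of a tetrahedron in `K`.
      exact hc.tetra _ _ hab (hc.miss _ ⟨_, hKu⟩ ⟨_, k1⟩)
        (hc.miss _ (hK.E₂ hKu) (hK.E₂ k1)) hKu k1
    have kpqr := hRest.1
    by_cases hav : a = v
    · subst hav
      rw [if_pos rfl] at ha
      have hb' : b ≠ a := (hP.ne hK h).symm
      have hc'' : c ≠ a := hP.ne hK (hP.rot _ _ _ (hP.rot _ _ _ h))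
      rw [if_neg hb'] at hb
      rw [if_neg hc''] at hc'
      subst ha
      exact main h kpqr hb.symm hc'.symm
    by_cases hbv : b = v
    · subst hbv
      rw [if_pos rfl] at hb
      have hc'' : c ≠ b := (hP.ne hK (hP.rot _ _ _ h)).symm
      rw [if_neg hav] at ha
      rw [if_neg hc''] at hc'
      subst hb
      exact main (hP.rot _ _ _ h) (hK.rot _ _ _ kpqr) hc'.symm ha.symm
    by_cases hcv : c = v
    · subst hcv
      rw [if_pos rfl] at hc'
      rw [if_neg hav] at ha
      rw [if_neg hbv] at hb
      subst hc'
      exact main (hP.rot _ _ _ (hP.rot _ _ _ h)) (hK.rot _ _ _ (hK.rot _ _ _ kpqr)) ha.symm hb.symm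
    · rw [if_neg hav] at ha
      rw [if_neg hbv] at hb
      rw [if_neg hcv] at hc'
      subst ha hb hc'
      exact hRest.2 h
  · intro c hsw hsupp heq a ha b
    -- In the tetrahedral case the boundary triangle is `{u, a₁, b₁}`, and every vertex of the
    -- contracted patch lies on it, so pinning is vacuous.
    by_cases htet : ∃ a b, a ≠ b ∧ D u v a ∧ D u v b ∧
        (D u a b ∨ triangleOf {p, q, r} u a b) ∧ D v a b
    · obtain ⟨a₁, b₁, hab, t1, t2, t3, t4⟩ := htet
      have hvs := fun w z (hw : E (fun a b c => D a b c ∨ triangleOf {p, q, r} a b c) w z) =>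
        hS.tetra_vertices hab (Or.inl t1) (Or.inl t2) t3 (Or.inl t4) hw
      have hTs : ∀ w ∈ ({p, q, r} : Finset V), w = u ∨ w = a₁ ∨ w = b₁ := by
        intro w hw
        obtain ⟨w', hw', hww⟩ := Finset.exists_mem_ne
          (show 1 < ({p, q, r} : Finset V).card by rw [hP.card]; norm_num) w
        obtain ⟨z, hz⟩ := hP.edge hw hw' hww.symm
        rcases hvs w w' ⟨z, Or.inl hz⟩ with rfl | rfl | h | h
        · exact Or.inl rfl
        · exact absurd hw hv
        · exact Or.inr (Or.inl h)
        · exact Or.inr (Or.inr h)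
      have hTs' : ({p, q, r} : Finset V) = {u, a₁, b₁} := by
        refine Finset.eq_of_subset_of_card_le (fun w hw => by simpa using hTs w hw) ?_
        rw [hP.card]
        exact Finset.card_le_three
      by_contra h0
      obtain ⟨z, -, -, -, a', b', c', h, rfl, rfl, rfl⟩ := hsupp a b h0
      apply ha
      rw [hTs']
      split_ifs with h1
      · simp
      · rcases hvs a' b' ⟨c', Or.inl h⟩ with rfl | rfl | rfl | rfl
        · simp
        · exact absurd rfl h1
        · simp
        · simp
    · have hcS : Contractible (fun a b c => D a b c ∨ triangleOf {p, q, r} a b c) u v := by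
        obtain ⟨w, hw⟩ := huvD
        have redv : ∀ {a b}, (D v a b ∨ triangleOf {p, q, r} v a b) → D v a b := by
          rintro a b (h | h)
          · exact h
          · exact absurd h.1.1 hv
        have redu : ∀ {b}, (D u v b ∨ triangleOf {p, q, r} u v b) → D u v b := by
          rintro b (h | h)
          · exact h
          · exact absurd h.1.2.1 hv
        refine ⟨⟨w, Or.inl hw⟩, ?_, ?_⟩
        · rintro w h1 ⟨z, h2⟩
          exact Or.inl (hle (hc.miss w (hE _ _ (hU' _ _ h1)) ⟨z, hP.le _ _ _ (redv h2)⟩))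
        · intro a b hab h1 h2 h3 h4
          exact htet ⟨a, b, hab, redu h1, redu h2, h3, redv h4⟩
      have hS' := hS.contr hcS
      have hH' := (hP.cap_trivialH1 h2).contr hcS.edge
      rw [contr_or_triangleOf hv] at hS' hH'
      have hTU : ∀ w ∈ ({p, q, r} : Finset V), w ∈ U.erase v := by
        intro w hw
        obtain ⟨w', hw', hww⟩ := Finset.exists_mem_ne
          (show 1 < ({p, q, r} : Finset V).card by rw [hP.card]; norm_num) w
        exact Finset.mem_erase.2 ⟨fun h => hv (h ▸ hw), hU _ _ (hE _ _ (hP.edge hw' hw hww))⟩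
      have hU'' : ∀ a b, E (fun a b c => contr D u v a b c ∨ triangleOf {p, q, r} a b c) a b →
          b ∈ U.erase v := by
        rintro a b ⟨c, hc | hc⟩
        · exact Finset.mem_erase.2 ⟨(contr_ne huv hc).2.1, hUC _ _ ⟨c, hswap _ _ _ hc⟩⟩
        · exact hTU _ hc.1.2.1
      have hx' : Gen {1, 2, 3} (U.erase v) x := hx.mono subset_rfl (Finset.erase_subset _ _)
      refine eq_zero_of_equilibrium_off (fun c hc => hS'.stress_free hH' hU'' hx' hc) hx'
        (T := {p, q, r}) hTU hP.card ?_ hsw ?_ heq ha b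
      · intro a ha b hb hab
        obtain ⟨c, hc⟩ := hP.contr_edge hK huvD hv ha hb hab
        exact ⟨c, Or.inl hc⟩
      · intro a b h0
        obtain ⟨c, hc⟩ := hsupp a b h0
        exact ⟨c, Or.inl hc⟩
  · refine exists_weighted_filling hswap hrot (hR.contr huvD)
      (hP.contr_edge hK huvD hv (by simp) (by simp) hne.1)
      (hP.contr_edge hK huvD hv (by simp) (by simp) hne.2.2)
      (hP.contr_edge hK huvD hv (by simp) (by simp) hne.2.1.symm) ?_
    exact fun a b hab => hx.ne_zero (by simp) (hUC _ _ hab)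

end PlugOfPatch

/-! ### The dual form of shifting, and triples containing 1. -/

section Pairing

variable {V : Type*} [Fintype V]

/-- The lexicographic order on triples. -/
def TripleLT (i' j' k' i j k : ℕ) : Prop := i' < i ∨ i' = i ∧ (j' < j ∨ j' = j ∧ k' < k)

/-- The pairing of a bilinear form with two vectors. -/
def pair₂ (c : V → V → ℝ) (g h : V → ℝ) : ℝ := ∑ a, (∑ b, c a b * h b) * g a

/-- The pairing of a trilinear form with three vectors. -/
def pair₃ {k : Type*} [Ring k] (m : V → V → V → k) (f g h : V → k) : k :=
  ∑ a, ∑ b, ∑ c, m a b c * (f a * g b * h c)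

/-- The form `f_i ∧ f_j ∧ f_k` is not a combination of lexicographically smaller ones, i.e. there
is a functional which vanishes on the latter but not on the former. -/
def IsShift (t : V → V → V → Prop) (x : ℕ → V → ℝ) (n i j k : ℕ) : Prop :=
  ∃ m : V → V → V → ℝ, IsAlt t m ∧
    (∀ i' j' k', 1 ≤ i' → i' < j' → j' < k' → k' ≤ n → TripleLT i' j' k' i j k →
      pair₃ m (x i') (x j') (x k') = 0) ∧ pair₃ m (x i) (x j) (x k) ≠ 0

variable {t : V → V → V → Prop} {x : ℕ → V → ℝ} {U : Finset V} {n : ℕ}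

theorem IsAlt.pair₃_eq {m : V → V → V → ℝ} (hm : IsAlt t m) (f g h : V → ℝ) :
    pair₃ m f g h = pair₂ (con m f) g h := by
  simp only [pair₃, pair₂, con, Finset.sum_mul]
  rw [Finset.sum_comm]
  refine Finset.sum_congr rfl fun b _ => ?_
  rw [Finset.sum_comm]
  refine Finset.sum_congr rfl fun c _ => Finset.sum_congr rfl fun a _ => ?_
  rw [hm.rot a b c]
  ring

theorem pair₂_swap {c : V → V → ℝ} (hc : ∀ a b, c b a = -c a b) (g h : V → ℝ) :
    pair₂ c h g = -pair₂ c g h := by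
  simp only [pair₂, Finset.sum_mul, ← Finset.sum_neg_distrib]
  rw [Finset.sum_comm]
  refine Finset.sum_congr rfl fun b _ => Finset.sum_congr rfl fun a _ => ?_
  rw [hc a b]
  ring

theorem pair₂_self {c : V → V → ℝ} (hc : ∀ a b, c b a = -c a b) (g : V → ℝ) :
    pair₂ c g g = 0 := by
  have := pair₂_swap hc g g
  linarith

/-- Vectors orthogonal to all generic rows vanish. -/
theorem sum_eq_zero_of_pair₂ {c : V → V → ℝ} (hx : Gen (Finset.Icc 1 n) U x) (hn : U.card = n)
    (hU : ∀ a b, c a b ≠ 0 → a ∈ U) {j : ℕ}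
    (h : ∀ l, 1 ≤ l → l ≤ n → pair₂ c (x l) (x j) = 0) (a : V) : ∑ b, c a b * x j b = 0 := by
  refine congrFun (hx.eq_zero_of_sum_eq_zero (by simp [hn]) (fun a => ∑ b, c a b * x j b)
    (fun a ha => ?_) fun i hi => ?_) a
  · refine Finset.sum_eq_zero fun b _ => ?_
    rw [show c a b = 0 from by_contra fun h0 => ha (hU a b h0), zero_mul]
  · exact h i (Finset.mem_Icc.1 hi).1 (Finset.mem_Icc.1 hi).2

/-- The sets `{1, j, k}` with `j ≥ 4` in the shifting only depend on the space of stresses that are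
boundaries. -/
theorem isShift_one_iff (hx : Gen (Finset.Icc 1 n) U x) (hn : U.card = n)
    (hU : ∀ a b, E t a b → a ∈ U) {j k : ℕ} (hj : 4 ≤ j) (hjk : j < k) (hk : k ≤ n) :
    IsShift t x n 1 j k ↔ ∃ c ∈ boundaryStress t x,
      (∀ j' k', 4 ≤ j' → j' < k' → k' ≤ n → (j' < j ∨ j' = j ∧ k' < k) →
        pair₂ c (x j') (x k') = 0) ∧ pair₂ c (x j) (x k) ≠ 0 := by
  constructor
  · rintro ⟨m, hm, h0, h1⟩
    -- Every `{1, i, l}` with `i` equal to 2 or 3 precedes `{1, j, k}`, because `4 ≤ j`.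
    -- Orthogonality to all rows then turns these vanishing pairings into equilibrium.
    have key : ∀ i ∈ ({2, 3} : Finset ℕ), ∀ l, 1 ≤ l → l ≤ n →
        pair₂ (con m (x 1)) (x l) (x i) = 0 := by
      intro i hi l hl hln
      have hi' : 2 ≤ i ∧ i ≤ 3 := by
        simp only [Finset.mem_insert, Finset.mem_singleton] at hi
        omega
      rcases eq_or_ne l 1 with rfl | hl1
      · rw [pair₂_swap (hm.con_swap _), pair₂]
        simp [hm.con_con_self]
      rcases lt_trichotomy l i with h | rfl | h
      · rw [← hm.pair₃_eq]
        exact h0 1 l i le_rfl (by omega) h (by omega) (Or.inr ⟨rfl, Or.inl (by omega)⟩)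
      · exact pair₂_self (hm.con_swap _) _
      · rw [pair₂_swap (hm.con_swap _), ← hm.pair₃_eq, neg_eq_zero]
        exact h0 1 i l le_rfl (by omega) h (by omega) (Or.inr ⟨rfl, Or.inl (by omega)⟩)
    refine ⟨con m (x 1), ⟨m, hm, rfl, fun i hi a => ?_⟩, fun j' k' h4 hjk' hkn hlt => ?_, ?_⟩
    · exact sum_eq_zero_of_pair₂ hx hn (fun a b h => hU _ _ (hm.con_supp _ h)) (key i hi) a
    · rw [← hm.pair₃_eq]
      exact h0 1 j' k' le_rfl (by omega) hjk' hkn (Or.inr ⟨rfl, hlt⟩)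
    · rwa [← hm.pair₃_eq]
  · rintro ⟨_, ⟨m, hm, rfl, heq⟩, h0, h1⟩
    refine ⟨m, hm, fun i' j' k' hi hij hjk' hkn hlt => ?_, by rwa [hm.pair₃_eq]⟩
    rcases hlt with h | ⟨rfl, hlt⟩
    · omega
    rw [hm.pair₃_eq]
    by_cases h4 : 4 ≤ j'
    · exact h0 j' k' h4 hjk' hkn hlt
    · rw [pair₂_swap (hm.con_swap _), pair₂]
      simp [heq j' (by simp; omega)]

/-- Deleting a generic row and a vertex not on the support of the stresses has no effect. -/
theorem boundaryStress_pair_iff {t' : V → V → V → Prop} {U' : Finset V} {n' : ℕ}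
    (hst : boundaryStress t x = boundaryStress t' x) (hn : n = n' + 1)
    (hx' : Gen (Finset.Icc 1 n') U' x) (hn' : U'.card = n') (hU' : ∀ a b, E t' a b → a ∈ U')
    {j k : ℕ} (hj : 4 ≤ j) (hjk : j < k) :
    (k ≤ n ∧ ∃ c ∈ boundaryStress t x,
      (∀ j' k', 4 ≤ j' → j' < k' → k' ≤ n → (j' < j ∨ j' = j ∧ k' < k) →
        pair₂ c (x j') (x k') = 0) ∧ pair₂ c (x j) (x k) ≠ 0) ↔
    (k ≤ n' ∧ ∃ c ∈ boundaryStress t' x,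
      (∀ j' k', 4 ≤ j' → j' < k' → k' ≤ n' → (j' < j ∨ j' = j ∧ k' < k) →
        pair₂ c (x j') (x k') = 0) ∧ pair₂ c (x j) (x k) ≠ 0) := by
  -- Rows 1 to `n'` form a basis on `U'`, and rows 1, 2, 3 already annihilate `c`. So vanishing
  -- against the remaining rows annihilates row `j'` at every vertex, and its pairing with any
  -- further row is zero.
  have key : ∀ c ∈ boundaryStress t' x, ∀ j', (∀ l, 4 ≤ l → l ≤ n' → l ≠ j' →
      pair₂ c (x l) (x j') = 0) → ∀ l, pair₂ c (x l) (x j') = 0 := by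
    rintro _ ⟨m, hm, rfl, heq⟩ j' h0 l
    rw [pair₂]
    refine Finset.sum_eq_zero fun a _ => ?_
    suffices h : ∀ l, 1 ≤ l → l ≤ n' → pair₂ (con m (x 1)) (x l) (x j') = 0 by
      rw [sum_eq_zero_of_pair₂ hx' hn' (fun a b h => hU' _ _ (hm.con_supp _ h)) h a, zero_mul]
    intro l hl hln
    by_cases hlj : l = j'
    · rw [hlj]
      exact pair₂_self (hm.con_swap _) _
    by_cases h4 : 4 ≤ l
    · exact h0 l h4 hln hlj
    · rw [pair₂_swap (hm.con_swap _), pair₂]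
      rcases eq_or_ne l 1 with rfl | hl1
      · simp [hm.con_con_self]
      · simp [heq l (by simp; omega)]
  have hsw : ∀ c ∈ boundaryStress t' x, ∀ a b, c b a = -c a b := by
    rintro _ ⟨m, hm, rfl, -⟩ a b
    exact hm.con_swap _ a b
  rw [hst]
  constructor
  · rintro ⟨hk, c, hc, h0, h1⟩
    refine ⟨?_, c, hc, fun j' k' h4 hjk' hkn => h0 j' k' h4 hjk' (by omega), h1⟩
    by_contra hcon
    refine h1 ?_
    rw [pair₂_swap (hsw c hc), key c hc j ?_ k, neg_zero]
    intro l hl hln hne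
    rcases lt_or_gt_of_ne hne with h | h
    · exact h0 l j hl h (by omega) (Or.inl h)
    · rw [pair₂_swap (hsw c hc), h0 j l hj h (by omega) (Or.inr ⟨rfl, by omega⟩), neg_zero]
  · rintro ⟨hk, c, hc, h0, h1⟩
    refine ⟨by omega, c, hc, fun j' k' h4 hjk' hkn hlt => ?_, h1⟩
    by_cases hkn' : k' ≤ n'
    · exact h0 j' k' h4 hjk' hkn' hlt
    -- Here `k'` is the extra row `n`. Precedence before `{j, k}` with `k ≤ n'` forces `j' < j`, so
    -- all pairs containing `j'` among the old rows are available.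
    rw [pair₂_swap (hsw c hc), key c hc j' ?_ k', neg_zero]
    intro l hl hln hne
    have hjj : j' < j := by omega
    rcases lt_or_gt_of_ne hne with h | h
    · exact h0 l j' hl h (by omega) (Or.inl (by omega))
    · rw [pair₂_swap (hsw c hc), h0 j' l h4 h (by omega) (Or.inl hjj), neg_zero]

end Pairing

/-! ### Triples without 1 and weighted cycles. -/

section Cycles

variable {V : Type*} [Fintype V] [DecidableEq V] {t : V → V → V → Prop} {x : ℕ → V → ℝ}
  {U : Finset V} {n : ℕ}

/-- The variable `x i a`. -/
noncomputable def genVar (I : Finset ℕ) (U : Finset V) (i : ℕ) (a : V) :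
    MvPolynomial (I × U) ℚ :=
  if h : i ∈ I ∧ a ∈ U then MvPolynomial.X (⟨i, h.1⟩, ⟨a, h.2⟩) else 0

omit [Fintype V] in
theorem aeval_genVar {k : Type*} [CommRing k] [Algebra ℚ k] {I : Finset ℕ} (y : ℕ → V → k) {i : ℕ}
    (hi : i ∈ I) {a : V} (ha : a ∈ U) :
    MvPolynomial.aeval (fun p : I × U => y p.1 p.2) (genVar I U i a) = y i a := by
  simp [genVar, hi, ha]

/-- A nonzero cycle pairs nontrivially with three further generic vectors. -/
theorem IsSurf.pair₃_ne_zero (h : IsSurf t) (hU : ∀ a b, E t a b → a ∈ U)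
    (hx : Gen {1, 2, 3, 4} U x) {m : V → V → V → ℝ} (hm : IsAlt t m) (hm0 : m ≠ 0)
    (hc : con m (x 1) = 0) : pair₃ m (x 2) (x 3) (x 4) ≠ 0 := by
  intro h0
  obtain ⟨a₀, b₀, c₀, hm0⟩ : ∃ a b c, m a b c ≠ 0 := by
    by_contra hcon
    push Not at hcon
    exact hm0 (by funext a b c; exact hcon a b c)
  have hpos : ∀ a ∈ U, x 1 a ≠ 0 := fun a ha => hx.ne_zero (by simp) ha
  have htU : ∀ {a b c}, t a b c → a ∈ U ∧ b ∈ U ∧ c ∈ U := fun h' =>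
    ⟨hU _ _ ⟨_, h'⟩, hU _ _ (h.E₂ (h.swap _ _ _ h')), hU _ _ ⟨_, h.rot _ _ _ (h.rot _ _ _ h')⟩⟩
  have htr := hm.supp _ _ _ hm0
  have hdist : ∀ {a b c}, t a b c → a ≠ b ∧ a ≠ c ∧ b ≠ c := fun h' =>
    ⟨h.ne _ _ _ h', h.E_ne (h.E₂ h'), h.ne _ _ _ (h.rot _ _ _ h')⟩
  set κ := |m a₀ b₀ c₀ * (x 1 a₀ * x 1 b₀ * x 1 c₀)| with hκ
  have hκ0 : κ ≠ 0 := by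
    obtain ⟨u1, u2, u3⟩ := htU htr
    exact abs_ne_zero.2 (mul_ne_zero hm0 (mul_ne_zero (mul_ne_zero (hpos _ u1) (hpos _ u2))
      (hpos _ u3)))
  -- After rescaling by row 1 a cycle is `κ` times a sign on each triangle. Clearing denominators
  -- therefore makes its pairing `κ` times the value of a rational polynomial.
  have hσ : ∀ a b c, ∃ σ : ℚ, (m a b c ≠ 0 → σ ≠ 0) ∧ (m a b c = 0 → σ = 0) ∧
      m a b c * (x 1 a * x 1 b * x 1 c) = κ * σ := by
    intro a b c
    by_cases hz : m a b c = 0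
    · exact ⟨0, by simp [hz], by simp, by simp [hz]⟩
    · have := h.cycle_abs hm hc (hm.supp _ _ _ hz) htr
      rcases abs_choice (m a b c * (x 1 a * x 1 b * x 1 c)) with h1 | h1
      · exact ⟨1, by simp, by simp [hz], by rw [hκ, ← this, h1]; simp⟩
      · exact ⟨-1, by simp, by simp [hz], by rw [hκ, ← this, h1]; simp⟩
  choose σ hσ1 hσ0 hσ using hσ
  let I : Finset ℕ := {1, 2, 3, 4}
  let P : MvPolynomial (I × U) ℚ := ∑ a, ∑ b, ∑ c, MvPolynomial.C (σ a b c) *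
    ((∏ w ∈ U \ {a, b, c}, genVar I U 1 w) * (genVar I U 2 a * genVar I U 3 b * genVar I U 4 c))
  have heval : ∀ {k : Type} [Field k] [Algebra ℚ k] (y : ℕ → V → k),
      MvPolynomial.aeval (fun p : I × U => y p.1 p.2) P =
        ∑ a, ∑ b, ∑ c, algebraMap ℚ k (σ a b c) *
          ((∏ w ∈ U \ {a, b, c}, y 1 w) * (y 2 a * y 3 b * y 4 c)) := by
    intro k _ _ y
    simp only [P, map_sum, map_mul, MvPolynomial.aeval_C, map_prod]
    refine Finset.sum_congr rfl fun a _ => Finset.sum_congr rfl fun b _ =>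
      Finset.sum_congr rfl fun c _ => ?_
    by_cases hz : m a b c = 0
    · simp [hσ0 a b c hz]
    · obtain ⟨u1, u2, u3⟩ := htU (hm.supp _ _ _ hz)
      rw [aeval_genVar y (by simp [I]) u1, aeval_genVar y (by simp [I]) u2,
        aeval_genVar y (by simp [I]) u3]
      congr 2
      exact Finset.prod_congr rfl fun w hw =>
        aeval_genVar y (by simp [I]) (Finset.mem_sdiff.1 hw).1
  have hP : P ≠ 0 := by
    intro hP
    -- Row 1 constant and rows 2, 3, 4 indicator vectors isolate the triangle `a₀b₀c₀`, so the
    -- polynomial is nonzero.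
    have h1 := heval (k := ℚ) (fun i a => if i = 2 then (if a = a₀ then 1 else 0) else
      if i = 3 then (if a = b₀ then 1 else 0) else if i = 4 then (if a = c₀ then 1 else 0) else 1)
    rw [hP, map_zero, Finset.sum_eq_single a₀ (by intro b _ hb; simp [hb]) (by simp),
      Finset.sum_eq_single b₀ (by intro b _ hb; simp [hb]) (by simp),
      Finset.sum_eq_single c₀ (by intro b _ hb; simp [hb]) (by simp)] at h1
    simp at h1
    exact hσ1 _ _ _ hm0 h1.symm
  refine hx.aeval_ne_zero hP ?_
  rw [heval x]
  have h2 : κ * (∑ a, ∑ b, ∑ c, algebraMap ℚ ℝ (σ a b c) *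
      ((∏ w ∈ U \ {a, b, c}, x 1 w) * (x 2 a * x 3 b * x 4 c))) =
      (∏ w ∈ U, x 1 w) * pair₃ m (x 2) (x 3) (x 4) := by
    simp only [pair₃, Finset.mul_sum]
    refine Finset.sum_congr rfl fun a _ => Finset.sum_congr rfl fun b _ =>
      Finset.sum_congr rfl fun c _ => ?_
    by_cases hz : m a b c = 0
    · simp [hσ0 a b c hz, hz]
    · have htabc := hm.supp _ _ _ hz
      obtain ⟨u1, u2, u3⟩ := htU htabc
      obtain ⟨n1, n2, n3⟩ := hdist htabc
      have hsub : ({a, b, c} : Finset V) ⊆ U := by simp [Finset.insert_subset_iff, u1, u2, u3]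
      have h3 : ∏ w ∈ ({a, b, c} : Finset V), x 1 w = x 1 a * x 1 b * x 1 c := by
        rw [Finset.prod_insert (by simp [n1, n2]), Finset.prod_insert (by simp [n3]),
          Finset.prod_singleton, mul_assoc]
      rw [← Finset.prod_sdiff hsub, h3, eq_ratCast, ← mul_assoc, ← hσ a b c]
      ring
  rw [h0, mul_zero] at h2
  exact (mul_eq_zero.1 h2).resolve_left hκ0

/-- The only possible set in the shifting without the element `1` is `{2, 3, 4}`. -/
theorem IsSurf.isShift_iff_of_two_le (h : IsSurf t) (hU : ∀ a b, E t a b → a ∈ U)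
    (hx : Gen (Finset.Icc 1 n) U x) (hn : U.card = n) {i j k : ℕ} (hi : 2 ≤ i) (hij : i < j)
    (hjk : j < k) (hk : k ≤ n) :
    IsShift t x n i j k ↔ (i = 2 ∧ j = 3 ∧ k = 4) ∧ HasCycle t (x 1) := by
  have hx' : Gen {1, 2, 3, 4} U x := hx.mono (by
    intro a ha
    simp only [Finset.mem_insert, Finset.mem_singleton] at ha
    simp only [Finset.mem_Icc]
    omega) subset_rfl
  constructor
  · rintro ⟨m, hm, h0, h1⟩
    have hm0 : m ≠ 0 := by
      rintro rfl
      exact h1 (by simp [pair₃])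
    -- As `2 ≤ i`, every triple containing 1 is smaller, so the contraction with row 1 pairs to zero
    -- with all pairs of rows and must vanish.
    have hz : ∀ l l', 1 ≤ l → l < l' → l' ≤ n → pair₂ (con m (x 1)) (x l) (x l') = 0 := by
      intro l l' hl hll hn
      rcases eq_or_lt_of_le hl with rfl | hl1
      · rw [pair₂_swap (hm.con_swap _), pair₂]
        simp [hm.con_con_self]
      · rw [← hm.pair₃_eq]
        exact h0 1 l l' le_rfl hl1 hll hn (Or.inl (by omega))
    have hrow : ∀ l, 1 ≤ l → l ≤ n → ∀ a, ∑ b, con m (x 1) a b * x l b = 0 := by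
      intro l hl hln
      refine sum_eq_zero_of_pair₂ hx hn (fun a b h => hU _ _ (hm.con_supp _ h)) fun l' hl' hln' => ?_
      rcases lt_trichotomy l l' with h | rfl | h
      · rw [pair₂_swap (hm.con_swap _), hz l l' hl h hln', neg_zero]
      · exact pair₂_self (hm.con_swap _) _
      · exact hz l' l hl' h hln
    have hc : con m (x 1) = 0 := by
      funext a
      refine hx.eq_zero_of_sum_eq_zero (by simp [hn]) (con m (x 1) a) (fun b hb => ?_)
        fun l hl => hrow l (Finset.mem_Icc.1 hl).1 (Finset.mem_Icc.1 hl).2 a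
      by_contra h0
      exact hb (hU _ _ (h.E_symm (hm.con_supp _ h0)))
    refine ⟨?_, m, hm, hm0, hc⟩
    by_contra hne
    refine h.pair₃_ne_zero hU hx' hm hm0 hc (h0 2 3 4 (by norm_num) (by norm_num) (by norm_num)
      (by omega) ?_)
    unfold TripleLT
    omega
  · rintro ⟨⟨rfl, rfl, rfl⟩, m, hm, hm0, hc⟩
    refine ⟨m, hm, fun i' j' k' h1 h2 h3 h4 hlt => ?_, h.pair₃_ne_zero hU hx' hm hm0 hc⟩
    have : i' = 1 := by
      unfold TripleLT at hlt
      omega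
    rw [this, hm.pair₃_eq, hc]
    simp [pair₂]

end Cycles

/-! ### Independence of the generic matrix and of vertex labels. -/

section Independence

variable {V : Type*} [Fintype V] {t : V → V → V → Prop} {x y : ℕ → V → ℝ} {U : Finset V} {n : ℕ}

theorem pair₃_map {k l : Type*} [Ring k] [Ring l] (φ : k →+* l) (m : V → V → V → k)
    (f g h : V → k) : φ (pair₃ m f g h) =
      pair₃ (fun a b c => φ (m a b c)) (fun a => φ (f a)) (fun a => φ (g a)) fun a => φ (h a) := by
  simp [pair₃]

theorem IsAlt.pair₃_congr {k : Type*} [Ring k] {m : V → V → V → k} (hm : IsAlt t m)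
    (ht : ∀ a b c, t a b c → a ∈ U ∧ b ∈ U ∧ c ∈ U) {f g h f' g' h' : V → k}
    (hf : ∀ a ∈ U, f a = f' a) (hg : ∀ a ∈ U, g a = g' a) (hh : ∀ a ∈ U, h a = h' a) :
    pair₃ m f g h = pair₃ m f' g' h' := by
  refine Finset.sum_congr rfl fun a _ => Finset.sum_congr rfl fun b _ =>
    Finset.sum_congr rfl fun c _ => ?_
  by_cases hz : m a b c = 0
  · simp [hz]
  · obtain ⟨h1, h2, h3⟩ := ht _ _ _ (hm.supp _ _ _ hz)
    rw [hf a h1, hg b h2, hh c h3]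

/-- The shifting does not depend on the choice of the generic rows. -/
theorem IsShift.of_gen [DecidableEq V] (ht : ∀ a b c, t a b c → a ∈ U ∧ b ∈ U ∧ c ∈ U)
    (hx : Gen (Finset.Icc 1 n) U x) (hy : Gen (Finset.Icc 1 n) U y) {i j k : ℕ} (hi : 1 ≤ i)
    (hij : i < j) (hjk : j < k) (hk : k ≤ n) (h : IsShift t x n i j k) : IsShift t y n i j k := by
  set I := Finset.Icc 1 n with hI
  let A := MvPolynomial (I × U) ℚ
  -- Each generic matrix embeds the field of rational functions in its entries into the reals, so it
  -- suffices to descend the functional to `L` and extend it along the other embedding.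
  let L := FractionRing A
  have emb : ∀ z : ℕ → V → ℝ, Gen I U z → ∃ φ : L →+* ℝ, ∀ i ∈ I, ∀ a ∈ U,
      φ (algebraMap A L (genVar I U i a)) = z i a := by
    intro z hz
    let f : A →+* ℝ := (MvPolynomial.aeval fun p : I × U => z p.1 p.2).toRingHom
    have hf : Function.Injective f := hz
    refine ⟨IsFractionRing.lift hf, fun i hi a ha => ?_⟩
    rw [IsFractionRing.lift_algebraMap]
    exact aeval_genVar z hi ha
  obtain ⟨φ, hφ⟩ := emb x hx
  obtain ⟨ψ, hψ⟩ := emb y hy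
  let Z : ℕ → V → L := fun i a => algebraMap A L (genVar I U i a)
  let _ : Algebra L ℝ := φ.toAlgebra
  obtain ⟨m, hm, h0, h1⟩ := h
  -- An `L`-linear retraction of the reals onto `L` descends the chain. Dividing first by the
  -- nonzero pairing `s` makes that pairing one, which `ρ` preserves.
  obtain ⟨ρ, hρ⟩ := (Algebra.linearMap L ℝ).exists_leftInverse_of_injective
    (LinearMap.ker_eq_bot.2 φ.injective)
  have hρ1 : ρ 1 = 1 := by
    have := LinearMap.congr_fun hρ 1
    simpa using this
  set s := pair₃ m (x i) (x j) (x k) with hs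
  let m' : V → V → V → L := fun a b c => ρ (s⁻¹ * m a b c)
  have hm' : IsAlt t m' := by
    refine ⟨fun a b c => ?_, fun a b c => ?_, fun a b c hne => hm.supp a b c ?_⟩
    · simp only [m']
      rw [hm.swap a b c, mul_neg, map_neg]
    · simp only [m']
      rw [hm.swap' a b c, mul_neg, map_neg]
    · intro hz
      simp [m', hz] at hne
  have hpair : ∀ i ∈ I, ∀ j ∈ I, ∀ k ∈ I, pair₃ m' (Z i) (Z j) (Z k) =
      ρ (s⁻¹ * pair₃ m (x i) (x j) (x k)) := by
    intro i hi j hj k hk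
    simp only [pair₃, Finset.mul_sum, map_sum]
    refine Finset.sum_congr rfl fun a _ => Finset.sum_congr rfl fun b _ =>
      Finset.sum_congr rfl fun c _ => ?_
    by_cases hz : m a b c = 0
    · simp [m', hz]
    · obtain ⟨u1, u2, u3⟩ := ht _ _ _ (hm.supp _ _ _ hz)
      have : s⁻¹ * (m a b c * (x i a * x j b * x k c)) =
          (Z i a * Z j b * Z k c) • (s⁻¹ * m a b c) := by
        rw [Algebra.smul_def]
        change _ = φ _ * _
        rw [map_mul, map_mul, hφ i hi a u1, hφ j hj b u2, hφ k hk c u3]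
        ring
      rw [this, map_smul, smul_eq_mul, mul_comm]
  have hpair' : ∀ i ∈ I, ∀ j ∈ I, ∀ k ∈ I,
      pair₃ (fun a b c => ψ (m' a b c)) (y i) (y j) (y k) =
        ψ (ρ (s⁻¹ * pair₃ m (x i) (x j) (x k))) := by
    intro i hi j hj k hk
    rw [← hpair i hi j hj k hk, pair₃_map]
    refine IsAlt.pair₃_congr (t := t) (U := U) ?_ ht (fun a ha => (hψ i hi a ha).symm)
      (fun a ha => (hψ j hj a ha).symm) (fun a ha => (hψ k hk a ha).symm)
    refine ⟨fun a b c => ?_, fun a b c => ?_, fun a b c hne => hm'.supp a b c ?_⟩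
    · rw [hm'.swap a b c, map_neg]
    · rw [hm'.swap' a b c, map_neg]
    · intro hz
      simp [hz] at hne
  refine ⟨fun a b c => ψ (m' a b c), ⟨fun a b c => ?_, fun a b c => ?_, fun a b c hne =>
    hm'.supp a b c ?_⟩, fun i' j' k' hi' hij' hjk' hk' hlt => ?_, ?_⟩
  · rw [hm'.swap a b c, map_neg]
  · rw [hm'.swap' a b c, map_neg]
  · intro hz
    simp [hz] at hne
  · rw [hpair' i' (by simp [I]; omega) j' (by simp [I]; omega) k' (by simp [I]; omega),
      h0 i' j' k' hi' hij' hjk' hk' hlt]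
    simp
  · rw [hpair' i (by simp [I]; omega) j (by simp [I]; omega) k (by simp [I]; omega), ← hs,
      inv_mul_cancel₀ h1, hρ1, map_one]
    exact one_ne_zero

/-- Relabelling the vertices does not affect the shifting. -/
theorem IsShift.relabel (s : Equiv.Perm V) {i j k : ℕ} (h : IsShift t x n i j k) :
    IsShift (fun a b c => t (s a) (s b) (s c)) (fun i a => x i (s a)) n i j k := by
  obtain ⟨m, hm, h0, h1⟩ := h
  have key : ∀ f g h : V → ℝ, pair₃ (fun a b c => m (s a) (s b) (s c)) (fun a => f (s a))
      (fun a => g (s a)) (fun a => h (s a)) = pair₃ m f g h := by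
    intro f g h
    simp only [pair₃]
    rw [Equiv.sum_comp s fun a => ∑ b, ∑ c, m a (s b) (s c) * (f a * g (s b) * h (s c))]
    refine Finset.sum_congr rfl fun a _ => ?_
    rw [Equiv.sum_comp s fun b => ∑ c, m a b (s c) * (f a * g b * h (s c))]
    refine Finset.sum_congr rfl fun b _ => ?_
    rw [Equiv.sum_comp s fun c => m a b c * (f a * g b * h c)]
  refine ⟨fun a b c => m (s a) (s b) (s c), ⟨fun a b c => hm.swap _ _ _,
    fun a b c => hm.swap' _ _ _, fun a b c => hm.supp _ _ _⟩, fun i' j' k' a1 a2 a3 a4 a5 => ?_, ?_⟩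
  · rw [key]
    exact h0 i' j' k' a1 a2 a3 a4 a5
  · rwa [key]

end Independence

/-! ### Comparing the shiftings before and after contraction. -/

section Comparison

variable {V : Type*} [Fintype V] [DecidableEq V] {K D : V → V → V → Prop} {x y : ℕ → V → ℝ}
  {T U : Finset V} {u v : V} {n : ℕ}

/-- Not all triangles of the surrounding complex belong to the plug. -/
theorem Plug.exists_not {R : V → V → V → Prop} {p q r : V} (h : Plug R D p q r x)
    (hR : ∃ a b c, R a b c) (hd : ∀ a b c, R a b c → a ≠ b) : ∃ a b c, R a b c ∧ ¬ D a b c := by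
  obtain ⟨a, b, c, hRabc⟩ := hR
  refine ⟨a, b, c, hRabc, fun hD => ?_⟩
  have mem : ∀ {a b c}, D a b c → R a b c → a ∈ ({p, q, r} : Finset V) := fun hD hR => by
    by_contra hn
    exact h.int _ _ _ hD hn _ _ hR
  have hD1 := h.rot _ _ _ hD
  have hR1 := h.rotR _ _ _ hRabc
  have hD2 := h.rot _ _ _ hD1
  have hR2 := h.rotR _ _ _ hR1
  have ha := mem hD hRabc
  have hb := mem hD1 hR1
  have hc := mem hD2 hR2
  have hab := hd _ _ _ hRabc
  have hbc := hd _ _ _ hR1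
  have hac := (hd _ _ _ hR2).symm
  obtain ⟨n1, n2, n3⟩ := h.ne
  have eq : ({a, b, c} : Finset V) = {p, q, r} := by
    refine Finset.eq_of_subset_of_card_le ?_ ?_
    · exact Finset.insert_subset ha (Finset.insert_subset hb (Finset.singleton_subset_iff.2 hc))
    rw [Finset.card_eq_three.2 ⟨a, b, c, hab, hac, hbc, rfl⟩]
    exact Finset.card_le_three
  have hp : p ∈ ({a, b, c} : Finset V) := by simp [eq]
  have hq : q ∈ ({a, b, c} : Finset V) := by simp [eq]
  have hr : r ∈ ({a, b, c} : Finset V) := by simp [eq]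
  exact h.disj (perm_of_mem h.swapR h.rotR hp hq hr n1 n2 n3 hRabc)
    (perm_of_mem h.swap h.rot hp hq hr n1 n2 n3 hD)

/-- Contracting an edge in a disk bounded by a triangle does not affect the tail of the
shifting. -/
theorem isShift_contr_iff (hK : IsSurf K) (hP : Patch K D T) (hU : ∀ a, a ∈ U ↔ ∃ b, E K a b)
    (hn : U.card = n) (hx : Gen (Finset.Icc 1 n) U x) (hy : Gen (Finset.Icc 1 (n - 1)) (U.erase v) y)
    (h2 : TrivialH1 D (ZMod 2)) (hR : TrivialH1 D ℝ) (hc : Contractible K u v) (hv : v ∉ T)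
    (hvD : ∃ a b, D v a b) {i j k : ℕ} (hi : 1 ≤ i) (hij : i < j) (hjk : j < k)
    (hj : i = 1 → 4 ≤ j) :
    (k ≤ n ∧ IsShift K x n i j k) ↔
      (k ≤ n - 1 ∧ IsShift (contr K u v) y (n - 1) i j k) := by
  obtain ⟨p, q, r, hpq, hpr, hqr, rfl⟩ := Finset.card_eq_three.1 hP.card
  have huv := hK.E_ne hc.edge
  have hvU : v ∈ U := (hU v).2 ⟨u, hK.E_symm hc.edge⟩
  have hUe : ∀ a b, E K a b → a ∈ U := fun a b h => (hU a).2 ⟨b, h⟩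
  have hUe' : ∀ a b, E K a b → b ∈ U := fun a b h => hUe _ _ (hK.E_symm h)
  have hS' := hK.contr hc
  have hU'e : ∀ a b, E (contr K u v) a b → a ∈ U.erase v := by
    rintro a b ⟨c, h⟩
    refine Finset.mem_erase.2 ⟨(contr_ne huv h).1, ?_⟩
    obtain ⟨-, -, -, a', b', c', h, rfl, -, -⟩ := h
    split_ifs
    · exact hUe _ _ hc.edge
    · exact hUe _ _ ⟨_, h⟩
  have hcard : (U.erase v).card = n - 1 := by rw [Finset.card_erase_of_mem hvU, hn]
  have hn1 : n = n - 1 + 1 := by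
    have := Finset.card_pos.2 ⟨v, hvU⟩
    omega
  have hx' : Gen (Finset.Icc 1 (n - 1)) (U.erase v) x :=
    hx.mono (Finset.Icc_subset_Icc_right (by omega)) (Finset.erase_subset _ _)
  have hcontr := hP.contr_eq hK (u := u) hv hvD
  -- the rest of the surface is not empty
  obtain ⟨a₀, b₀, c₀, hrest⟩ : ∃ a b c, rest K D a b c := by
    obtain ⟨c, hc1, hc2⟩ := (hP.bdry p q hpq).1 (by simp)
    obtain ⟨d, hd, hd', -⟩ := hK.two _ _ _ (hP.le _ _ _ hc1)
    exact ⟨p, q, d, hd', fun h => hd (hc2 d h)⟩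
  -- Two triangles on a common edge of the contracted surface give four vertices; this makes index 4
  -- of `{2, 3, 4}` available on both sides.
  have hfour : 4 ≤ n - 1 := by
    have ht : contr K u v a₀ b₀ c₀ := by
      rw [hcontr]
      exact Or.inl hrest
    obtain ⟨d, hd, htd, -⟩ := hS'.two _ _ _ ht
    have hab := hS'.ne _ _ _ ht
    have hac := hS'.E_ne (hS'.E₂ ht)
    have hbc := hS'.E_ne (hS'.E₃ ht)
    have had := hS'.E_ne (hS'.E₂ htd)
    have hbd := hS'.E_ne (hS'.E₃ htd)
    rw [← hcard]
    have : ({a₀, b₀, c₀, d} : Finset V) ⊆ U.erase v := by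
      intro w hw
      simp only [Finset.mem_insert, Finset.mem_singleton] at hw
      rcases hw with rfl | rfl | rfl | rfl
      · exact hU'e _ _ ⟨_, ht⟩
      · exact hU'e _ _ (hS'.E₃ ht)
      · exact hU'e _ _ (hS'.E_symm (hS'.E₃ ht))
      · exact hU'e _ _ (hS'.E_symm (hS'.E₃ htd))
    refine le_trans (le_of_eq ?_) (Finset.card_le_card this)
    rw [Finset.card_insert_of_notMem (by simp [hab, hac, had]),
      Finset.card_insert_of_notMem (by simp [hbc, hbd]), Finset.card_pair hd.symm]
  have hx3 : Gen {1, 2, 3} U x := hx.mono (by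
    intro a ha
    simp only [Finset.mem_insert, Finset.mem_singleton] at ha
    simp only [Finset.mem_Icc]
    omega) subset_rfl
  have pl := hP.plug hK ⟨hpq, hpr, hqr⟩ hUe' hx3 h2 hR
  have pl' := hP.plug_contr hK ⟨hpq, hpr, hqr⟩ hUe' hx3 h2 hR hc hv hvD
  have hKeq : K = fun a b c => rest K D a b c ∨ D a b c := by
    funext a b c
    apply propext
    by_cases hD : D a b c
    · exact ⟨fun _ => Or.inr hD, fun _ => hP.le _ _ _ hD⟩
    · exact ⟨fun h => Or.inl ⟨h, hD⟩, fun h => h.elim And.left fun h => absurd h hD⟩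
  -- replace the rows for the contracted complex by those for `K`
  have swap_rows : k ≤ n - 1 → (IsShift (contr K u v) y (n - 1) i j k ↔
      IsShift (contr K u v) x (n - 1) i j k) := by
    intro hk
    have ht : ∀ a b c, contr K u v a b c → a ∈ U.erase v ∧ b ∈ U.erase v ∧ c ∈ U.erase v :=
      fun a b c h => ⟨hU'e _ _ ⟨_, h⟩, hU'e _ _ (hS'.E₃ h), hU'e _ _ (hS'.E_symm (hS'.E₃ h))⟩
    exact ⟨IsShift.of_gen ht hy hx' hi hij hjk hk, IsShift.of_gen ht hx' hy hi hij hjk hk⟩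
  rw [and_congr_right swap_rows]
  rcases eq_or_lt_of_le hi with rfl | hi2
  · have hst : boundaryStress K x = boundaryStress (contr K u v) x := by
      rw [hcontr, pl'.boundaryStress_eq, ← pl.boundaryStress_eq, ← hKeq]
    rw [and_congr_right fun hk => isShift_one_iff hx hn hUe (hj rfl) hjk hk,
      and_congr_right fun hk => isShift_one_iff hx' hcard hU'e (hj rfl) hjk hk]
    exact boundaryStress_pair_iff hst hn1 hx' hcard hU'e (hj rfl) hjk
  · rw [and_congr_right fun hk => hK.isShift_iff_of_two_le hUe hx hn hi2 hij hjk hk,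
      and_congr_right fun hk => hS'.isShift_iff_of_two_le hU'e hx' hcard hi2 hij hjk hk]
    have hpos : ∀ a ∈ U, x 1 a ≠ 0 := fun a ha => hx3.ne_zero (by simp) ha
    have hrd : ∀ a b c, rest K D a b c → a ≠ b := fun a b c h => hK.ne _ _ _ h.1
    have hcyc : HasCycle K (x 1) ↔ HasCycle (contr K u v) (x 1) := by
      have e1 := pl.hasCycle_iff (hKeq ▸ hK)
        (fun a b c h => hpos _ (hUe a b ⟨c, by rw [hKeq]; exact h⟩))
        (pl.exists_not ⟨_, _, _, hrest⟩ hrd)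
      have e2 := pl'.hasCycle_iff (hcontr ▸ hS')
        (fun a b c h => hpos _ (Finset.mem_of_mem_erase (hU'e a b ⟨c, by rw [hcontr]; exact h⟩)))
        (pl'.exists_not ⟨_, _, _, hrest⟩ hrd)
      rw [hcontr, e2, ← e1, ← hKeq]
    rw [hcyc]
    constructor
    · rintro ⟨-, ⟨h1, h2, h3⟩, h⟩
      exact ⟨by omega, ⟨h1, h2, h3⟩, h⟩
    · rintro ⟨hk, h⟩
      exact ⟨by omega, h⟩

end Comparison

/-! ### From simplicial complexes to relations on ordered triangles. -/

section Surfaces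

variable {V : Type*} [DecidableEq V] {K D : PreAbstractSimplicialComplex V} {u v : V}

theorem pair_eq_pair_iff {a b c d : V} (hab : a ≠ b) :
    ({a, b} : Finset V) = {c, d} ↔ (a = c ∧ b = d) ∨ (a = d ∧ b = c) := by
  constructor
  · intro h
    have ha : a ∈ ({c, d} : Finset V) := by simp [← h]
    have hb : b ∈ ({c, d} : Finset V) := by simp [← h]
    simp only [Finset.mem_insert, Finset.mem_singleton] at ha hb
    rcases ha with rfl | rfl <;> rcases hb with rfl | rfl <;> simp_all
  · rintro (⟨rfl, rfl⟩ | ⟨rfl, rfl⟩)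
    · rfl
    · exact Finset.pair_comm _ _

theorem pair_ne_singleton {a b c : V} (hab : a ≠ b) : ({a, b} : Finset V) ≠ {c} := by
  intro h
  have := congrArg Finset.card h
  rw [Finset.card_pair hab, Finset.card_singleton] at this
  omega

/-- Translates the cyclic link into neighbours and ordered triangles. The size bound on faces is
what later identifies a tetrahedron boundary. -/
theorem IsTriangulatedSurface.exists_link (hK : IsTriangulatedSurface K) (hv : v ∈ vertexSet K) :
    ∃ m : ℕ, 3 ≤ m ∧ ∃ c : ZMod m → V, Function.Injective c ∧
      (∀ a, (v ≠ a ∧ ({v, a} : Finset V) ∈ K) ↔ ∃ i, a = c i) ∧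
      (∀ a b, tri K v a b ↔ ∃ i, (a = c i ∧ b = c (i + 1)) ∨ (a = c (i + 1) ∧ b = c i)) ∧
      (∀ s ∈ K, v ∈ s → s.card ≤ 3) := by
  obtain ⟨m, hm, c, hc, hs⟩ := hK.link_isCycle v hv
  have : Fact (1 < m) := ⟨by omega⟩
  have hcc : ∀ i, c i ≠ c (i + 1) := fun i h => by
    have := hc h
    exact one_ne_zero (left_eq_add.1 this)
  have hlink : ∀ s : Finset V, s ∈ link K v ↔ s.Nonempty ∧ v ∉ s ∧ insert v s ∈ K :=
    fun _ => Iff.rfl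
  refine ⟨m, hm, c, hc, fun a => ?_, fun a b => ?_, fun s hsK hvs => ?_⟩
  · have h1 := hs {a}
    rw [hlink] at h1
    have h2 : (∃ i, ({a} : Finset V) = {c i} ∨ ({a} : Finset V) = {c i, c (i + 1)}) ↔
        ∃ i, a = c i := by
      refine exists_congr fun i => ⟨?_, fun h => Or.inl (by rw [h])⟩
      rintro (h | h)
      · exact Finset.singleton_injective h
      · exact absurd h.symm (pair_ne_singleton (hcc i))
    rw [h2] at h1
    rw [← h1]
    simp
  · by_cases hab : a = b
    · subst hab
      refine ⟨fun h => absurd rfl h.2.2.1, ?_⟩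
      rintro ⟨i, ⟨h1, h2⟩ | ⟨h1, h2⟩⟩
      · exact absurd (h1.symm.trans h2) (hcc i)
      · exact absurd (h2.symm.trans h1) (hcc i)
    · have h1 := hs {a, b}
      rw [hlink] at h1
      have h2 : (∃ i, ({a, b} : Finset V) = {c i} ∨ ({a, b} : Finset V) = {c i, c (i + 1)}) ↔
          ∃ i, (a = c i ∧ b = c (i + 1)) ∨ (a = c (i + 1) ∧ b = c i) := by
        refine exists_congr fun i => ?_
        rw [pair_eq_pair_iff hab]
        exact ⟨fun h => h.resolve_left (pair_ne_singleton hab), Or.inr⟩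
      rw [← h2, ← h1]
      simp only [tri, Finset.mem_insert, Finset.mem_singleton, not_or]
      constructor
      · rintro ⟨n1, n2, -, h⟩
        exact ⟨by simp, ⟨n1, n2⟩, h⟩
      · rintro ⟨-, ⟨n1, n2⟩, h⟩
        exact ⟨n1, n2, hab, h⟩
  · by_cases h1 : (s.erase v).Nonempty
    · have h2 : s.erase v ∈ link K v :=
        ⟨h1, Finset.notMem_erase v s, by rwa [Finset.insert_erase hvs]⟩
      obtain ⟨i, h3 | h3⟩ := (hs _).1 h2
      · have := congrArg Finset.card h3
        rw [Finset.card_erase_of_mem hvs, Finset.card_singleton] at this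
        omega
      · have := congrArg Finset.card h3
        rw [Finset.card_erase_of_mem hvs, Finset.card_pair (hcc i)] at this
        omega
    · have h2 := Finset.not_nonempty_iff_eq_empty.1 h1
      have := congrArg Finset.card h2
      rw [Finset.card_erase_of_mem hvs, Finset.card_empty] at this
      omega

omit [DecidableEq V] in
theorem vertex_of_face {s : Finset V} (hs : s ∈ K) (hv : v ∈ s) : v ∈ vertexSet K :=
  face_mono hs (Finset.singleton_subset_iff.2 hv) (Finset.singleton_nonempty v)

theorem IsTriangulatedSurface.E_iff (hK : IsTriangulatedSurface K) {a b : V} :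
    E (tri K) a b ↔ a ≠ b ∧ ({a, b} : Finset V) ∈ K := by
  constructor
  · rintro ⟨c, h⟩
    exact ⟨h.1, face_mono h.2.2.2 (by intro x; simp; tauto) (by simp)⟩
  · intro h
    obtain ⟨m, hm, c, hc, h1, h2, -⟩ := hK.exists_link (vertex_of_face h.2 (by simp : a ∈ {a, b}))
    obtain ⟨i, rfl⟩ := (h1 b).1 h
    exact ⟨c (i + 1), (h2 _ _).2 ⟨i, Or.inl ⟨rfl, rfl⟩⟩⟩

theorem IsTriangulatedSurface.mem_vertexSet (hK : IsTriangulatedSurface K) {a : V} :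
    a ∈ vertexSet K ↔ ∃ b, E (tri K) a b := by
  constructor
  · intro h
    obtain ⟨m, hm, c, hc, h1, h2, -⟩ := hK.exists_link h
    exact ⟨c 0, c (0 + 1), (h2 _ _).2 ⟨0, Or.inl ⟨rfl, rfl⟩⟩⟩
  · rintro ⟨b, hb⟩
    exact vertex_of_face (hK.E_iff.1 hb).2 (by simp)

/-- The triangles of a triangulated surface. -/
theorem IsTriangulatedSurface.isSurf (hK : IsTriangulatedSurface K) : IsSurf (tri K) where
  swap _ _ _ := tri_swap
  rot _ _ _ := tri_rot
  ne _ _ _ h := h.1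
  two a b c h := by
    obtain ⟨m, hm, f, hf, h1, h2, -⟩ := hK.exists_link (hK.mem_vertexSet.2 ⟨b, c, h⟩)
    -- Two is nonzero modulo `m` since `3 ≤ m`: the two neighbours of a link vertex are distinct.
    have two_ne : ∀ i : ZMod m, i ≠ i + 1 + 1 := by
      intro i hi
      have h3 : ((2 : ℕ) : ZMod m) = 0 := by
        push_cast
        linear_combination -hi
      rw [ZMod.natCast_eq_zero_iff] at h3
      have := Nat.le_of_dvd (by norm_num) h3
      omega
    obtain ⟨i, ⟨rfl, rfl⟩ | ⟨rfl, rfl⟩⟩ := (h2 b c).1 h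
    · refine ⟨f (i - 1), fun h3 => ?_, (h2 _ _).2 ⟨i - 1, Or.inr ⟨by simp, rfl⟩⟩, fun e he => ?_⟩
      · refine two_ne (i - 1) ?_
        simpa using hf h3
      · obtain ⟨j, ⟨e1, rfl⟩ | ⟨e1, rfl⟩⟩ := (h2 _ _).1 he
        · exact Or.inl (by rw [hf e1])
        · exact Or.inr (by rw [hf e1]; simp)
    · refine ⟨f (i + 1 + 1), fun h3 => two_ne i (hf h3).symm,
        (h2 _ _).2 ⟨i + 1, Or.inl ⟨rfl, rfl⟩⟩, fun e he => ?_⟩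
      obtain ⟨j, ⟨e1, rfl⟩ | ⟨e1, rfl⟩⟩ := (h2 _ _).1 he
      · exact Or.inr (by rw [← hf e1])
      · exact Or.inl (by rw [add_right_cancel (hf e1)])
  link v f hf a b ha hb hfa := by
    obtain ⟨m, hm, c, hc, h1, h2, -⟩ := hK.exists_link (hK.mem_vertexSet.2 ⟨a, ha⟩)
    obtain ⟨i, rfl⟩ := (h1 a).1 (hK.E_iff.1 ha)
    obtain ⟨j, rfl⟩ := (h1 b).1 (hK.E_iff.1 hb)
    have key : ∀ k : ℕ, f (c (i + k)) := by
      intro k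
      induction k with
      | zero => simpa using hfa
      | succ k ih =>
        refine hf _ _ ((h2 _ _).2 ⟨i + k, Or.inl ⟨rfl, ?_⟩⟩) ih
        push_cast
        rw [add_assoc]
    have : NeZero m := ⟨by omega⟩
    have := key (j - i).val
    rwa [ZMod.natCast_zmod_val, add_sub_cancel] at this
  conn f hf a b ha hb hfa := by
    have key : ∀ x y : vertexSet K, (skeletonGraph K).Walk x y → f x → f y := by
      intro x y w
      induction w with
      | nil => exact id
      | @cons x y z hxy _ ih =>
        intro hx
        obtain ⟨d, hd⟩ := hK.E_iff.2 ⟨fun h => hxy.1 (Subtype.ext h), hxy.2⟩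
        exact ih (hf _ _ _ hd hx)
    obtain ⟨w⟩ := hK.connected.preconnected ⟨a, hK.mem_vertexSet.2 ha⟩ ⟨b, hK.mem_vertexSet.2 hb⟩
    exact key _ _ w hfa

/-- If four vertices span all four triangles, they are all the vertices of the connected surface. As
faces have at most three vertices, the complex is the tetrahedron boundary, which is excluded. -/
theorem IsContractible.contractible (hK : IsTriangulatedSurface K) (hc : IsContractible K u v) :
    Contractible (tri K) u v where
  edge := hK.E_iff.2 ⟨hc.1, hc.2.1⟩
  miss w h1 h2 := by
    rw [hK.E_iff] at h1 h2
    refine ⟨hc.1, h1.1, h2.1, by_contra fun h => hc.2.2.1 w ?_⟩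
    exact ⟨hc.1, h1.1, h2.1, hc.2.1, h1.2, h2.2, h⟩
  tetra a b hab h1 h2 h3 h4 := by
    refine hc.2.2.2 ⟨{u, v, a, b}, ?_, fun s => ⟨fun hs => ?_, ?_⟩⟩
    · rw [Finset.card_insert_of_notMem (by simp [hc.1, h1.2.1, h2.2.1]),
        Finset.card_insert_of_notMem (by simp [h1.2.2.1, h2.2.2.1]), Finset.card_pair hab]
    · have hne : s.Nonempty := (K.isRelLowerSet_faces hs).1
      have hsub : s ⊆ {u, v, a, b} := by
        intro w hw
        obtain ⟨z, hz⟩ := hK.mem_vertexSet.1 (vertex_of_face hs hw)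
        simpa using hK.isSurf.tetra_vertices hab h1 h2 h3 h4 hz
      refine ⟨hne, hsub.ssubset_of_ne fun h => ?_⟩
      obtain ⟨w, hw⟩ := hne
      obtain ⟨-, -, -, -, -, -, hcard⟩ := hK.exists_link (vertex_of_face hs hw)
      have := hcard s hs hw
      rw [h, Finset.card_insert_of_notMem (by simp [hc.1, h1.2.1, h2.2.1]),
        Finset.card_insert_of_notMem (by simp [h1.2.2.1, h2.2.2.1]), Finset.card_pair hab] at this
      omega
    · rintro ⟨hne, hss⟩
      obtain ⟨w, hw, hws⟩ := Finset.exists_of_ssubset hss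
      have hsub : ∀ z ∈ s, z ≠ w ∧ (z = u ∨ z = v ∨ z = a ∨ z = b) := fun z hz =>
        ⟨fun h => hws (h ▸ hz), by simpa using hss.1 hz⟩
      simp only [Finset.mem_insert, Finset.mem_singleton] at hw
      rcases hw with rfl | rfl | rfl | rfl
      · refine face_mono h4.2.2.2 (fun z hz => ?_) hne
        have := hsub z hz
        simp
        tauto
      · refine face_mono h3.2.2.2 (fun z hz => ?_) hne
        have := hsub z hz
        simp
        tauto
      · refine face_mono h2.2.2.2 (fun z hz => ?_) hne
        have := hsub z hz
        simp
        tauto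
      · refine face_mono h1.2.2.2 (fun z hz => ?_) hne
        have := hsub z hz
        simp
        tauto

theorem tri_mono (h : D ≤ K) {a b c : V} (ht : tri D a b c) : tri K a b c :=
  ⟨ht.1, ht.2.1, ht.2.2.1, h ht.2.2.2⟩

theorem isBoundaryEdge_iff {a b : V} (hab : a ≠ b) :
    IsBoundaryEdge D {a, b} ↔ ∃! c, tri D a b c := by
  have key : ∀ t : Finset V, t.card = 3 → {a, b} ⊆ t → ∃ c, a ≠ c ∧ b ≠ c ∧ t = {a, b, c} := by
    intro t ht hs
    have hc : (t \ {a, b}).card = 1 := by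
      rw [Finset.card_sdiff_of_subset hs, ht, Finset.card_pair hab]
    obtain ⟨c, hc⟩ := Finset.card_eq_one.mp hc
    have hcm : c ∈ t \ {a, b} := by rw [hc]; simp
    simp only [Finset.mem_sdiff, Finset.mem_insert, Finset.mem_singleton, not_or] at hcm
    refine ⟨c, Ne.symm hcm.2.1, Ne.symm hcm.2.2, ?_⟩
    rw [← Finset.union_sdiff_of_subset hs, hc]
    ext
    simp
  have key' : ∀ c d, a ≠ c → b ≠ c → ({a, b, c} : Finset V) = {a, b, d} → c = d := by
    intro c d h1 h2 h
    have : c ∈ ({a, b, d} : Finset V) := by simp [← h]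
    simpa [h1.symm, h2.symm] using this
  have hcard : ∀ c, tri D a b c → ({a, b, c} : Finset V).card = 3 := fun c h =>
    Finset.card_eq_three.2 ⟨a, b, c, h.1, h.2.1, h.2.2.1, rfl⟩
  have hsub : ∀ c, ({a, b} : Finset V) ⊆ {a, b, c} := fun c x => by
    simp only [Finset.mem_insert, Finset.mem_singleton]
    tauto
  constructor
  · rintro ⟨-, -, t, ⟨ht, ht3, hs⟩, huniq⟩
    obtain ⟨c, h1, h2, rfl⟩ := key t ht3 hs
    refine ⟨c, ⟨hab, h1, h2, ht⟩, fun d hd => ?_⟩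
    exact key' d c hd.2.1 hd.2.2.1 (huniq _ ⟨hd.2.2.2, hcard d hd, hsub d⟩)
  · rintro ⟨c, hc, huniq⟩
    refine ⟨face_mono hc.2.2.2 (hsub c) (by simp), Finset.card_pair hab, {a, b, c},
      ⟨hc.2.2.2, hcard c hc, hsub c⟩, ?_⟩
    rintro t ⟨ht, ht3, hs⟩
    obtain ⟨d, h1, h2, rfl⟩ := key t ht3 hs
    rw [huniq d ⟨hab, h1, h2, ht⟩]

/-- The disk of the theorem is a patch. -/
theorem IsTriangulatedSurface.patch (hK : IsTriangulatedSurface K) (hDK : D ≤ K)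
    (hpure : IsPureTwoDim D) {T : Finset V} (hT : T.card = 3)
    (hbdry : ∀ e : Finset V, IsBoundaryEdge D e ↔ e ⊆ T ∧ e.card = 2)
    (hv : IsInternalVertex D v) :
    Patch (tri K) (tri D) T ∧ v ∉ T ∧ ∃ a b, tri D v a b := by
  have hvT : v ∉ T := by
    intro hvT
    obtain ⟨w, hw, hwv⟩ := Finset.exists_mem_ne (show 1 < T.card by omega) v
    refine hv.2 {v, w} ((hbdry _).2 ⟨?_, Finset.card_pair hwv.symm⟩) (by simp)
    simp [Finset.insert_subset_iff, hvT, hw]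
  have hex : ∃ a b, tri D v a b := by
    obtain ⟨t, ht, hs, h3, -⟩ := hpure _ hv.1
    obtain ⟨w, hw, hwv⟩ := Finset.exists_mem_ne (show 1 < t.card by omega) v
    have hvt : v ∈ t := hs (by simp)
    obtain ⟨c, hc⟩ := hpure.exists_tri_of_edge hwv.symm
      (face_mono ht (by simp [Finset.insert_subset_iff, hvt, hw]) (by simp))
    exact ⟨w, c, hc⟩
  refine ⟨Patch.mk' hK.isSurf (fun _ _ _ => tri_swap) (fun _ _ _ => tri_rot)
    (fun _ _ _ => tri_mono hDK) hT (fun a b hab => ?_) hex hvT, hvT, hex⟩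
  rw [← isBoundaryEdge_iff hab, hbdry, Finset.card_pair hab]
  simp [Finset.insert_subset_iff]

theorem tri_contract : tri (contract K u v) = contr (tri K) u v := by
  have hmem : ∀ s, s ∈ contract K u v ↔ ∃ s' ∈ K, s'.image (fun w => if w = v then u else w) = s :=
    fun _ => Iff.rfl
  funext x y z
  apply propext
  constructor
  · rintro ⟨n1, n2, n3, h⟩
    obtain ⟨s, hs, he⟩ := (hmem _).1 h
    have pre : ∀ w ∈ ({x, y, z} : Finset V), ∃ a ∈ s, (if a = v then u else a) = w := by
      intro w hw
      rw [← he] at hw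
      exact Finset.mem_image.1 hw
    obtain ⟨a, ha, rfl⟩ := pre x (by simp)
    obtain ⟨b, hb, rfl⟩ := pre y (by simp)
    obtain ⟨c, hc, rfl⟩ := pre z (by simp)
    refine ⟨n1, n2, n3, a, b, c, ⟨?_, ?_, ?_, ?_⟩, rfl, rfl, rfl⟩
    · rintro rfl; exact n1 rfl
    · rintro rfl; exact n2 rfl
    · rintro rfl; exact n3 rfl
    · exact face_mono hs (by simp [Finset.insert_subset_iff, ha, hb, hc]) (by simp)
  · rintro ⟨n1, n2, n3, a, b, c, h, rfl, rfl, rfl⟩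
    refine ⟨n1, n2, n3, (hmem _).2 ⟨{a, b, c}, h.2.2.2, ?_⟩⟩
    simp [Finset.image_insert]

theorem mem_vertexSet_contract (hu : u ∈ vertexSet K) (huv : u ≠ v) {a : V} :
    a ∈ vertexSet (contract K u v) ↔ a ∈ vertexSet K ∧ a ≠ v := by
  constructor
  · rintro ⟨s, hs, he⟩
    have : a ∈ s.image fun w => if w = v then u else w := by
      change s.image _ = _ at he
      rw [he]
      simp
    obtain ⟨b, hb, rfl⟩ := Finset.mem_image.1 this
    have := vertex_of_face hs hb
    split_ifs with h
    · exact ⟨hu, huv⟩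
    · exact ⟨this, h⟩
  · rintro ⟨ha, hav⟩
    exact ⟨{a}, ha, by simp [hav]⟩

/-- Which endpoint survives is only a matter of naming: the two contractions differ by the
transposition of `u` and `v`. -/
theorem contr_symm (t : V → V → V → Prop) (u v : V) :
    contr t v u = fun a b c =>
      contr t u v (Equiv.swap u v a) (Equiv.swap u v b) (Equiv.swap u v c) := by
  have key : ∀ a, Equiv.swap u v (if a = u then v else a) = if a = v then u else a := by
    intro a
    by_cases h1 : a = u
    · subst h1
      by_cases h2 : a = v <;> simp [h2]
    · by_cases h2 : a = v
      · simp [h2]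
      · simp [h1, h2, Equiv.swap_apply_of_ne_of_ne h1 h2]
  funext x y z
  apply propext
  simp only [contr, ne_eq, EmbeddingLike.apply_eq_iff_eq, ← key]

end Surfaces

/-! ### Lexicographic order on three-element sets. -/

section Triples

theorem lexLT_triple {ι : Type*} [LinearOrder ι] [DecidableEq ι] {i j k i' j' k' : ι} (hij : i < j) (hjk : j < k)
    (hij' : i' < j') (hjk' : j' < k') :
    LexLT ({i', j', k'} : Finset ι) {i, j, k} ↔ i' < i ∨ i' = i ∧ (j' < j ∨ j' = j ∧ k' < k) := by
  simp only [LexLT, Finset.mem_insert, Finset.mem_singleton]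
  constructor
  · rintro ⟨a, ha, hna, h⟩
    have h1 := h i
    have h2 := h j
    have h3 := h k
    have h4 := h i'
    have h5 := h j'
    rcases lt_trichotomy i' i with h6 | h6 | h6
    · exact Or.inl h6
    · refine Or.inr ⟨h6, ?_⟩
      rcases lt_trichotomy j' j with h7 | h7 | h7
      · exact Or.inl h7
      · refine Or.inr ⟨h7, ?_⟩
        rcases lt_trichotomy k' k with h8 | h8 | h8
        · exact h8
        · grind
        · grind
      · grind
    · grind
  · rintro (h | ⟨rfl, h | ⟨rfl, h⟩⟩)
    · exact ⟨i', by grind⟩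
    · exact ⟨j', by grind⟩
    · exact ⟨k', by grind⟩

theorem exists_triple {ι : Type*} [LinearOrder ι] [DecidableEq ι] {s : Finset ι} (hs : s.card = 3) :
    ∃ i j k, i < j ∧ j < k ∧ s = {i, j, k} := by
  refine ⟨s.orderEmbOfFin hs 0, s.orderEmbOfFin hs 1, s.orderEmbOfFin hs 2,
    (s.orderEmbOfFin hs).strictMono (by decide), (s.orderEmbOfFin hs).strictMono (by decide), ?_⟩
  ext a
  have h : (∃ l, s.orderEmbOfFin hs l = a) ↔ a ∈ s :=
    Set.ext_iff.1 (s.range_orderEmbOfFin hs) a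
  rw [← h, Fin.exists_fin_succ, Fin.exists_fin_two, Finset.mem_insert, Finset.mem_insert,
    Finset.mem_singleton]
  simp only [eq_comm]
  rfl

theorem card_triple {ι : Type*} [LinearOrder ι] [DecidableEq ι] {i j k : ι} (hij : i < j) (hjk : j < k) :
    ({i, j, k} : Finset ι).card = 3 :=
  Finset.card_eq_three.2 ⟨i, j, k, hij.ne, (hij.trans hjk).ne, hjk.ne, rfl⟩

end Triples

/-! ### Degree three of the exterior face ring. -/

section FaceRing

variable {V : Type*} [Fintype V] [DecidableEq V] {K : PreAbstractSimplicialComplex V}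

/-- The product of three vectors in the exterior algebra. -/
noncomputable def wedge₃ (f g h : vertexSet K → ℝ) : ExtAlg K :=
  ExteriorAlgebra.ιMulti ℝ 3 ![f, g, h]

omit [Fintype V] [DecidableEq V] in
theorem wedge₃_eq (f g h : vertexSet K → ℝ) : wedge₃ f g h =
    ExteriorAlgebra.ι ℝ f * (ExteriorAlgebra.ι ℝ g * ExteriorAlgebra.ι ℝ h) := by
  simp [wedge₃, ExteriorAlgebra.ιMulti_apply]

omit [Fintype V] [DecidableEq V] in
theorem rowWedge_triple (X : Matrix (Index K) (vertexSet K) ℝ) {i j k : Index K} (hij : i < j)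
    (hjk : j < k) : rowWedge X {i, j, k} = wedge₃ (X i) (X j) (X k) := by
  have key : ∀ (s : Finset (Index K)) (n : ℕ) (h : s.card = n),
      rowWedge X s = ExteriorAlgebra.ιMulti ℝ n fun l => X (s.orderEmbOfFin h l) := by
    rintro s n rfl
    rfl
  refine (key _ 3 (card_triple hij hjk)).trans ?_
  have : (![i, j, k] : Fin 3 → Index K) =
      Finset.orderEmbOfFin _ (card_triple hij hjk) := by
    refine Finset.orderEmbOfFin_unique _ (fun l => ?_) ?_
    · fin_cases l <;> simp
    · intro a b hab
      fin_cases a <;> fin_cases b <;> simp at hab ⊢ <;> first | exact hij | exact hjk |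
        exact hij.trans hjk
  rw [wedge₃]
  congr 1
  funext l
  rw [← this]
  fin_cases l <;> rfl

/-- The quotient map as a linear map. -/
noncomputable def quotientLin (K : PreAbstractSimplicialComplex V) :
    ExtAlg K →ₗ[ℝ] ExteriorFaceRing K :=
  ((faceIdeal K).ringCon.mkₐ ℝ).toLinearMap

omit [Fintype V] in
theorem quotientLin_eq_zero_iff {z : ExtAlg K} : quotientLin K z = 0 ↔ z ∈ faceIdeal K := by
  rw [TwoSidedIdeal.mem_iff]
  exact Quotient.eq''

/-- Restriction to three coordinates. -/
noncomputable def coords (a b c : vertexSet K) :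
    ExtAlg K →ₐ[ℝ] ExteriorAlgebra ℝ (Fin 3 → ℝ) :=
  ExteriorAlgebra.map (LinearMap.funLeft ℝ ℝ ![a, b, c])

omit [Fintype V] in
-- A monomial outside the complex involves a vertex outside the face `abc`, and its basis vector
-- restricts to zero.
theorem coords_eq_zero {a b c : vertexSet K} (h : ({a.1, b.1, c.1} : Finset V) ∈ K) {z : ExtAlg K}
    (hz : z ∈ faceIdeal K) : coords a b c z = 0 := by
  have hle : faceIdeal K ≤ TwoSidedIdeal.ker (coords a b c) := by
    refine TwoSidedIdeal.span_le.2 ?_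
    rintro _ ⟨k, v, hk, hv, rfl⟩
    rw [SetLike.mem_coe, TwoSidedIdeal.mem_ker, coords, ExteriorAlgebra.map_apply_ιMulti]
    obtain ⟨j, hj⟩ : ∃ j, (v j).1 ∉ ({a.1, b.1, c.1} : Finset V) := by
      by_contra hcon
      push Not at hcon
      refine hv (face_mono h (fun w hw => ?_) ?_)
      · simp only [Finset.mem_map, Finset.mem_univ, true_and] at hw
        obtain ⟨_, ⟨l, rfl⟩, rfl⟩ := hw
        exact hcon l
      · exact ⟨v ⟨0, hk⟩, by simp⟩
    refine AlternatingMap.map_coord_zero _ j ?_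
    simp only [Finset.mem_insert, Finset.mem_singleton, not_or] at hj
    funext l
    simp only [Function.comp_apply, LinearMap.funLeft_apply, Pi.zero_apply]
    rw [Pi.single_eq_of_ne]
    fin_cases l
    · exact fun h => hj.1 (congrArg Subtype.val h.symm)
    · exact fun h => hj.2.1 (congrArg Subtype.val h.symm)
    · exact fun h => hj.2.2 (congrArg Subtype.val h.symm)
  exact (TwoSidedIdeal.mem_ker _).1 (hle hz)

/-- The determinant as a functional on the exterior algebra of a three-dimensional space. -/
noncomputable def detLin : ExteriorAlgebra ℝ (Fin 3 → ℝ) →ₗ[ℝ] ℝ :=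
  ExteriorAlgebra.liftAlternating fun i =>
    if h : i = 3 then h ▸ (Matrix.detRowAlternating : (Fin 3 → ℝ) [⋀^Fin 3]→ₗ[ℝ] ℝ) else 0

omit [Fintype V] [DecidableEq V] in
theorem detLin_coords (a b c : vertexSet K) (f g h : vertexSet K → ℝ) :
    detLin (coords a b c (wedge₃ f g h)) =
      f a * g b * h c - f a * g c * h b - f b * g a * h c + f b * g c * h a + f c * g a * h b
        - f c * g b * h a := by
  rw [coords, wedge₃, ExteriorAlgebra.map_apply_ιMulti, detLin,
    ExteriorAlgebra.liftAlternating_apply_ιMulti]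
  simp only [↓reduceDIte]
  change Matrix.det (Matrix.of fun l l' => ![f, g, h] l (![a, b, c] l')) = _
  rw [Matrix.det_fin_three]
  simp

end FaceRing

/-! ### Functionals on the face ring as alternating functions on triangles. -/

section Functionals

variable {V : Type*} [Fintype V] [DecidableEq V] {K : PreAbstractSimplicialComplex V}

/-- Extension by zero of a function on the vertices. -/
noncomputable def extendVec (f : vertexSet K → ℝ) : V → ℝ := Function.extend Subtype.val f 0

omit [Fintype V] [DecidableEq V] in
theorem extendVec_apply (f : vertexSet K → ℝ) (w : vertexSet K) : extendVec f w = f w :=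
  Subtype.val_injective.extend_apply f 0 w

omit [Fintype V] [DecidableEq V] in
theorem extendVec_of_not_mem (f : vertexSet K → ℝ) {a : V} (ha : a ∉ vertexSet K) :
    extendVec f a = 0 :=
  Function.extend_apply' _ _ _ fun ⟨w, hw⟩ => ha (hw ▸ w.2)

omit [DecidableEq V] in
theorem pair₃_perm₁ {t : V → V → V → Prop} {m : V → V → V → ℝ} (hm : IsAlt t m) (f g h : V → ℝ) :
    pair₃ m g f h = -pair₃ m f g h := by
  simp only [pair₃, ← Finset.sum_neg_distrib]
  rw [Finset.sum_comm]
  refine Finset.sum_congr rfl fun a _ => Finset.sum_congr rfl fun b _ =>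
    Finset.sum_congr rfl fun c _ => ?_
  rw [hm.swap a b c]
  ring

omit [DecidableEq V] in
theorem pair₃_perm₂ {t : V → V → V → Prop} {m : V → V → V → ℝ} (hm : IsAlt t m) (f g h : V → ℝ) :
    pair₃ m f h g = -pair₃ m f g h := by
  simp only [pair₃, ← Finset.sum_neg_distrib]
  refine Finset.sum_congr rfl fun a _ => ?_
  rw [Finset.sum_comm]
  refine Finset.sum_congr rfl fun b _ => Finset.sum_congr rfl fun c _ => ?_
  rw [hm.swap' a b c]
  ring

/-- The functional on the exterior algebra defined by an alternating function. -/
noncomputable def chainLin (m : V → V → V → ℝ) : ExtAlg K →ₗ[ℝ] ℝ := by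
  classical
  exact ∑ a : vertexSet K, ∑ b : vertexSet K, ∑ c : vertexSet K,
    m a b c • (detLin ∘ₗ (coords a b c).toLinearMap)

/-- Only triples spanning faces carry weight, and restriction to the coordinates of a face kills the
face ideal. So the functional descends to the face ring. -/
theorem chainLin_eq_zero {m : V → V → V → ℝ} (hm : IsAlt (tri K) m) {z : ExtAlg K}
    (hz : quotientLin K z = 0) : chainLin m z = 0 := by
  classical
  rw [quotientLin_eq_zero_iff] at hz
  simp only [chainLin, LinearMap.sum_apply, LinearMap.smul_apply, LinearMap.comp_apply,
    AlgHom.toLinearMap_apply]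
  refine Finset.sum_eq_zero fun a _ => Finset.sum_eq_zero fun b _ => Finset.sum_eq_zero fun c _ => ?_
  by_cases h0 : m a b c = 0
  · rw [h0, zero_smul]
  · rw [coords_eq_zero (hm.supp _ _ _ h0).2.2.2 hz, map_zero, smul_zero]

/-- The determinant expands into six permuted pairings, each equal to the same one up to its sign.
-/
theorem chainLin_wedge₃ {m : V → V → V → ℝ} (hm : IsAlt (tri K) m) (f g h : vertexSet K → ℝ) :
    chainLin m (wedge₃ f g h) = 6 * pair₃ m (extendVec f) (extendVec g) (extendVec h) := by
  classical
  have h6 : 6 * pair₃ m (extendVec f) (extendVec g) (extendVec h) =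
      pair₃ m (extendVec f) (extendVec g) (extendVec h)
        - pair₃ m (extendVec f) (extendVec h) (extendVec g)
        - pair₃ m (extendVec g) (extendVec f) (extendVec h)
        + pair₃ m (extendVec h) (extendVec f) (extendVec g)
        + pair₃ m (extendVec g) (extendVec h) (extendVec f)
        - pair₃ m (extendVec h) (extendVec g) (extendVec f) := by
    rw [pair₃_perm₁ hm (extendVec g) (extendVec h), pair₃_perm₂ hm (extendVec g) (extendVec f),
      pair₃_perm₁ hm (extendVec f) (extendVec h), pair₃_perm₂ hm (extendVec f) (extendVec g),
      pair₃_perm₁ hm (extendVec f) (extendVec g)]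
    ring
  have red : ∀ F : V → ℝ, (∀ a ∉ vertexSet K, F a = 0) → ∑ a, F a = ∑ a : vertexSet K, F a := by
    intro F hF
    rw [← Finset.sum_subtype (Finset.univ.filter (· ∈ vertexSet K)) (by simp) F]
    exact (Finset.sum_subset (Finset.subset_univ _) fun a _ ha => hF a (by simpa using ha)).symm
  have red₃ : ∀ f g h : vertexSet K → ℝ, pair₃ m (extendVec f) (extendVec g) (extendVec h) =
      ∑ a : vertexSet K, ∑ b : vertexSet K, ∑ c : vertexSet K, m a b c * (f a * g b * h c) := by
    intro f g h
    rw [pair₃, red _ fun a ha => by simp [extendVec_of_not_mem _ ha]]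
    refine Finset.sum_congr rfl fun a _ => ?_
    rw [red _ fun a ha => by simp [extendVec_of_not_mem _ ha]]
    refine Finset.sum_congr rfl fun b _ => ?_
    rw [red _ fun a ha => by simp [extendVec_of_not_mem _ ha]]
    refine Finset.sum_congr rfl fun c _ => ?_
    simp only [extendVec_apply]
  rw [h6]
  simp only [red₃, ← Finset.sum_add_distrib, ← Finset.sum_sub_distrib]
  simp only [chainLin, LinearMap.sum_apply, LinearMap.smul_apply, LinearMap.comp_apply,
    AlgHom.toLinearMap_apply, detLin_coords, smul_eq_mul]
  refine Finset.sum_congr rfl fun a _ => Finset.sum_congr rfl fun b _ =>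
    Finset.sum_congr rfl fun c _ => ?_
  ring

/-- The basis vector of `a`, which is zero if `a` is not a vertex. -/
noncomputable def basisVec (K : PreAbstractSimplicialComplex V) (a : V) : vertexSet K → ℝ :=
  fun w => if w.1 = a then 1 else 0

omit [Fintype V] in
theorem basisVec_of_not_mem {a : V} (ha : a ∉ vertexSet K) : basisVec K a = 0 := by
  funext w
  simp only [basisVec, Pi.zero_apply, ite_eq_right_iff, one_ne_zero, imp_false]
  exact fun h => ha (h ▸ w.2)

theorem sum_basisVec (f : vertexSet K → ℝ) : f = ∑ a, extendVec f a • basisVec K a := by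
  funext w
  simp [basisVec, Finset.sum_apply, extendVec_apply]

/-- The alternating function defined by a functional on the exterior face ring. -/
noncomputable def linChain (l : ExteriorFaceRing K →ₗ[ℝ] ℝ) (a b c : V) : ℝ :=
  l (quotientLin K (wedge₃ (basisVec K a) (basisVec K b) (basisVec K c)))

omit [Fintype V] in
-- Alternation is inherited from the exterior algebra and makes repeated indices vanish; on a
-- nonface with distinct vertices the monomial lies in the face ideal.
theorem linChain_isAlt (l : ExteriorFaceRing K →ₗ[ℝ] ℝ) : IsAlt (tri K) (linChain l) := by
  have swap : ∀ a b c, linChain l b a c = -linChain l a b c := by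
    intro a b c
    simp only [linChain]
    rw [← map_neg, ← map_neg]
    congr 2
    rw [wedge₃_eq, wedge₃_eq, ← mul_assoc, ← mul_assoc, ← neg_mul]
    congr 1
    exact eq_neg_of_add_eq_zero_left (ExteriorAlgebra.ι_add_mul_swap _ _)
  have swap' : ∀ a b c, linChain l a c b = -linChain l a b c := by
    intro a b c
    simp only [linChain]
    rw [← map_neg, ← map_neg]
    congr 2
    rw [wedge₃_eq, wedge₃_eq, ← mul_neg]
    congr 1
    exact eq_neg_of_add_eq_zero_left (ExteriorAlgebra.ι_add_mul_swap _ _)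
  refine ⟨swap, swap', fun a b c hne => ?_⟩
  have hab : a ≠ b := by
    rintro rfl
    have := swap a a c
    exact hne (by linarith)
  have hbc : b ≠ c := by
    rintro rfl
    have := swap' a b b
    exact hne (by linarith)
  have hac : a ≠ c := by
    rintro rfl
    have h1 := swap' a a b
    have h2 := swap a a b
    exact hne (by linarith)
  refine ⟨hab, hac, hbc, ?_⟩
  by_contra hK
  refine hne ?_
  by_cases ha : a ∈ vertexSet K
  swap
  · simp [linChain, wedge₃_eq, basisVec_of_not_mem ha]
  by_cases hb : b ∈ vertexSet K
  swap
  · simp [linChain, wedge₃_eq, basisVec_of_not_mem hb]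
  by_cases hc : c ∈ vertexSet K
  swap
  · simp [linChain, wedge₃_eq, basisVec_of_not_mem hc]
  have : wedge₃ (basisVec K a) (basisVec K b) (basisVec K c) ∈ faceIdeal K := by
    refine TwoSidedIdeal.subset_span ⟨3, ⟨![⟨a, ha⟩, ⟨b, hb⟩, ⟨c, hc⟩], ?_⟩, by norm_num, ?_, ?_⟩
    · intro i j hij
      fin_cases i <;> fin_cases j <;>
        simp [hab, hac, hbc, hab.symm, hac.symm, hbc.symm] at hij ⊢
    · convert hK using 2
      ext w
      simp only [Finset.mem_insert, Finset.mem_singleton, eq_comm (a := w)]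
      simp [Fin.exists_fin_succ]
      rfl
    · rw [wedge₃]
      congr 1
      funext i w
      fin_cases i <;> simp [basisVec, Pi.single_apply, Subtype.ext_iff] <;> rfl
  rw [linChain, quotientLin_eq_zero_iff.2 this, map_zero]

theorem pair₃_linChain (l : ExteriorFaceRing K →ₗ[ℝ] ℝ) (f g h : vertexSet K → ℝ) :
    pair₃ (linChain l) (extendVec f) (extendVec g) (extendVec h) =
      l (quotientLin K (wedge₃ f g h)) := by
  conv_rhs => rw [wedge₃_eq, sum_basisVec f, sum_basisVec g, sum_basisVec h]
  rw [map_sum, map_sum, map_sum, Finset.sum_mul_sum, Finset.sum_mul]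
  simp only [Finset.mul_sum, map_sum]
  refine Finset.sum_congr rfl fun a _ => Finset.sum_congr rfl fun b _ =>
    Finset.sum_congr rfl fun c _ => ?_
  simp only [linChain, wedge₃_eq, map_smul, smul_mul_assoc, mul_smul_comm, smul_eq_mul]
  ring

end Functionals

/-! ### Shifting in terms of pairings with chains. -/

section Translation

variable {V : Type*} [Fintype V] [DecidableEq V] {K : PreAbstractSimplicialComplex V}

/-- The rows of a matrix as functions on `V`, for all natural numbers. -/
noncomputable def rows (X : Matrix (Index K) (vertexSet K) ℝ) (i : ℕ) : V → ℝ :=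
  if h : i ∈ Finset.Icc 1 (Nat.card (vertexSet K)) then extendVec (X ⟨i, h⟩) else 0

omit [Fintype V] [DecidableEq V] in
theorem rows_apply (X : Matrix (Index K) (vertexSet K) ℝ) (i : Index K) :
    rows X i = extendVec (X i) := by
  simp only [rows, dif_pos i.2]

omit [Fintype V] [DecidableEq V] in
theorem IsGeneric.gen {X : Matrix (Index K) (vertexSet K) ℝ} (hX : IsGeneric X) {U : Finset V}
    (hU : ∀ a, a ∈ U ↔ a ∈ vertexSet K) :
    Gen (Finset.Icc 1 (Nat.card (vertexSet K))) U (rows X) := by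
  have := hX.comp (fun p : Finset.Icc 1 (Nat.card (vertexSet K)) × U =>
    ((p.1, ⟨p.2.1, (hU _).1 p.2.2⟩) : Index K × vertexSet K)) (by
      rintro ⟨a, b⟩ ⟨c, d⟩ h
      simp only [Prod.mk.injEq, Subtype.mk.injEq] at h
      rw [h.1, Subtype.ext h.2])
  have e : (fun p : Finset.Icc 1 (Nat.card (vertexSet K)) × U => rows X p.1 p.2) =
      fun p => X p.1 ⟨p.2.1, (hU _).1 p.2.2⟩ := by
    funext p
    rw [rows_apply]
    exact extendVec_apply (X p.1) ⟨p.2.1, (hU _).1 p.2.2⟩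
  rw [Gen, e]
  exact this

theorem tripleLT_coe {P : ℕ → Prop} {i j k i' j' k' : Subtype P} :
    TripleLT i' j' k' i j k ↔ i' < i ∨ i' = i ∧ (j' < j ∨ j' = j ∧ k' < k) := by
  simp only [TripleLT, Subtype.coe_lt_coe, Subtype.ext_iff]

theorem map_triple {α β : Type*} [DecidableEq α] [DecidableEq β] (f : α ↪ β) (a b c : α) :
    ({a, b, c} : Finset α).map f = {f a, f b, f c} := by
  rw [Finset.map_insert, Finset.map_insert, Finset.map_singleton]

/-- A vector is outside a span exactly when a linear functional separates them. On triple wedges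
these functionals are alternating functions on triangles: `linChain` gives one direction and
`chainLin` the other. -/
theorem quotient_notMem_span_iff (X : Matrix (Index K) (vertexSet K) ℝ) {i j k : Index K}
    (hij : i < j) (hjk : j < k) :
    (quotientMap K (rowWedge X {i, j, k}) ∉ Submodule.span ℝ
        {y | ∃ t : Finset (Index K), LexLT t {i, j, k} ∧ t.card = ({i, j, k} : Finset _).card ∧
          y = quotientMap K (rowWedge X t)}) ↔
      IsShift (tri K) (rows X) (Nat.card (vertexSet K)) i j k := by
  have hset : {y | ∃ t : Finset (Index K), LexLT t {i, j, k} ∧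
      t.card = ({i, j, k} : Finset (Index K)).card ∧ y = quotientMap K (rowWedge X t)} =
      quotientLin K '' {z | ∃ i' j' k' : Index K, i' < j' ∧ j' < k' ∧
        TripleLT i' j' k' i j k ∧ z = wedge₃ (X i') (X j') (X k')} := by
    ext y
    constructor
    · rintro ⟨t, ht, hc, rfl⟩
      rw [card_triple hij hjk] at hc
      obtain ⟨i', j', k', h1, h2, rfl⟩ := exists_triple hc
      refine ⟨_, ⟨i', j', k', h1, h2, ?_, rfl⟩, by rw [← rowWedge_triple X h1 h2]; rfl⟩
      exact tripleLT_coe.2 ((lexLT_triple hij hjk h1 h2).1 ht)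
    · rintro ⟨_, ⟨i', j', k', h1, h2, hlt, rfl⟩, rfl⟩
      refine ⟨{i', j', k'}, (lexLT_triple hij hjk h1 h2).2 ?_, ?_,
        by rw [← rowWedge_triple X h1 h2]; rfl⟩
      · exact tripleLT_coe.1 hlt
      · rw [card_triple hij hjk, card_triple h1 h2]
  rw [hset, rowWedge_triple X hij hjk, ← Submodule.map_span]
  change quotientLin K _ ∉ _ ↔ _
  constructor
  · intro h
    obtain ⟨l, hl, hle⟩ := Submodule.exists_le_ker_of_notMem h
    refine ⟨linChain l, linChain_isAlt l, fun i' j' k' h1 h2 h3 h4 hlt => ?_, ?_⟩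
    · have hi' : i' ∈ Finset.Icc 1 (Nat.card (vertexSet K)) := Finset.mem_Icc.2 ⟨h1, by omega⟩
      have hj' : j' ∈ Finset.Icc 1 (Nat.card (vertexSet K)) := Finset.mem_Icc.2 ⟨by omega, by omega⟩
      have hk' : k' ∈ Finset.Icc 1 (Nat.card (vertexSet K)) := Finset.mem_Icc.2 ⟨by omega, h4⟩
      have e := pair₃_linChain l (X ⟨i', hi'⟩) (X ⟨j', hj'⟩) (X ⟨k', hk'⟩)
      rw [← rows_apply, ← rows_apply, ← rows_apply] at e
      refine e.trans (LinearMap.mem_ker.1 (hle (Submodule.mem_map_of_mem (Submodule.subset_span ?_))))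
      exact ⟨⟨i', hi'⟩, ⟨j', hj'⟩, ⟨k', hk'⟩, h2, h3, hlt, rfl⟩
    · rw [rows_apply, rows_apply, rows_apply, pair₃_linChain]
      exact hl
  · rintro ⟨m, hm, h0, h1⟩ hmem
    obtain ⟨w, hw, he⟩ := Submodule.mem_map.1 hmem
    have hF : chainLin m w = 0 := by
      have : Submodule.span ℝ {z | ∃ i' j' k' : Index K, i' < j' ∧ j' < k' ∧
          TripleLT i' j' k' i j k ∧ z = wedge₃ (X i') (X j') (X k')} ≤
          LinearMap.ker (chainLin (K := K) m) := by
        refine Submodule.span_le.2 ?_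
        rintro _ ⟨i', j', k', h2, h3, hlt, rfl⟩
        rw [SetLike.mem_coe, LinearMap.mem_ker, chainLin_wedge₃ hm, ← rows_apply, ← rows_apply,
          ← rows_apply, h0 i' j' k' (Finset.mem_Icc.1 i'.2).1 h2 h3 (Finset.mem_Icc.1 k'.2).2 hlt,
          mul_zero]
      exact LinearMap.mem_ker.1 (this hw)
    have h2 := chainLin_eq_zero hm (z := w - wedge₃ (X i) (X j) (X k)) (by
      rw [map_sub, he, sub_self])
    rw [map_sub, hF, chainLin_wedge₃ hm, ← rows_apply, ← rows_apply, ← rows_apply] at h2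
    apply h1
    linarith

theorem triple_mem_exteriorShift_iff (X : Matrix (Index K) (vertexSet K) ℝ) {i j k : ℕ}
    (hij : i < j) (hjk : j < k) : ({i, j, k} : Finset ℕ) ∈ exteriorShift X ↔
      1 ≤ i ∧ k ≤ Nat.card (vertexSet K) ∧
        IsShift (tri K) (rows X) (Nat.card (vertexSet K)) i j k := by
  constructor
  · rintro ⟨s, hs, h⟩
    have hc : s.card = 3 := by
      rw [← Finset.card_map (Function.Embedding.subtype _), ← hs, card_triple hij hjk]
    obtain ⟨a, b, c, hab, hbc, rfl⟩ := exists_triple hc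
    have hs' : ({i, j, k} : Finset ℕ) = {a.1, b.1, c.1} := by
      rw [hs]
      exact map_triple _ a b c
    have hab' : a.1 < b.1 := hab
    have hbc' : b.1 < c.1 := hbc
    have m1 : i ∈ ({a.1, b.1, c.1} : Finset ℕ) := by simp [← hs']
    have m2 : j ∈ ({a.1, b.1, c.1} : Finset ℕ) := by simp [← hs']
    have m3 : k ∈ ({a.1, b.1, c.1} : Finset ℕ) := by simp [← hs']
    simp only [Finset.mem_insert, Finset.mem_singleton] at m1 m2 m3
    obtain ⟨rfl, rfl, rfl⟩ : i = a.1 ∧ j = b.1 ∧ k = c.1 := by omega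
    exact ⟨(Finset.mem_Icc.1 a.2).1, (Finset.mem_Icc.1 c.2).2,
      (quotient_notMem_span_iff X hab hbc).1 h⟩
  · rintro ⟨h1, h2, h⟩
    let a : Index K := ⟨i, Finset.mem_Icc.2 ⟨h1, by omega⟩⟩
    let b : Index K := ⟨j, Finset.mem_Icc.2 ⟨by omega, by omega⟩⟩
    let c : Index K := ⟨k, Finset.mem_Icc.2 ⟨by omega, h2⟩⟩
    exact ⟨{a, b, c}, (map_triple (Function.Embedding.subtype _) a b c).symm,
      (quotient_notMem_span_iff X (i := a) (j := b) (k := c) hij hjk).2 h⟩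

/-- Reduces the tail to the cases treated separately: smallest element 1 and second at least 4, or
smallest element at least 2. Triples containing 0 must be absent from both sets. -/
theorem lexTail_eq_of_triples {S S' : Set (Finset ℕ)}
    (h : ∀ i j k, i < j → j < k → (i = 0 → {i, j, k} ∉ S ∧ {i, j, k} ∉ S') ∧
      (1 ≤ i → (i = 1 → 4 ≤ j) → ({i, j, k} ∈ S ↔ {i, j, k} ∈ S'))) :
    lexTail S {1, 4, 5} = lexTail S' {1, 4, 5} := by
  ext δ
  have h145 : ({1, 4, 5} : Finset ℕ).card = 3 := rfl
  simp only [lexTail, Set.mem_ofPred_eq, h145]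
  refine and_congr_left ?_
  rintro ⟨hc, hlex⟩
  obtain ⟨i, j, k, hij, hjk, rfl⟩ := exists_triple hc
  rcases Nat.eq_zero_or_pos i with hi | hi
  · have := (h i j k hij hjk).1 hi
    exact iff_of_false this.1 this.2
  · refine (h i j k hij hjk).2 hi fun h1 => ?_
    rcases hlex with he | hlt
    · have hj : j ∈ ({1, 4, 5} : Finset ℕ) := by simp [← he]
      simp only [Finset.mem_insert, Finset.mem_singleton] at hj
      omega
    · rw [lexLT_triple hij hjk (by norm_num) (by norm_num)] at hlt
      omega

end Translation

/-! ### Assembly, with either endpoint of the edge interior. -/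

section Main

variable {V : Type*} [Fintype V] [DecidableEq V]

omit [Fintype V] [DecidableEq V] in
theorem Contractible.symm {t : V → V → V → Prop} (h : IsSurf t) {u v : V}
    (hc : Contractible t u v) : Contractible t v u where
  edge := h.E_symm hc.edge
  miss w h1 h2 := h.swap _ _ _ (hc.miss w h2 h1)
  tetra a b hab h1 h2 h3 h4 := hc.tetra a b hab (h.swap _ _ _ h1) (h.swap _ _ _ h2) h4 h3

omit [Fintype V] in
theorem Gen.relabel {I : Finset ℕ} {U : Finset V} {u v : V} {y : ℕ → V → ℝ}
    (hy : Gen I (U.erase v) y) (hu : u ∈ U) :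
    Gen I (U.erase u) fun i a => y i (Equiv.swap u v a) := by
  have mem : ∀ a ∈ U.erase u, Equiv.swap u v a ∈ U.erase v := by
    intro a ha
    obtain ⟨h1, h2⟩ := Finset.mem_erase.1 ha
    by_cases hav : a = v
    · rw [hav, Equiv.swap_apply_right]
      exact Finset.mem_erase.2 ⟨fun h => h1 (hav.trans h.symm), hu⟩
    · rw [Equiv.swap_apply_of_ne_of_ne h1 hav]
      exact Finset.mem_erase.2 ⟨hav, h2⟩
  exact hy.comp (fun p : I × (U.erase u : Finset V) =>
    ((p.1, ⟨Equiv.swap u v p.2, mem _ p.2.2⟩) : I × (U.erase v : Finset V))) (by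
      rintro ⟨a, b⟩ ⟨c, d⟩ h
      simp only [Prod.mk.injEq, Subtype.mk.injEq, EmbeddingLike.apply_eq_iff_eq] at h
      rw [h.1, Subtype.ext h.2])

/-- The contraction always removes `v`, whereas the comparison needs the removed vertex to be
interior. When only `u` is known to be interior, one contracts the other way and relabels. -/
theorem isShift_contr_symm_iff {t : V → V → V → Prop} {u v : V} {y : ℕ → V → ℝ} {n i j k : ℕ} :
    IsShift (contr t v u) (fun i a => y i (Equiv.swap u v a)) n i j k ↔
      IsShift (contr t u v) y n i j k := by
  rw [contr_symm t u v]
  refine ⟨fun h => ?_, fun h => h.relabel _⟩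
  simpa using h.relabel (Equiv.swap u v)

/-- Contracting an edge in the interior of a disk bounded by a triangle does not affect the tail of
the exterior shifting. -/
theorem lexTail_exteriorShift_contract {K D : PreAbstractSimplicialComplex V}
    (hK : IsTriangulatedSurface K) (hDK : D ≤ K) (hpure : IsPureTwoDim D) (hdisk : IsDisk D)
    (hbdry : HasTriangleBoundary D) {u v : V} (hint : IsInternalEdge D {u, v})
    (hcontr : IsContractible K u v) {X : Matrix (Index K) (vertexSet K) ℝ} (hX : IsGeneric X)
    {X' : Matrix (Index (contract K u v)) (vertexSet (contract K u v)) ℝ} (hX' : IsGeneric X') :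
    lexTail (exteriorShift X) {1, 4, 5} = lexTail (exteriorShift X') {1, 4, 5} := by
  classical
  obtain ⟨T, hT, hbdry⟩ := hbdry
  have hS := hK.isSurf
  have hc := hcontr.contractible hK
  have huv := hcontr.1
  have hu : u ∈ vertexSet K := hK.mem_vertexSet.2 ⟨v, hc.edge⟩
  have hv : v ∈ vertexSet K := hK.mem_vertexSet.2 ⟨u, hS.E_symm hc.edge⟩
  let U : Finset V := Finset.univ.filter (· ∈ vertexSet K)
  have hU : ∀ a, a ∈ U ↔ a ∈ vertexSet K := fun a => by simp [U]
  have hUE : ∀ a, a ∈ U ↔ ∃ b, E (tri K) a b := fun a => (hU a).trans hK.mem_vertexSet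
  have hU' : ∀ a, a ∈ U.erase v ↔ a ∈ vertexSet (contract K u v) := fun a => by
    rw [mem_vertexSet_contract hu huv, Finset.mem_erase, hU, and_comm]
  have card_eq : ∀ (L : PreAbstractSimplicialComplex V) (W : Finset V),
      (∀ a, a ∈ W ↔ a ∈ vertexSet L) → W.card = Nat.card (vertexSet L) := by
    intro L W hW
    rw [Nat.card_eq_fintype_card, Fintype.card_of_subtype W hW]
  have hn := card_eq K U hU
  have hn' : Nat.card (vertexSet (contract K u v)) = Nat.card (vertexSet K) - 1 := by
    rw [← card_eq _ _ hU', Finset.card_erase_of_mem ((hU v).2 hv), hn]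
  have hx := hX.gen hU
  have hy := hX'.gen hU'
  rw [hn'] at hy
  have h2 := hdisk.trivialH1 (ZMod 2)
  have hR := hdisk.trivialH1 ℝ
  refine lexTail_eq_of_triples fun i j k hij hjk => ⟨fun hi => ?_, fun hi hj => ?_⟩
  · rw [triple_mem_exteriorShift_iff X hij hjk, triple_mem_exteriorShift_iff X' hij hjk]
    omega
  rw [triple_mem_exteriorShift_iff X hij hjk, triple_mem_exteriorShift_iff X' hij hjk, hn',
    tri_contract]
  refine and_congr_right fun _ => ?_
  obtain ⟨w, hw, hwint⟩ := hint.2.2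
  obtain ⟨hP, hwT, hwD⟩ := hK.patch hDK hpure hT hbdry hwint
  rcases Finset.mem_insert.1 hw with rfl | hw
  · have := isShift_contr_iff hS hP hUE hn hx (hy.relabel ((hU w).2 hu)) h2 hR
      (hc.symm hS) hwT hwD hi hij hjk hj
    rwa [isShift_contr_symm_iff] at this
  · obtain rfl := Finset.mem_singleton.1 hw
    exact isShift_contr_iff hS hP hUE hn hx hy h2 hR hc hwT hwD hi hij hjk hj

end Main

end ExtShift

theorem mainTheorem9 {V : Type*} [Fintype V] [DecidableEq V]
    (K D : PreAbstractSimplicialComplex V)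
    (hK : ExtShift.IsTriangulatedSurface K)
    (hDK : D ≤ K) (hpure : ExtShift.IsPureTwoDim D)
    (hdisk : ExtShift.IsDisk D) (hbdry : ExtShift.HasTriangleBoundary D)
    (u v : V) (hint : ExtShift.IsInternalEdge D {u, v})
    (hcontr : ExtShift.IsContractible K u v)
    (X : Matrix (ExtShift.Index K) (ExtShift.vertexSet K) ℝ) (hX : ExtShift.IsGeneric X)
    (X' : Matrix (ExtShift.Index (ExtShift.contract K u v))
      (ExtShift.vertexSet (ExtShift.contract K u v)) ℝ) (hX' : ExtShift.IsGeneric X') :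
    ExtShift.lexTail (ExtShift.exteriorShift X) {1, 4, 5} =
      ExtShift.lexTail (ExtShift.exteriorShift X') {1, 4, 5} :=
  ExtShift.lexTail_exteriorShift_contract hK hDK hpure hdisk hbdry hint hcontr hX hX'
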